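/- **Weighted centroid distance estimation.** Let $x_1,\dots,x_N\in\mathbb R^d$ ($N\ge 1$) be the examples (the rows of $X$), let $w\in\mathbb R^d$ be a weight vector with $\|w\|=1$, and let $c_1,\dots,c_k\in\mathbb R^d$ be centroids with $\|c_j\|\le\max_i\|x_i\|$ for all $j$ (as holds for any points in the convex hull of the examples). Put $\eta_1=\max_i\|x_i\|^2$, let $c_{j,w}=w\circ c_j$ be the weighted centroids (entrywise product), and let $I_w(x_i,c_j)=\sum_{l=1}^d w_l x_{il}c_{jl}=\langle x_i,c_{j,w}\rangle$. Quantum access to vectors $v_1,\dots,v_n\in\mathbb R^d$ means: one can apply, with a control qubit, a unitary which keeps the index register and maps $|i\rangle|0\rangle\mapsto|i\rangle\,\|v_i\|^{-1}\sum_l v_{il}|l\rangle$ for every $i$ with $v_i\ne0$, as well as its adjoint, and one can query the binary digits of the norm, $|i\rangle|z\rangle\mapsto|i\rangle|z\oplus b\rangle$ with $b$ a chosen binary digit of $\|v_i\|$. An algorithm is a quantum circuit (unitary, without intermediate measurements) that is fixed given $N,d,k,\eta_1,\varepsilon_1,\Delta$ and the query times, and sees the data only through queries. Its running time counts $1$ for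 each elementary gate (a unitary on at most three qubits), $T$ for each query to $X$, and $T_c$ for each query to the weighted centroids, where $0\le T_c\le T$, $T\ge1$ and $T\ge\lceil\log_2 d\rceil$ (the number of qubits of $|x_i\rangle$). There is a universal constant $C$ such that, for all $N,d,k,T,T_c,\eta_1$ as above, all $\varepsilon_1>0$ and all $0<\Delta\le1$, there is such an algorithm of running time $$T_{cd}\;\le\; C\,T\,k\,\frac{\eta_1}{\varepsilon_1}\,\log\frac1\Delta$$ which, for all examples with $\max_i\|x_i\|^2=\eta_1$ and all $w,c_1,\dots,c_k$ as above, performs $$\frac1{\sqrt N}\sum_{i=1}^N|i\rangle\bigotimes_{j=1}^k\big(|j\rangle|0\rangle\big)\;\longmapsto\;\frac1{\sqrt N}\sum_{i=1}^N|i\rangle\bigotimes_{j=1}^k\big(|j\rangle|\Psi_{ij}\rangle\big),$$ where $\Psi_{ij}$ is a unit vector in the state space of a value register together with work qubits, and, for every $i$ and $j$, measuring the value register of $\Psi_{ij}$ (read as a binary fixed-point number, in two's complement) gives an estimate $\overline{I_w(x_i,c_j)}$ with $|\overline{I_w(x_i,c_j)}-I_w(x_i,c_j)|\le\varepsilon_1$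 with probability at least $1-2\Delta$. **Depth-$l$ variant.** Likewise, for every $l\ge0$, with $k^l$ centroids $c_1,\dots,c_{k^l}$ in place of $k$, there is such an algorithm of running time at most $C\,T\,k^l\,\frac{\eta_1}{\varepsilon_1}\log\frac1\Delta$, with $C$ a universal constant. -/

import Mathlib

open scoped BigOperators

noncomputable section

namespace QCentroid

/-- The computational-basis code of `i ∈ {0, …, n-1}` in a register of `⌈log₂ n⌉` qubits. -/
def code (n : ℕ) (i : Fin n) : Fin (Nat.clog 2 n) → Bool :=
  fun b => Nat.testBit (i : ℕ) (b : ℕ)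

/-- The amplitude encoding `|v⟩ = ‖v‖⁻¹ ∑ l, v l |l⟩` of a real vector
(only used for `v ≠ 0`). -/
def amplitudeState {d : ℕ} (v : EuclideanSpace ℝ (Fin d)) :
    (Fin (Nat.clog 2 d) → Bool) → ℂ :=
  fun y => ∑ l : Fin d, if y = code d l then ((v l / ‖v‖ : ℝ) : ℂ) else 0

/-- The binary digit of weight `2 ^ (-s)` of a nonnegative real number `r`. -/
def binaryDigit (r : ℝ) (s : ℤ) : Bool :=
  decide (⌊r * (2 : ℝ) ^ s⌋ % 2 = 1)

/-- Quantum access to the vectors `v 0, …, v (n-1)` of `ℝ^d`: a unitary that, controlled on the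
index register, performs `|i⟩|0⟩ ↦ |i⟩|v i⟩`, and the norms of the vectors, stored in binary.
Nothing is assumed about indices outside `{0, …, n-1}`, about the action of the unitary on
`|i⟩|y⟩` with `y ≠ 0` (beyond keeping the index register), or about the state prepared for a zero
vector. -/
structure QuantumAccess {n d : ℕ} (v : Fin n → EuclideanSpace ℝ (Fin d)) where
  prepare : (Fin (Nat.clog 2 n) → Bool) →
    Matrix.unitaryGroup (Fin (Nat.clog 2 d) → Bool) ℂ
  prepare_spec : ∀ i : Fin n, v i ≠ 0 → ∀ y : Fin (Nat.clog 2 d) → Bool,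
    (prepare (code n i)).1 y (fun _ => false) = amplitudeState (v i) y
  normDigit : (Fin (Nat.clog 2 n) → Bool) → ℤ → Bool
  normDigit_spec : ∀ (i : Fin n) (s : ℤ), normDigit (code n i) s = binaryDigit ‖v i‖ s

/-- A (not necessarily normalized) state vector of a family of qubits indexed by `W`. -/
abbrev QState (W : Type) : Type := (W → Bool) → ℂ

/-- The operator with matrix `u` applied to the qubits `e i`, the other qubits being untouched. -/
def applyOn {W ι : Type} [Fintype ι] [DecidableEq ι] (e : ι → W)
    (u : Matrix (ι → Bool) (ι → Bool) ℂ) (ψ : QState W) : QState W :=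
  fun x => ∑ y : ι → Bool, u (x ∘ e) y * ψ (Function.extend e y x)

/-- A single query to a quantum access for `n` vectors of `ℝ^d`, in a circuit with qubits `W`.
* `state adj e`: the state-preparation unitary (its adjoint if `adj = true`), with control qubit,
  index register and target register placed by `e`, these being pairwise distinct qubits;
* `norm s e`: `|i⟩|z⟩ ↦ |i⟩|z ⊕ b⟩`, with `b` the binary digit of weight `2 ^ (-s)` of the `i`-th
  norm, and with target qubit and index register placed by `e`. -/
inductive Query (n d : ℕ) (W : Type) : Type
  | state (adj : Bool) (e : (Unit ⊕ Fin (Nat.clog 2 n) ⊕ Fin (Nat.clog 2 d)) ↪ W) : Query n d W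
  | norm (s : ℤ) (e : (Unit ⊕ Fin (Nat.clog 2 n)) ↪ W) : Query n d W

open Classical in
/-- The action of a query on state vectors. -/
def Query.apply {n d : ℕ} {W : Type} {v : Fin n → EuclideanSpace ℝ (Fin d)}
    (A : QuantumAccess v) : Query n d W → QState W → QState W
  | .state adj e, ψ => fun x =>
      if x (e (Sum.inl ())) = true then
        applyOn (fun t => e (Sum.inr (Sum.inr t)))
          (if adj = true
            then (A.prepare (fun b => x (e (Sum.inr (Sum.inl b))))).1.conjTranspose
            else (A.prepare (fun b => x (e (Sum.inr (Sum.inl b))))).1) ψ x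
      else ψ x
  | .norm s e, ψ => fun x =>
      ψ (Function.update x (e (Sum.inl ()))
        (xor (x (e (Sum.inl ()))) (A.normDigit (fun b => x (e (Sum.inr b))) s)))

/-- The instructions of a quantum algorithm with access to `N` examples and `k` weighted centroids
in `ℝ^d`: elementary gates, i.e. arbitrary unitaries on at most three qubits, and queries. -/
inductive Gate (N d k : ℕ) (W : Type) : Type
  | elementary (r : ℕ) (hr : r ≤ 3) (e : Fin r ↪ W)
      (u : Matrix.unitaryGroup (Fin r → Bool) ℂ) : Gate N d k W
  | row (q : Query N d W) : Gate N d k W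
  | centroid (q : Query k d W) : Gate N d k W

/-- The action of an instruction on state vectors. -/
def Gate.apply {N d k : ℕ} {W : Type} {v : Fin N → EuclideanSpace ℝ (Fin d)}
    {c : Fin k → EuclideanSpace ℝ (Fin d)} (A : QuantumAccess v) (B : QuantumAccess c) :
    Gate N d k W → QState W → QState W
  | .elementary _ _ e u, ψ => applyOn e u.1 ψ
  | .row q, ψ => q.apply A ψ
  | .centroid q, ψ => q.apply B ψ

/-- The time of an instruction: `1` for an elementary gate, `T` for a query to the examples, `Tc`
for a query to the weighted centroids. -/
def Gate.time {N d k : ℕ} {W : Type} (T Tc : ℝ) : Gate N d k W → ℝ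
  | .elementary _ _ _ _ => 1
  | .row _ => T
  | .centroid _ => Tc

/-- A quantum circuit: the list of its instructions, in the order of execution. -/
abbrev Circuit (N d k : ℕ) (W : Type) : Type := List (Gate N d k W)

/-- The result of running a circuit on an initial state. -/
def Circuit.run {N d k : ℕ} {W : Type} {v : Fin N → EuclideanSpace ℝ (Fin d)}
    {c : Fin k → EuclideanSpace ℝ (Fin d)} (A : QuantumAccess v) (B : QuantumAccess c)
    (P : Circuit N d k W) (ψ : QState W) : QState W :=
  P.foldl (fun φ g => g.apply A B φ) ψ

/-- The running time of a circuit. -/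
def Circuit.time {N d k : ℕ} {W : Type} (T Tc : ℝ) (P : Circuit N d k W) : ℝ :=
  (P.map (Gate.time T Tc)).sum

/-- The qubits of one output block: a value register of `p + 1` qubits and `a` work qubits. -/
abbrev OutWire (p a : ℕ) : Type := Fin (p + 1) ⊕ Fin a

/-- All the qubits: the register holding the index `i` of an example, and for each `j : Fin k` a
register holding the label `j`, a value register, and work qubits. -/
abbrev Wire (N k p a : ℕ) : Type :=
  Fin (Nat.clog 2 N) ⊕ (Fin k × (Fin (Nat.clog 2 k) ⊕ OutWire p a))

/-- The state `N^{-1/2} ∑ i, |i⟩ ⊗_j (|j⟩ ⊗ Φ i j)`, with `Φ i j` a state of the value register and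
the work qubits of block `j`. -/
def superposition (N k p a : ℕ) (Φ : Fin N → Fin k → QState (OutWire p a)) :
    QState (Wire N k p a) :=
  fun x => ((1 / Real.sqrt N : ℝ) : ℂ) * ∑ i : Fin N,
    (if (fun b => x (Sum.inl b)) = code N i then 1 else 0) *
      ∏ j : Fin k,
        ((if (fun b => x (Sum.inr (j, Sum.inl b))) = code k j then 1 else 0) *
          Φ i j (fun b => x (Sum.inr (j, Sum.inr b))))

/-- The basis state `|0…0⟩`. -/
def zeroState (W : Type) [Fintype W] : QState W :=
  fun x => if x = (fun _ => false) then 1 else 0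

/-- The real number held by a value register in basis state `y`, in two's complement fixed-point
notation with least significant bit of weight `2 ^ (-f)`. -/
def fixedPoint {p : ℕ} (f : ℤ) (y : Fin (p + 1) → Bool) : ℝ :=
  (2 : ℝ) ^ (-f) *
    ((∑ b : Fin p, if y b.castSucc = true then (2 : ℝ) ^ (b : ℕ) else 0) -
      (if y (Fin.last p) = true then (2 : ℝ) ^ p else 0))

open Classical in
/-- The probability that measuring the value register of the state `φ` gives a number that is
within `ε` of `μ`. -/
def probClose {p a : ℕ} (f : ℤ) (φ : QState (OutWire p a)) (μ ε : ℝ) : ℝ :=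
  ∑ y : OutWire p a → Bool,
    if |fixedPoint f (fun b => y (Sum.inl b)) - μ| ≤ ε then ‖φ y‖ ^ 2 else 0

/-- The weighted inner product `I_w(x, c) = ∑ l, w l * x l * c l`. -/
def weightedInner {d : ℕ} (w x c : EuclideanSpace ℝ (Fin d)) : ℝ :=
  ∑ l : Fin d, w l * x l * c l

/-- The weighted centroid `w ∘ c` (entrywise product). -/
def weightedCentroid {d : ℕ} (w c : EuclideanSpace ℝ (Fin d)) : EuclideanSpace ℝ (Fin d) :=
  WithLp.toLp 2 (fun l => w l * c l)

/-- The largest squared norm of an example. -/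
def maxSqNorm {N d : ℕ} (x : Fin N → EuclideanSpace ℝ (Fin d)) : ℝ :=
  ⨆ i : Fin N, ‖x i‖ ^ 2

/-- There is a quantum algorithm for `N` examples and `k` centroids in `ℝ^d` of running time at
most `bound` which, for all examples with largest squared norm `η`, all unit weight vectors, all
centroids that are no longer than the longest example, and whatever the unitaries that give access
to the data are, performs
`N^{-1/2} ∑ i, |i⟩ ⊗_j |j⟩|0⟩ ↦ N^{-1/2} ∑ i, |i⟩ ⊗_j |j⟩|Ψ i j⟩`,
where measuring the value register of `Ψ i j` gives a number within `ε` of `I_w(x i, c j)` with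
probability at least `1 - 2 * Δ`. The algorithm is fixed before the data and sees them only
through queries. -/
def EstimatesWithin (N d k : ℕ) (T Tc η ε Δ bound : ℝ) : Prop :=
  ∃ (p a : ℕ) (f : ℤ) (P : Circuit N d k (Wire N k p a)),
    P.time T Tc ≤ bound ∧
    ∀ (x : Fin N → EuclideanSpace ℝ (Fin d)) (w : EuclideanSpace ℝ (Fin d))
      (c : Fin k → EuclideanSpace ℝ (Fin d)),
      maxSqNorm x = η → ‖w‖ = 1 → (∀ j, ‖c j‖ ^ 2 ≤ maxSqNorm x) →
      ∀ (A : QuantumAccess x) (B : QuantumAccess (fun j => weightedCentroid w (c j))),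
        ∃ Ψ : Fin N → Fin k → QState (OutWire p a),
          P.run A B (superposition N k p a (fun _ _ => zeroState (OutWire p a))) =
            superposition N k p a Ψ ∧
          ∀ (i : Fin N) (j : Fin k),
            (∑ y, ‖Ψ i j y‖ ^ 2 = 1) ∧
            1 - 2 * Δ ≤ probClose f (Ψ i j) (weightedInner w (x i) (c j)) ε

end QCentroid

end

/-!
The estimate `I_w(x, c) = ‖x‖ ‖w ∘ c‖ s`, with `s` the inner product of the normalized vectors, is
computed in each block from the leading digits of the two norms, which can be queried, and from an
approximation of `s`, which is found by a variant of phase estimation without Fourier transform.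

The rotation. An ancilla selects one of the two state-preparation unitaries, `U 0` for the example
and `U 1` for the weighted centroid. The involution `U† X U`, with `X` the flip of the ancilla,
followed by the reflection about `|+⟩|0⟩`, is an operator that four queries perform
(`implLogical_rotate`). The start state `|+⟩|0⟩` is the sum of two orthogonal eigenvectors with
eigenvalues `exp (i θ)`, where `cos θ = s` in both cases (`exists_eigenvectors`). All the tests
below act diagonally on eigenvectors, so that the final distribution is a mixture of two product
distributions, one for each eigenvector (`exists_blockCircuit`).

The tests. A Hadamard test of the power `2 ^ v` of the rotation, with an additional phase `1` or
`-i`, gives a bit whose expectation shows the sign of `cos (2 ^ v θ)` or `sin (2 ^ v θ)` unless the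
latter is small. The majority of `R` repetitions is wrong with probability at most `(49 / 50) ^ R`
(`productProb_not_signBit_le`). From sign bits that may be arbitrary where the cosine or sine is
below `sin (π / 10)` in absolute value, but are correct elsewhere, the binary digits of
`θ / (2 π)` can be decoded, starting with the least significant one: at each step the angle is
known up to a half turn, and one of the two sign bits decides (`cos_decodedAngle_close`).

The running time. For precision `ε` about `log₂ (η / ε)` digits are needed. The test with power
`2 ^ v` is repeated about `log (1 / Δ) 2 ^ (u / 2)` times, where `u` counts the steps from the
highest power; so the failure probabilities have sum at most `Δ` (`sum_failure_le`), and the time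
is a geometric sum dominated by the highest power, which is `O(T (η / ε) log (1 / Δ))`
(`tests_time_le`). There is no factor `log log (η / ε)`, as there would be with equally many
repetitions.

The classical part. Majorities, decoding and multiplications are written as a straight-line program
over Boolean functions and then carried out by gates on three qubits (`Computes.exists_flips`).
The cosine of the decoded angle comes from tables for the two halves of its digits and the addition
theorem: a table for all digits together would have about `η / ε` entries for each of the output
digits, whereas the two tables have `√(η / ε)` entries only, so that the program has length
`O(log (1 / Δ) η / ε)` (`program_length_le`).

No gate depends on the data, and the blocks share only the index register, which no gate changes;
hence the circuit of one block, run on the blocks in turn, acts on the superposition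
(`run_allBlocks`). If `η ≤ ε` or `Δ ≥ 1 / 2`, the empty circuit is good enough.
-/

noncomputable section

namespace QCentroid

/-! ### Circuits on one output block -/

section BlockCircuits

/-- The part of the data that one output block sees: the state-preparation unitary and the digits
of the norm of one example (at `false`) and of one weighted centroid (at `true`). -/
structure BlockData (m : ℕ) where
  prep : Bool → Matrix.unitaryGroup (Fin m → Bool) ℂ
  digit : Bool → ℤ → Bool

/-- An instruction that touches only the qubits `V` of one output block, apart from the index and
label registers that address a query. The Boolean argument of a query tells whether the centroids
(`true`) or the examples (`false`) are queried. -/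
inductive BlockGate (m : ℕ) (V : Type) : Type
  | elementary (r : ℕ) (hr : r ≤ 3) (e : Fin r ↪ V)
      (u : Matrix.unitaryGroup (Fin r → Bool) ℂ) : BlockGate m V
  | state (c adj : Bool) (e : (Unit ⊕ Fin m) ↪ V) : BlockGate m V
  | norm (c : Bool) (s : ℤ) (w : V) : BlockGate m V

variable {m : ℕ} {V : Type}

open Classical in
/-- The action of a block instruction on the states of the block, for given data. -/
def BlockGate.apply (D : BlockData m) : BlockGate m V → QState V → QState V
  | .elementary _ _ e u, ψ => applyOn e u.1 ψ
  | .state c adj e, ψ => fun x =>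
      if x (e (Sum.inl ())) = true then
        applyOn (fun t => e (Sum.inr t))
          (if adj = true then (D.prep c).1.conjTranspose else (D.prep c).1) ψ x
      else ψ x
  | .norm c s w, ψ => fun x => ψ (Function.update x w (xor (x w) (D.digit c s)))

/-- The time of a block instruction when every query costs `T`. -/
def BlockGate.time (T : ℝ) : BlockGate m V → ℝ
  | .elementary _ _ _ _ => 1
  | .state _ _ _ => T
  | .norm _ _ _ => T

/-- Running a list of block instructions. -/
def blockRun (D : BlockData m) (P : List (BlockGate m V)) (ψ : QState V) : QState V :=
  P.foldl (fun φ g => g.apply D φ) ψ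

/-- The running time of a list of block instructions. -/
def blockTime (T : ℝ) (P : List (BlockGate m V)) : ℝ :=
  (P.map (BlockGate.time T)).sum

theorem applyOn_add {W ι : Type} [Fintype ι] [DecidableEq ι] (e : ι → W)
    (u : Matrix (ι → Bool) (ι → Bool) ℂ) (ψ φ : QState W) :
    applyOn e u (ψ + φ) = applyOn e u ψ + applyOn e u φ := by
  funext x
  simp [applyOn, mul_add, Finset.sum_add_distrib]

theorem applyOn_smul {W ι : Type} [Fintype ι] [DecidableEq ι] (e : ι → W)
    (u : Matrix (ι → Bool) (ι → Bool) ℂ) (c : ℂ) (ψ : QState W) :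
    applyOn e u (c • ψ) = c • applyOn e u ψ := by
  funext x
  simp [applyOn, Finset.mul_sum, mul_left_comm]

theorem BlockGate.apply_add (D : BlockData m) (g : BlockGate m V) (ψ φ : QState V) :
    g.apply D (ψ + φ) = g.apply D ψ + g.apply D φ := by
  cases g with
  | elementary r hr e u => exact applyOn_add _ _ _ _
  | state c adj e =>
    funext x
    simp only [BlockGate.apply, applyOn_add, Pi.add_apply]
    split_ifs <;> rfl
  | norm c s w => rfl

theorem BlockGate.apply_smul (D : BlockData m) (g : BlockGate m V) (c : ℂ) (ψ : QState V) :
    g.apply D (c • ψ) = c • g.apply D ψ := by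
  cases g with
  | elementary r hr e u => exact applyOn_smul _ _ _ _
  | state c adj e =>
    funext x
    simp only [BlockGate.apply, applyOn_smul, Pi.smul_apply]
    split_ifs <;> rfl
  | norm c s w => rfl

theorem blockRun_add (D : BlockData m) (P : List (BlockGate m V)) (ψ φ : QState V) :
    blockRun D P (ψ + φ) = blockRun D P ψ + blockRun D P φ := by
  induction P generalizing ψ φ with
  | nil => rfl
  | cons g P ih =>
    simp only [blockRun, List.foldl_cons] at ih ⊢
    rw [BlockGate.apply_add, ih]

theorem BlockGate.apply_sum {ι : Type} (D : BlockData m) (g : BlockGate m V) (s : Finset ι)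
    (c : ι → ℂ) (ψ : ι → QState V) :
    g.apply D (fun x => ∑ i ∈ s, c i * ψ i x) = fun x => ∑ i ∈ s, c i * g.apply D (ψ i) x := by
  let f : QState V →ₗ[ℂ] QState V :=
    { toFun := g.apply D, map_add' := g.apply_add D, map_smul' := g.apply_smul D }
  have h := map_sum f (fun i => c i • ψ i) s
  have h1 : (fun x => ∑ i ∈ s, c i * ψ i x) = ∑ i ∈ s, c i • ψ i := by
    funext x; simp
  have h2 : ∀ i, f (c i • ψ i) = c i • g.apply D (ψ i) := fun i => g.apply_smul D _ _
  rw [h1]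
  change f _ = _
  rw [h]
  funext x
  simp [h2]

/-! ### Running block circuits on the superposition -/

theorem extend_comp_embedding {W U : Type} {ι : Type} (g : U ↪ W) (e : ι → U)
    (he : Function.Injective e) (y : ι → Bool) (x : W → Bool) :
    Function.extend (fun t => g (e t)) y x
      = Function.extend g (Function.extend e y (fun v => x (g v))) x := by
  classical
  have hge : Function.Injective (fun t => g (e t)) := g.injective.comp he
  funext w
  by_cases hw : ∃ v, g v = w
  · obtain ⟨v, rfl⟩ := hw
    rw [g.injective.extend_apply]
    by_cases hv : ∃ t, e t = v
    · obtain ⟨t, rfl⟩ := hv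
      rw [he.extend_apply]
      exact hge.extend_apply y x t
    · rw [Function.extend_apply' _ _ _ hv, Function.extend_apply']
      rintro ⟨t, ht⟩
      exact hv ⟨t, g.injective ht⟩
  · rw [Function.extend_apply' _ _ _ hw, Function.extend_apply']
    rintro ⟨t, ht⟩
    exact hw ⟨e t, ht⟩

theorem applyOn_comp_embedding {W U : Type} {ι : Type} [Fintype ι] [DecidableEq ι] (g : U ↪ W)
    (e : ι → U) (he : Function.Injective e) (u : Matrix (ι → Bool) (ι → Bool) ℂ) (ψ : QState W)
    (x : W → Bool) :
    applyOn (fun t => g (e t)) u ψ x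
      = applyOn e u (fun z => ψ (Function.extend g z x)) (fun v => x (g v)) := by
  simp only [applyOn, extend_comp_embedding g e he]
  rfl

theorem extend_self {W U : Type} (g : U ↪ W) (x : W → Bool) :
    Function.extend g (fun v => x (g v)) x = x := by
  funext w
  by_cases hw : ∃ v, g v = w
  · obtain ⟨v, rfl⟩ := hw
    rw [g.injective.extend_apply]
  · rw [Function.extend_apply' _ _ _ hw]

theorem extend_update {W U : Type} [DecidableEq W] [DecidableEq U] (g : U ↪ W) (v : U) (b : Bool)
    (x : W → Bool) :
    Function.extend g (Function.update (fun v => x (g v)) v b) x = Function.update x (g v) b := by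
  funext w
  by_cases hw : ∃ v, g v = w
  · obtain ⟨v', rfl⟩ := hw
    rw [g.injective.extend_apply]
    by_cases h : v' = v
    · subst h; simp
    · rw [Function.update_of_ne h, Function.update_of_ne (fun h' => h (g.injective h'))]
  · rw [Function.extend_apply' _ _ _ hw, Function.update_of_ne]
    rintro rfl
    exact hw ⟨v, rfl⟩

variable {N d k p a : ℕ}

/-- The qubits of block `j` among all the qubits, for a labelling `ε` of the block by `V`. -/
def blockWire (N : ℕ) (ε : V ≃ OutWire p a) (j : Fin k) : V ↪ Wire N k p a where
  toFun v := Sum.inr (j, Sum.inr (ε v))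
  inj' v w h := by simpa using h

theorem blockWire_apply (ε : V ≃ OutWire p a) (j : Fin k) (v : V) :
    blockWire N ε j v = Sum.inr (j, Sum.inr (ε v)) := rfl

/-- The wires of a query: control and target inside the block, index register elsewhere. -/
def queryWires {W : Type} {q : ℕ} (I : Fin q ↪ W) (g : V ↪ W) (h : ∀ b v, I b ≠ g v)
    (e : (Unit ⊕ Fin m) ↪ V) : (Unit ⊕ Fin q ⊕ Fin m) ↪ W where
  toFun := Sum.elim (fun _ => g (e (Sum.inl ())))
    (Sum.elim I (fun t => g (e (Sum.inr t))))
  inj' := by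
    rintro (⟨⟩ | b | t) (⟨⟩ | b' | t') hh
    · rfl
    · exact absurd hh.symm (h _ _)
    · exact absurd (e.injective (g.injective hh)) (by simp)
    · exact absurd hh (h _ _)
    · rw [I.injective hh]
    · exact absurd hh (h _ _)
    · exact absurd (e.injective (g.injective hh)) (by simp)
    · exact absurd hh.symm (h _ _)
    · have := e.injective (g.injective hh)
      rw [Sum.inr_injective this]

/-- The wires of a query to a digit of a norm. -/
def normWires {W : Type} {q : ℕ} (I : Fin q ↪ W) (g : V ↪ W) (h : ∀ b v, I b ≠ g v)
    (w : V) : (Unit ⊕ Fin q) ↪ W where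
  toFun := Sum.elim (fun _ => g w) I
  inj' := by
    rintro (⟨⟩ | b) (⟨⟩ | b') hh
    · rfl
    · exact absurd hh.symm (h _ _)
    · exact absurd hh (h _ _)
    · rw [I.injective hh]

/-- The register that holds the index of an example. -/
def indexWires (N k p a : ℕ) : Fin (Nat.clog 2 N) ↪ Wire N k p a := ⟨Sum.inl, Sum.inl_injective⟩

/-- The register of block `j` that holds the label of a centroid. -/
def labelWires (N p a : ℕ) (j : Fin k) : Fin (Nat.clog 2 k) ↪ Wire N k p a where
  toFun b := Sum.inr (j, Sum.inl b)
  inj' b b' h := by simpa using h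

theorem labelWires_apply (j : Fin k) (b : Fin (Nat.clog 2 k)) :
    labelWires N p a j b = Sum.inr (j, Sum.inl b) := rfl

theorem indexWires_ne (ε : V ≃ OutWire p a) (j : Fin k) (b : Fin (Nat.clog 2 N)) (v : V) :
    indexWires N k p a b ≠ blockWire N ε j v := by
  simp [indexWires, blockWire]

theorem labelWires_ne (ε : V ≃ OutWire p a) (j : Fin k) (b : Fin (Nat.clog 2 k)) (v : V) :
    labelWires N p a j b ≠ blockWire N ε j v := by
  simp [labelWires_apply, blockWire_apply]

/-- A block instruction as an instruction of the whole circuit, acting on block `j`. -/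
def BlockGate.toGate (ε : V ≃ OutWire p a) (j : Fin k) :
    BlockGate (Nat.clog 2 d) V → Gate N d k (Wire N k p a)
  | .elementary r hr e u => .elementary r hr (e.trans (blockWire N ε j)) u
  | .state false adj e =>
      .row (.state adj (queryWires (indexWires N k p a) (blockWire N ε j) (indexWires_ne ε j) e))
  | .state true adj e =>
      .centroid (.state adj (queryWires (labelWires N p a j) (blockWire N ε j)
        (labelWires_ne ε j) e))
  | .norm false s w =>
      .row (.norm s (normWires (indexWires N k p a) (blockWire N ε j) (indexWires_ne ε j) w))
  | .norm true s w =>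
      .centroid (.norm s (normWires (labelWires N p a j) (blockWire N ε j) (labelWires_ne ε j) w))

theorem BlockGate.toGate_time_le (ε : V ≃ OutWire p a) (j : Fin k)
    (g : BlockGate (Nat.clog 2 d) V) {T Tc : ℝ} (hT : Tc ≤ T) :
    (g.toGate ε j : Gate N d k (Wire N k p a)).time T Tc ≤ g.time T := by
  rcases g with _ | ⟨_ | _, _, _⟩ | ⟨_ | _, _, _⟩ <;>
    simp [BlockGate.toGate, Gate.time, BlockGate.time, hT]

section Data

variable {x : Fin N → EuclideanSpace ℝ (Fin d)} {c : Fin k → EuclideanSpace ℝ (Fin d)}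

/-- The data seen by a block whose index and label registers hold the given bits. -/
def blockData (A : QuantumAccess x) (B : QuantumAccess c) (s : Fin (Nat.clog 2 N) → Bool)
    (t : Fin (Nat.clog 2 k) → Bool) : BlockData (Nat.clog 2 d) where
  prep b := cond b (B.prepare t) (A.prepare s)
  digit b := cond b (B.normDigit t) (A.normDigit s)

/-- On the slice of basis states that agree with `y` outside block `j`, the lifted instruction acts
as the block instruction does, with the data addressed by `y`. -/
theorem BlockGate.toGate_apply (A : QuantumAccess x) (B : QuantumAccess c)
    (ε : V ≃ OutWire p a) (j : Fin k) (g : BlockGate (Nat.clog 2 d) V)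
    (ψ : QState (Wire N k p a)) (y : Wire N k p a → Bool) :
    (g.toGate ε j).apply A B ψ y =
      g.apply (blockData A B (fun b => y (Sum.inl b)) (fun b => y (Sum.inr (j, Sum.inl b))))
        (fun z => ψ (Function.extend (blockWire N ε j) z y)) (fun v => y (blockWire N ε j v)) := by
  classical
  rcases g with ⟨r, hr, e, u⟩ | ⟨_ | _, adj, e⟩ | ⟨_ | _, s, w⟩
  · exact applyOn_comp_embedding (blockWire N ε j) e e.injective u.1 ψ y
  · simp only [BlockGate.toGate, Gate.apply, Query.apply, BlockGate.apply, extend_self]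
    by_cases h : y (blockWire N ε j (e (Sum.inl ()))) = true
    · refine (if_pos h).trans (Eq.trans ?_ (if_pos h).symm)
      exact applyOn_comp_embedding (blockWire N ε j) (fun t => e (Sum.inr t))
        (e.injective.comp Sum.inr_injective) _ ψ y
    · exact (if_neg h).trans (if_neg h).symm
  · simp only [BlockGate.toGate, Gate.apply, Query.apply, BlockGate.apply, extend_self]
    by_cases h : y (blockWire N ε j (e (Sum.inl ()))) = true
    · refine (if_pos h).trans (Eq.trans ?_ (if_pos h).symm)
      exact applyOn_comp_embedding (blockWire N ε j) (fun t => e (Sum.inr t))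
        (e.injective.comp Sum.inr_injective) _ ψ y
    · exact (if_neg h).trans (if_neg h).symm
  · exact (congrArg ψ (@extend_update (Wire N k p a) V
      (fun _ _ => Classical.propDecidable _) (fun _ _ => Classical.propDecidable _)
      (blockWire N ε j) w
      (xor (y (blockWire N ε j w)) (A.normDigit (fun b => y (Sum.inl b)) s)) y)).symm
  · exact (congrArg ψ (@extend_update (Wire N k p a) V
      (fun _ _ => Classical.propDecidable _) (fun _ _ => Classical.propDecidable _)
      (blockWire N ε j) w
      (xor (y (blockWire N ε j w)) (B.normDigit (fun b => y (Sum.inr (j, Sum.inl b))) s)) y)).symm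

end Data

/-- A state of the block `V`, read as a state of the output block. -/
def relabel (ε : V ≃ OutWire p a) (φ : QState V) : QState (OutWire p a) :=
  fun y => φ (fun v => y (ε v))

/-- The contribution of example `i` to the superposition, with the factor of block `j` left out. -/
def sliceWeight (Φ : Fin N → Fin k → QState (OutWire p a)) (j : Fin k) (i : Fin N)
    (y : Wire N k p a → Bool) : ℂ :=
  ((1 / Real.sqrt N : ℝ) : ℂ) * (if (fun b => y (Sum.inl b)) = code N i then 1 else 0) *
    (if (fun b => y (Sum.inr (j, Sum.inl b))) = code k j then 1 else 0) *
    ∏ j' ∈ Finset.univ.erase j,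
      ((if (fun b => y (Sum.inr (j', Sum.inl b))) = code k j' then 1 else 0) *
          Φ i j' (fun b => y (Sum.inr (j', Sum.inr b))))

theorem superposition_extend (ε : V ≃ OutWire p a) (Φ : Fin N → Fin k → QState (OutWire p a))
    (j : Fin k) (φ : Fin N → QState V) (hΦ : ∀ i, Φ i j = relabel ε (φ i))
    (y : Wire N k p a → Bool) (z : V → Bool) :
    superposition N k p a Φ (Function.extend (blockWire N ε j) z y)
      = ∑ i, sliceWeight Φ j i y * φ i z := by
  have h1 : ∀ b, Function.extend (blockWire N ε j) z y (Sum.inl b) = y (Sum.inl b) := by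
    intro b
    apply Function.extend_apply'
    rintro ⟨v, hv⟩
    simp [blockWire_apply] at hv
  have h2 : ∀ j' b, Function.extend (blockWire N ε j) z y (Sum.inr (j', Sum.inl b))
      = y (Sum.inr (j', Sum.inl b)) := by
    intro j' b
    apply Function.extend_apply'
    rintro ⟨v, hv⟩
    simp [blockWire_apply] at hv
  have h3 : ∀ j', j' ≠ j → ∀ b, Function.extend (blockWire N ε j) z y (Sum.inr (j', Sum.inr b))
      = y (Sum.inr (j', Sum.inr b)) := by
    intro j' hj b
    apply Function.extend_apply'
    rintro ⟨v, hv⟩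
    simp only [blockWire_apply, Sum.inr.injEq, Prod.mk.injEq] at hv
    exact hj hv.1.symm
  have h4 : ∀ v, Function.extend (blockWire N ε j) z y (Sum.inr (j, Sum.inr (ε v))) = z v :=
    fun v => (blockWire N ε j).injective.extend_apply z y v
  unfold superposition
  simp only [h1, h2]
  rw [Finset.mul_sum]
  refine Finset.sum_congr rfl fun i _ => ?_
  rw [← Finset.mul_prod_erase _ _ (Finset.mem_univ j)]
  have h5 : Φ i j (fun b => Function.extend (blockWire N ε j) z y (Sum.inr (j, Sum.inr b)))
      = φ i z := by
    rw [hΦ]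
    simp only [relabel, h4]
  have h6 : ∏ j' ∈ Finset.univ.erase j,
      ((if (fun b => y (Sum.inr (j', Sum.inl b))) = code k j' then (1 : ℂ) else 0) *
          Φ i j' (fun b => Function.extend (blockWire N ε j) z y (Sum.inr (j', Sum.inr b))))
      = ∏ j' ∈ Finset.univ.erase j,
      ((if (fun b => y (Sum.inr (j', Sum.inl b))) = code k j' then 1 else 0) *
          Φ i j' (fun b => y (Sum.inr (j', Sum.inr b)))) := by
    refine Finset.prod_congr rfl fun j' hj' => ?_
    simp only [h3 j' (Finset.ne_of_mem_erase hj')]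
  rw [h5, h6, sliceWeight]
  ring

section Run

variable {x : Fin N → EuclideanSpace ℝ (Fin d)} {c : Fin k → EuclideanSpace ℝ (Fin d)}

/-- A lifted block instruction acts on block `j` of each summand of the superposition, with the
data of the summand. -/
theorem BlockGate.toGate_superposition (A : QuantumAccess x) (B : QuantumAccess c)
    (ε : V ≃ OutWire p a) (j : Fin k) (g : BlockGate (Nat.clog 2 d) V)
    (Φ : Fin N → Fin k → QState (OutWire p a)) (φ : Fin N → QState V)
    (hΦ : ∀ i, Φ i j = relabel ε (φ i)) :
    (g.toGate ε j).apply A B (superposition N k p a Φ) =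
      superposition N k p a (fun i => Function.update (Φ i) j
        (relabel ε (g.apply (blockData A B (code N i) (code k j)) (φ i)))) := by
  funext y
  rw [BlockGate.toGate_apply]
  simp only [superposition_extend ε Φ j φ hΦ y]
  rw [BlockGate.apply_sum]
  have h := superposition_extend ε (fun i => Function.update (Φ i) j
        (relabel ε (g.apply (blockData A B (code N i) (code k j)) (φ i)))) j
        (fun i => g.apply (blockData A B (code N i) (code k j)) (φ i)) (fun i => by simp) y
        (fun v => y (blockWire N ε j v))
  rw [extend_self] at h
  rw [h]
  refine Finset.sum_congr rfl fun i _ => ?_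
  have hw : sliceWeight (fun i => Function.update (Φ i) j
        (relabel ε (g.apply (blockData A B (code N i) (code k j)) (φ i)))) j i y
      = sliceWeight Φ j i y := by
    unfold sliceWeight
    congr 1
    refine Finset.prod_congr rfl fun j' hj' => ?_
    dsimp only
    rw [Function.update_of_ne (Finset.ne_of_mem_erase hj')]
  rw [hw]
  by_cases h1 : (fun b => y (Sum.inl b)) = code N i
  · by_cases h2 : (fun b => y (Sum.inr (j, Sum.inl b))) = code k j
    · rw [h1, h2]
    · simp [sliceWeight, h2]
  · simp [sliceWeight, h1]

theorem run_block (A : QuantumAccess x) (B : QuantumAccess c) (ε : V ≃ OutWire p a) (j : Fin k)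
    (P : List (BlockGate (Nat.clog 2 d) V)) (Φ : Fin N → Fin k → QState (OutWire p a))
    (φ : Fin N → QState V) (hΦ : ∀ i, Φ i j = relabel ε (φ i)) :
    Circuit.run A B (P.map (BlockGate.toGate ε j)) (superposition N k p a Φ) =
      superposition N k p a (fun i => Function.update (Φ i) j
        (relabel ε (blockRun (blockData A B (code N i) (code k j)) P (φ i)))) := by
  induction P generalizing Φ φ with
  | nil =>
    simp only [List.map_nil, Circuit.run, List.foldl_nil, blockRun]
    congr 1
    funext i
    rw [← hΦ, Function.update_eq_self]
  | cons g P ih =>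
    have h := ih (fun i => Function.update (Φ i) j
        (relabel ε (g.apply (blockData A B (code N i) (code k j)) (φ i))))
        (fun i => g.apply (blockData A B (code N i) (code k j)) (φ i)) (fun i => by simp)
    simp only [List.map_cons, Circuit.run, List.foldl_cons, blockRun] at h ⊢
    rw [BlockGate.toGate_superposition A B ε j g Φ φ hΦ, h]
    simp only [Function.update_idem]

/-- The block circuit `P` run on the blocks in turn. -/
def allBlocks (ε : V ≃ OutWire p a) (P : List (BlockGate (Nat.clog 2 d) V)) (js : List (Fin k)) :
    Circuit N d k (Wire N k p a) :=
  js.flatMap fun j => P.map (BlockGate.toGate ε j)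

theorem run_allBlocks (A : QuantumAccess x) (B : QuantumAccess c) (ε : V ≃ OutWire p a)
    (P : List (BlockGate (Nat.clog 2 d) V)) (js : List (Fin k)) (hjs : js.Nodup) (φ₀ : QState V)
    (Φ : Fin N → Fin k → QState (OutWire p a)) (hΦ : ∀ i, ∀ j ∈ js, Φ i j = relabel ε φ₀) :
    Circuit.run A B (allBlocks ε P js) (superposition N k p a Φ) =
      superposition N k p a (fun i j => if j ∈ js then
        relabel ε (blockRun (blockData A B (code N i) (code k j)) P φ₀) else Φ i j) := by
  induction js generalizing Φ with
  | nil => simp [allBlocks, Circuit.run]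
  | cons j js ih =>
    obtain ⟨hj, hjs⟩ := List.nodup_cons.1 hjs
    have h1 := run_block A B ε j P Φ (fun _ => φ₀) (fun i => hΦ i j (by simp))
    simp only [Circuit.run, allBlocks, List.flatMap_cons, List.foldl_append] at h1 ih ⊢
    rw [h1, ih hjs]
    · congr 1
      funext i j'
      by_cases h : j' = j
      · subst h; simp [hj]
      · simp [h]
    · intro i j' hj'
      rw [Function.update_of_ne (by rintro rfl; exact hj hj')]
      exact hΦ i j' (by simp [hj'])

theorem allBlocks_time_le (ε : V ≃ OutWire p a) (P : List (BlockGate (Nat.clog 2 d) V))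
    (js : List (Fin k)) {T Tc : ℝ} (hT : Tc ≤ T) :
    (allBlocks ε P js : Circuit N d k (Wire N k p a)).time T Tc ≤ js.length * blockTime T P := by
  have h1 : ∀ j : Fin k, ((P.map (BlockGate.toGate ε j)).map
      (Gate.time T Tc : Gate N d k (Wire N k p a) → ℝ)).sum ≤ blockTime T P := by
    intro j
    rw [List.map_map]
    exact List.sum_le_sum fun g _ => BlockGate.toGate_time_le ε j g hT
  induction js with
  | nil => simp [allBlocks, Circuit.time]
  | cons j js ih =>
    simp only [Circuit.time, allBlocks, List.flatMap_cons, List.map_append, List.sum_append,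
      List.length_cons, Nat.cast_add, Nat.cast_one] at ih ⊢
    linarith [h1 j]

end Run

end BlockCircuits

/-! ### Operators implemented by block circuits -/

section Impl

variable {m : ℕ} {V : Type} {T : ℝ}

/-- The operator `F` on block states (depending on the data) is performed by a block circuit of
running time at most `t`, when every query costs `T`. The circuit does not depend on the data. -/
def Impl (T t : ℝ) (F : BlockData m → QState V → QState V) : Prop :=
  ∃ P : List (BlockGate m V), blockTime T P ≤ t ∧ ∀ D ψ, blockRun D P ψ = F D ψ

theorem Impl.of_gate {t : ℝ} {F : BlockData m → QState V → QState V} (g : BlockGate m V)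
    (ht : g.time T ≤ t) (h : ∀ D ψ, g.apply D ψ = F D ψ) : Impl T t F :=
  ⟨[g], by simpa [blockTime] using ht, fun D ψ => by simpa [blockRun] using h D ψ⟩

theorem Impl.comp {t₁ t₂ : ℝ} {F G : BlockData m → QState V → QState V}
    (hF : Impl T t₁ F) (hG : Impl T t₂ G) : Impl T (t₁ + t₂) (fun D ψ => G D (F D ψ)) := by
  obtain ⟨P, hP, hP'⟩ := hF
  obtain ⟨Q, hQ, hQ'⟩ := hG
  refine ⟨P ++ Q, ?_, fun D ψ => ?_⟩
  · simp only [blockTime, List.map_append, List.sum_append] at hP hQ ⊢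
    linarith
  · have h1 := hP' D ψ
    have h2 := hQ' D (F D ψ)
    simp only [blockRun, List.foldl_append] at h1 h2 ⊢
    rw [h1, h2]

theorem applyOn_diagonal {ι : Type} [Fintype ι] [DecidableEq ι] (e : ι ↪ V)
    (d : (ι → Bool) → ℂ) (ψ : QState V) (x : V → Bool) :
    applyOn e (Matrix.diagonal d) ψ x = d (fun t => x (e t)) * ψ x := by
  unfold applyOn
  rw [Finset.sum_eq_single (fun t => x (e t))]
  · rw [extend_self]
    congr 1
    exact Matrix.diagonal_apply_eq d _
  · intro y _ hy
    rw [Matrix.diagonal_apply_ne d (by exact fun h => hy h.symm), zero_mul]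
  · simp

theorem diagonal_mem_unitary {ι : Type} [Fintype ι] [DecidableEq ι] (d : ι → ℂ)
    (hd : ∀ z, ‖d z‖ = 1) : Matrix.diagonal d ∈ Matrix.unitaryGroup ι ℂ := by
  rw [Matrix.mem_unitaryGroup_iff, Matrix.star_eq_conjTranspose, Matrix.diagonal_conjTranspose,
    Matrix.diagonal_mul_diagonal, ← Matrix.diagonal_one]
  congr 1
  funext z
  simp [Complex.mul_conj, Complex.normSq_eq_norm_sq, hd z]

/-- The permutation matrix of an involution. -/
def involutionMatrix {ι : Type} [DecidableEq ι] (g : ι → ι) : Matrix ι ι ℂ :=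
  fun x y => if y = g x then 1 else 0

theorem involutionMatrix_mem_unitary {ι : Type} [Fintype ι] [DecidableEq ι] (g : ι → ι)
    (hg : Function.Involutive g) : involutionMatrix g ∈ Matrix.unitaryGroup ι ℂ := by
  rw [Matrix.mem_unitaryGroup_iff]
  ext x y
  simp [Matrix.mul_apply, involutionMatrix, Matrix.one_apply, hg.injective.eq_iff, eq_comm]

theorem applyOn_involutionMatrix {ι : Type} [Fintype ι] [DecidableEq ι] (e : ι → V)
    (g : (ι → Bool) → (ι → Bool)) (ψ : QState V) (x : V → Bool) :
    applyOn e (involutionMatrix g) ψ x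
      = ψ (Function.extend e (g (fun t => x (e t))) x) := by
  unfold applyOn involutionMatrix
  rw [Finset.sum_eq_single (g (fun t => x (e t)))]
  · rw [if_pos (by rfl), one_mul]
  · intro y _ hy
    rw [if_neg (by exact hy), zero_mul]
  · simp

theorem impl_phase (w : V) (c : ℂ) (hc : ‖c‖ = 1) :
    Impl (m := m) T 1 (fun _ ψ x => (if x w then c else 1) * ψ x) := by
  let e : Fin 1 ↪ V := ⟨fun _ => w, fun i j _ => Subsingleton.elim i j⟩
  refine Impl.of_gate (.elementary 1 (by norm_num) e
    ⟨Matrix.diagonal fun z => if z 0 then c else 1, diagonal_mem_unitary _ fun z => ?_⟩) le_rfl ?_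
  · split_ifs <;> simp [hc]
  · intro D ψ
    funext x
    simp only [BlockGate.apply]
    rw [applyOn_diagonal]
    rfl

theorem impl_phase₂ (v w : V) (hvw : v ≠ w) (c : Bool → Bool → ℂ) (hc : ∀ a b, ‖c a b‖ = 1) :
    Impl (m := m) T 1 (fun _ ψ x => c (x v) (x w) * ψ x) := by
  let e : Fin 2 ↪ V := ⟨![v, w], by
      intro i j; fin_cases i <;> fin_cases j <;> simp [hvw, hvw.symm]⟩
  refine Impl.of_gate (.elementary 2 (by norm_num) e
    ⟨Matrix.diagonal fun z => c (z 0) (z 1), diagonal_mem_unitary _ fun z => hc _ _⟩) le_rfl ?_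
  intro D ψ
  funext x
  simp only [BlockGate.apply]
  rw [applyOn_diagonal]
  rfl

theorem impl_state (c adj : Bool) (e : (Unit ⊕ Fin m) ↪ V) :
    Impl T T (fun D ψ x => if x (e (Sum.inl ())) = true then
        applyOn (fun t => e (Sum.inr t))
          (if adj = true then (D.prep c).1.conjTranspose else (D.prep c).1) ψ x
      else ψ x) :=
  Impl.of_gate (.state c adj e) le_rfl (fun D ψ => by
    funext x
    simp only [BlockGate.apply])

variable [DecidableEq V]

theorem update_xor_involutive {ι : Type} [DecidableEq ι] (i : ι) (f : (ι → Bool) → Bool)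
    (hf : ∀ z b, f (Function.update z i b) = f z) :
    Function.Involutive fun z : ι → Bool => Function.update z i (xor (z i) (f z)) := by
  intro z
  simp [hf]

/-- A classical instruction `x w ← x w ⊕ f (x a) (x b)`. -/
structure Flip (V : Type) where
  w : V
  a : V
  b : V
  ha : a ≠ w
  hb : b ≠ w
  f : Bool → Bool → Bool

/-- The action of a classical instruction on bit strings. -/
def Flip.step (o : Flip V) (x : V → Bool) : V → Bool :=
  Function.update x o.w (xor (x o.w) (o.f (x o.a) (x o.b)))

theorem Flip.step_step (o : Flip V) (x : V → Bool) : o.step (o.step x) = x :=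
  update_xor_involutive o.w (fun z => o.f (z o.a) (z o.b))
    (fun z b => by simp [Function.update_of_ne o.ha, Function.update_of_ne o.hb]) x

theorem impl_flip (o : Flip V) :
    Impl (m := m) T 1 (fun _ ψ x => ψ (o.step x)) := by
  obtain ⟨w, a, b, ha, hb, f⟩ := o
  by_cases hab : a = b
  · subst hab
    let e : Fin 2 ↪ V := ⟨![w, a], by
      intro i j; fin_cases i <;> fin_cases j <;> simp [ha, ha.symm]⟩
    let g : (Fin 2 → Bool) → (Fin 2 → Bool) :=
      fun z => Function.update z 0 (xor (z 0) (f (z 1) (z 1)))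
    have hg : Function.Involutive g :=
      update_xor_involutive 0 (fun z => f (z 1) (z 1)) (fun z b => by simp)
    refine Impl.of_gate (.elementary 2 (by norm_num) e
      ⟨involutionMatrix g, involutionMatrix_mem_unitary g hg⟩) le_rfl ?_
    intro D ψ
    funext x
    simp only [BlockGate.apply]
    rw [applyOn_involutionMatrix]
    exact congrArg ψ (extend_update e 0 _ x)
  · let e : Fin 3 ↪ V := ⟨![w, a, b], by
      intro i j
      fin_cases i <;> fin_cases j <;> simp [ha, ha.symm, hb, hb.symm, hab, Ne.symm hab]⟩
    let g : (Fin 3 → Bool) → (Fin 3 → Bool) :=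
      fun z => Function.update z 0 (xor (z 0) (f (z 1) (z 2)))
    have hg : Function.Involutive g :=
      update_xor_involutive 0 (fun z => f (z 1) (z 2)) (fun z b => by simp)
    refine Impl.of_gate (.elementary 3 le_rfl e
      ⟨involutionMatrix g, involutionMatrix_mem_unitary g hg⟩) le_rfl ?_
    intro D ψ
    funext x
    simp only [BlockGate.apply]
    rw [applyOn_involutionMatrix]
    exact congrArg ψ (extend_update e 0 _ x)

/-- The factor `1 / √2` of the Hadamard gate. -/
def invSqrtTwo : ℂ := ((Real.sqrt 2)⁻¹ : ℝ)

theorem invSqrtTwo_mul_self : invSqrtTwo * invSqrtTwo = 1 / 2 := by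
  unfold invSqrtTwo
  rw [← Complex.ofReal_mul, ← mul_inv, Real.mul_self_sqrt (by norm_num)]
  norm_num

/-- The Hadamard gate as an operator on a pair of values `φ false`, `φ true`. -/
def hadamard (φ : Bool → ℂ) (b : Bool) : ℂ :=
  invSqrtTwo * (φ false + (if b then -1 else 1) * φ true)

/-- The matrix of the Hadamard gate. -/
def hadamardMatrix : Matrix (Fin 1 → Bool) (Fin 1 → Bool) ℂ :=
  Matrix.of fun x y => invSqrtTwo * (if x 0 && y 0 then -1 else 1)

theorem hadamard_mem_unitary : hadamardMatrix ∈ Matrix.unitaryGroup (Fin 1 → Bool) ℂ := by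
  have h1 : (starRingEnd ℂ) invSqrtTwo = invSqrtTwo := Complex.conj_ofReal _
  rw [Matrix.mem_unitaryGroup_iff]
  ext x y
  rw [Matrix.mul_apply]
  rw [← (Equiv.funUnique (Fin 1) Bool).symm.sum_comp]
  have hx : x = (Equiv.funUnique (Fin 1) Bool).symm (x 0) :=
    ((Equiv.funUnique (Fin 1) Bool).symm_apply_apply x).symm
  have hy : y = (Equiv.funUnique (Fin 1) Bool).symm (y 0) :=
    ((Equiv.funUnique (Fin 1) Bool).symm_apply_apply y).symm
  rw [Matrix.one_apply, hx, hy]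
  have h2 := invSqrtTwo_mul_self
  generalize x 0 = a
  generalize y 0 = b
  cases a <;> cases b <;>
    simp [hadamardMatrix, Matrix.star_apply, h1, Equiv.funUnique]
  · linear_combination 2 * h2
  · exact fun h => Bool.noConfusion (congrFun h 0)
  · exact fun h => Bool.noConfusion (congrFun h 0)
  · linear_combination 2 * h2

theorem impl_hadamard (w : V) :
    Impl (m := m) T 1
      (fun _ ψ x => hadamard (fun b => ψ (Function.update x w b)) (x w)) := by
  let e : Fin 1 ↪ V := ⟨fun _ => w, fun i j _ => Subsingleton.elim i j⟩
  refine Impl.of_gate (.elementary 1 (by norm_num) e ⟨_, hadamard_mem_unitary⟩) le_rfl ?_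
  intro D ψ
  funext x
  simp only [BlockGate.apply, applyOn]
  rw [← (Equiv.funUnique (Fin 1) Bool).symm.sum_comp]
  have h : ∀ b : Bool, Function.extend e ((Equiv.funUnique (Fin 1) Bool).symm b) x
      = Function.update x w b := by
    intro b
    refine Eq.trans ?_ (extend_update e 0 b x)
    congr 1
    funext t
    rw [Subsingleton.elim t 0, Function.update_self]
    rfl
  rw [Fintype.sum_bool, h, h]
  have he : x (e 0) = x w := rfl
  cases hw : x w <;> simp [hadamardMatrix, hadamard, Equiv.funUnique, he, hw] <;> ring

theorem impl_norm (c : Bool) (s : ℤ) (w : V) :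
    Impl (m := m) T T (fun D ψ x => ψ (Function.update x w (xor (x w) (D.digit c s)))) :=
  Impl.of_gate (.norm c s w) le_rfl (fun D ψ => by
    funext x
    simp only [BlockGate.apply]
    congr!)

/-! ### Lists of classical instructions -/

/-- Executing a list of classical instructions from the first to the last. -/
def flipForward (ops : List (Flip V)) (x : V → Bool) : V → Bool :=
  ops.foldl (fun y o => o.step y) x

/-- Executing a list of classical instructions from the last to the first. -/
def flipBackward (ops : List (Flip V)) (x : V → Bool) : V → Bool :=
  ops.foldr (fun o y => o.step y) x

theorem flipBackward_forward (ops : List (Flip V)) (x : V → Bool) :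
    flipBackward ops (flipForward ops x) = x := by
  induction ops generalizing x with
  | nil => rfl
  | cons o ops ih =>
    simp only [flipBackward, flipForward, List.foldr_cons, List.foldl_cons] at ih ⊢
    rw [ih, Flip.step_step]

theorem flipForward_backward (ops : List (Flip V)) (x : V → Bool) :
    flipForward ops (flipBackward ops x) = x := by
  induction ops generalizing x with
  | nil => rfl
  | cons o ops ih =>
    simp only [flipBackward, flipForward, List.foldr_cons, List.foldl_cons] at ih ⊢
    rw [Flip.step_step, ih]

/-- The bijection of bit strings performed by a list of classical instructions. -/
def flipEquiv (ops : List (Flip V)) : (V → Bool) ≃ (V → Bool) where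
  toFun := flipForward ops
  invFun := flipBackward ops
  left_inv := flipBackward_forward ops
  right_inv := flipForward_backward ops

theorem flipBackward_reverse (ops : List (Flip V)) (x : V → Bool) :
    flipBackward ops.reverse x = flipForward ops x := by
  simp [flipBackward, flipForward]

theorem impl_flips (ops : List (Flip V)) :
    Impl (m := m) T ops.length (fun _ ψ x => ψ (flipBackward ops x)) := by
  induction ops with
  | nil => exact ⟨[], by simp [blockTime], fun D ψ => rfl⟩
  | cons o ops ih =>
    have h := (impl_flip (m := m) (T := T) o).comp ih
    rw [List.length_cons, Nat.cast_succ, add_comm]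
    exact h

end Impl

/-! ### The controlled rotation -/

section Logical

variable {m : ℕ} {K : Type} {T : ℝ}

/-- The qubits of one block: classical and test qubits `K`, an ancilla that selects one of the two
state-preparation unitaries, their common target register, and `m + 1` flags. -/
abbrev SysWire (m : ℕ) (K : Type) : Type := K ⊕ (Unit ⊕ Fin m ⊕ Fin (m + 1))

/-- The ancilla. -/
def ancWire : SysWire m K := Sum.inr (Sum.inl ())

/-- A qubit of the target register. -/
def targetWire (t : Fin m) : SysWire m K := Sum.inr (Sum.inr (Sum.inl t))

/-- A flag. -/
def flagWire (r : Fin (m + 1)) : SysWire m K := Sum.inr (Sum.inr (Sum.inr r))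

/-- States of the ancilla and the target register. -/
abbrev SysState (m : ℕ) : Type := Bool → (Fin m → Bool) → ℂ

/-- For each assignment of the qubits `K`, a state of the ancilla and the target register. -/
abbrev LogicalState (m : ℕ) (K : Type) : Type := (K → Bool) → SysState m

open Classical in
/-- The block state with all flags equal to `0` given by a logical state. -/
def lift (v : LogicalState m K) : QState (SysWire m K) := fun x =>
  if ∀ r, x (flagWire r) = false then
    v (fun κ => x (Sum.inl κ)) (x ancWire) (fun t => x (targetWire t)) else 0

theorem lift_add (v w : LogicalState m K) : lift (v + w) = lift v + lift w := by
  funext x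
  simp only [lift, Pi.add_apply]
  split_ifs <;> simp

/-- The operator `F` on logical states is performed by a block circuit of running time at most
`t`. -/
def LogicalImpl (T t : ℝ) (F : BlockData m → LogicalState m K → LogicalState m K) : Prop :=
  ∃ P : List (BlockGate m (SysWire m K)), blockTime T P ≤ t ∧
    ∀ D v, blockRun D P (lift v) = lift (F D v)

theorem LogicalImpl.of_impl {t : ℝ} {F' : BlockData m → QState (SysWire m K) → QState (SysWire m K)}
    {F : BlockData m → LogicalState m K → LogicalState m K} (h : Impl T t F')
    (hF : ∀ D v, F' D (lift v) = lift (F D v)) : LogicalImpl T t F := by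
  obtain ⟨P, hP, hP'⟩ := h
  exact ⟨P, hP, fun D v => by rw [hP', hF]⟩

theorem LogicalImpl.mono {t t' : ℝ} {F F' : BlockData m → LogicalState m K → LogicalState m K}
    (h : LogicalImpl T t F) (ht : t ≤ t') (hF : ∀ D v, F D v = F' D v) : LogicalImpl T t' F' := by
  obtain ⟨P, hP, hP'⟩ := h
  exact ⟨P, hP.trans ht, fun D v => by rw [hP', hF]⟩

theorem LogicalImpl.comp {t₁ t₂ : ℝ} {F G : BlockData m → LogicalState m K → LogicalState m K}
    (hF : LogicalImpl T t₁ F) (hG : LogicalImpl T t₂ G) :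
    LogicalImpl T (t₁ + t₂) (fun D v => G D (F D v)) := by
  obtain ⟨P, hP, hP'⟩ := hF
  obtain ⟨Q, hQ, hQ'⟩ := hG
  refine ⟨P ++ Q, ?_, fun D v => ?_⟩
  · simp only [blockTime, List.map_append, List.sum_append] at hP hQ ⊢
    linarith
  · have h1 := hP' D v
    have h2 := hQ' D (F D v)
    simp only [blockRun, List.foldl_append] at h1 h2 ⊢
    rw [h1, h2]

theorem LogicalImpl.id : LogicalImpl (m := m) (K := K) T 0 (fun _ v => v) :=
  ⟨[], by simp [blockTime], fun _ _ => rfl⟩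

theorem LogicalImpl.iterate {t : ℝ} {F : BlockData m → LogicalState m K → LogicalState m K}
    (hF : LogicalImpl T t F) (n : ℕ) : LogicalImpl T (n * t) (fun D => (F D)^[n]) := by
  induction n with
  | zero => exact LogicalImpl.id.mono (by simp) (fun _ _ => rfl)
  | succ n ih =>
    refine (hF.comp ih).mono (by push_cast; linarith) fun D v => ?_
    rw [Function.iterate_succ_apply]

/-! #### Operators on the ancilla and the target register -/

/-- Apply `U a` to the target register when the ancilla is `a`. -/
def sysSelect (U : Bool → Matrix (Fin m → Bool) (Fin m → Bool) ℂ) (φ : SysState m) : SysState m :=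
  fun a y => ∑ y', U a y y' * φ a y'

/-- Flip the ancilla. -/
def sysNot (φ : SysState m) : SysState m := fun a => φ (!a)

/-- The Hadamard gate on the ancilla. -/
def sysHadamard (φ : SysState m) : SysState m := fun a y => hadamard (fun b => φ b y) a

/-- The reflection that fixes the basis state `0` of ancilla and target register and negates the
other ones. -/
def sysReflect (φ : SysState m) : SysState m :=
  fun a y => if a = false ∧ y = (fun _ => false) then φ a y else -φ a y

/-- The rotation whose eigenphases carry the inner product of the two prepared states: the
involution that swaps `|0⟩|u⟩` and `|1⟩|u'⟩` for `u`, `u'` obtained from one vector by the two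
unitaries, followed by the reflection about `|+⟩|0⟩`. -/
def sysRotate (U : Bool → Matrix (Fin m → Bool) (Fin m → Bool) ℂ) (φ : SysState m) : SysState m :=
  sysHadamard (sysReflect (sysHadamard
    (sysSelect (fun a => (U a).conjTranspose) (sysNot (sysSelect U φ)))))

theorem hadamard_hadamard (φ : Bool → ℂ) (a : Bool) : hadamard (hadamard φ) a = φ a := by
  have h := invSqrtTwo_mul_self
  cases a <;> simp only [hadamard, if_true, Bool.false_eq_true, if_false]
  · linear_combination 2 * φ false * h
  · linear_combination 2 * φ true * h

theorem sysHadamard_sysHadamard (φ : SysState m) : sysHadamard (sysHadamard φ) = φ := by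
  funext a y
  exact hadamard_hadamard (fun b => φ b y) a

theorem sysSelect_adjoint (U : Bool → Matrix.unitaryGroup (Fin m → Bool) ℂ) (φ : SysState m) :
    sysSelect (fun a => (U a).1.conjTranspose) (sysSelect (fun a => (U a).1) φ) = φ := by
  funext a
  have h : (U a).1.conjTranspose.mulVec ((U a).1.mulVec (φ a)) = φ a := by
    rw [Matrix.mulVec_mulVec, ← Matrix.star_eq_conjTranspose,
      Matrix.UnitaryGroup.star_mul_self, Matrix.one_mulVec]
  exact h

/-! #### Their implementation -/

theorem implLogical_target (c adj : Bool) :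
    LogicalImpl (m := m) (K := K) T T (fun D v κ => sysSelect (fun a => if a then
      (if adj = true then (D.prep c).1.conjTranspose else (D.prep c).1) else 1) (v κ)) := by
  let e : (Unit ⊕ Fin m) ↪ SysWire m K :=
    ⟨Sum.elim (fun _ => ancWire) targetWire, by
      rintro (⟨⟩ | t) (⟨⟩ | t') h <;> simp_all [ancWire, targetWire]⟩
  refine LogicalImpl.of_impl (impl_state c adj e) fun D v => ?_
  generalize (if adj = true then (D.prep c).1.conjTranspose else (D.prep c).1) = U
  funext x
  have he : e (Sum.inl ()) = ancWire := rfl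
  have ht : (fun t => e (Sum.inr t)) = targetWire := rfl
  have hinj : Function.Injective (targetWire : Fin m → SysWire m K) := by
    intro a b h; simpa [targetWire] using h
  rw [he, ht]
  cases hx : x ancWire
  · simp [lift, hx, sysSelect, Matrix.one_apply]
  · have h1 : ∀ y r, Function.extend targetWire y x (flagWire r : SysWire m K)
        = x (flagWire r) := by
      intro y r
      apply Function.extend_apply'
      rintro ⟨t, ht⟩
      simp [targetWire, flagWire] at ht
    have h2 : ∀ y κ, Function.extend targetWire y x (Sum.inl κ : SysWire m K) = x (Sum.inl κ) := by
      intro y r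
      apply Function.extend_apply'
      rintro ⟨t, ht⟩
      simp [targetWire] at ht
    have h3 : ∀ y, Function.extend targetWire y x (ancWire : SysWire m K) = x ancWire := by
      intro y
      apply Function.extend_apply'
      rintro ⟨t, ht⟩
      simp [targetWire, ancWire] at ht
    simp only [if_true, applyOn, lift, h1, h2, h3, hinj.extend_apply, hx, sysSelect]
    split_ifs <;> simp [Function.comp_def]

theorem implLogical_phase (τ : K) (c : ℂ) (hc : ‖c‖ = 1) :
    LogicalImpl (m := m) T 1 (fun _ v κ a y => (if κ τ then c else 1) * v κ a y) := by
  refine LogicalImpl.of_impl (impl_phase (Sum.inl τ) c hc) fun D v => ?_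
  funext x
  simp only [lift]
  split_ifs <;> simp

/-- The classical instructions that compute in flag `r` whether the ancilla and the first `r`
qubits of the target register are all `0`, for `r ≤ n`. -/
def flagChain (K : Type) : (n : ℕ) → n ≤ m → List (Flip (SysWire m K))
  | 0, _ => [⟨flagWire 0, ancWire, ancWire, by simp [flagWire, ancWire],
      by simp [flagWire, ancWire], fun a _ => !a⟩]
  | n + 1, h => flagChain K n (Nat.le_of_succ_le h) ++
      [⟨flagWire (Fin.succ ⟨n, h⟩), flagWire (Fin.castSucc ⟨n, h⟩), targetWire ⟨n, h⟩,
        by simp [flagWire, Fin.ext_iff], by simp [flagWire, targetWire], fun p q => p && !q⟩]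

theorem flagChain_length (n : ℕ) (h : n ≤ m) : (flagChain K n h).length = n + 1 := by
  induction n with
  | zero => rfl
  | succ n ih => simp [flagChain, ih]

variable [DecidableEq K]

theorem update_inl (x : SysWire m K → Bool) (τ : K) (b : Bool) :
    (fun κ => Function.update x (Sum.inl τ) b (Sum.inl κ))
      = Function.update (fun κ => x (Sum.inl κ)) τ b := by
  funext κ
  by_cases h : κ = τ
  · subst h; simp
  · rw [Function.update_of_ne h, Function.update_of_ne (by simpa using h)]

theorem lift_update_inl (v : LogicalState m K) (x : SysWire m K → Bool) (τ : K) (b : Bool) :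
    lift v (Function.update x (Sum.inl τ) b)
      = lift (fun κ => v (Function.update κ τ b)) x := by
  have h1 : ∀ r, Function.update x (Sum.inl τ) b (flagWire r) = x (flagWire r) := fun r =>
    Function.update_of_ne (by simp [flagWire]) _ _
  have h2 : Function.update x (Sum.inl τ) b ancWire = x ancWire :=
    Function.update_of_ne (by simp [ancWire]) _ _
  have h3 : ∀ t, Function.update x (Sum.inl τ) b (targetWire t) = x (targetWire t) := fun r =>
    Function.update_of_ne (by simp [targetWire]) _ _
  simp only [lift, h1, h2, h3, update_inl]

theorem lift_update_anc (v : LogicalState m K) (x : SysWire m K → Bool) (b : Bool) :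
    lift v (Function.update x ancWire b) = lift (fun κ _ => v κ b) x := by
  have h1 : ∀ r, Function.update x ancWire b (flagWire r) = x (flagWire r) := fun r =>
    Function.update_of_ne (by simp [flagWire, ancWire]) _ _
  have h2 : ∀ κ, Function.update x ancWire b (Sum.inl κ) = x (Sum.inl κ) := fun κ =>
    Function.update_of_ne (by simp [ancWire]) _ _
  have h3 : ∀ t, Function.update x ancWire b (targetWire t) = x (targetWire t) := fun r =>
    Function.update_of_ne (by simp [targetWire, ancWire]) _ _
  simp only [lift, h1, h2, h3, Function.update_self]

theorem implLogical_hadamard_test (τ : K) :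
    LogicalImpl (m := m) T 1
      (fun _ v κ a y => hadamard (fun b => v (Function.update κ τ b) a y) (κ τ)) := by
  refine LogicalImpl.of_impl (impl_hadamard (Sum.inl τ)) fun D v => ?_
  funext x
  simp only [lift_update_inl]
  simp only [lift]
  split_ifs <;> simp [hadamard]

theorem implLogical_hadamard_anc :
    LogicalImpl (m := m) (K := K) T 1 (fun _ v κ => sysHadamard (v κ)) := by
  refine LogicalImpl.of_impl (impl_hadamard ancWire) fun D v => ?_
  funext x
  simp only [lift_update_anc]
  simp only [lift, sysHadamard]
  split_ifs <;> simp [hadamard]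

theorem implLogical_norm (c : Bool) (s : ℤ) (w : K) :
    LogicalImpl (m := m) T T
      (fun D v κ => v (Function.update κ w (xor (κ w) (D.digit c s)))) := by
  refine LogicalImpl.of_impl (impl_norm c s (Sum.inl w)) fun D v => ?_
  funext x
  simp only [lift_update_inl]
  rfl

theorem implLogical_flip (o : Flip K) :
    LogicalImpl (m := m) T 1 (fun _ v κ => v (o.step κ)) := by
  let o' : Flip (SysWire m K) :=
    ⟨Sum.inl o.w, Sum.inl o.a, Sum.inl o.b, by simpa using o.ha, by simpa using o.hb, o.f⟩
  refine LogicalImpl.of_impl (impl_flip o') fun D v => ?_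
  funext x
  simp only [Flip.step, o', lift_update_inl]
  rfl

theorem implLogical_flips (ops : List (Flip K)) :
    LogicalImpl (m := m) T ops.length (fun _ v κ => v (flipBackward ops κ)) := by
  induction ops with
  | nil => exact LogicalImpl.id.mono (by simp) (fun _ _ => rfl)
  | cons o ops ih =>
    refine ((implLogical_flip (T := T) o).comp ih).mono ?_ fun _ _ => rfl
    rw [List.length_cons, Nat.cast_succ, add_comm]

theorem implLogical_not :
    LogicalImpl (m := m) (K := K) T 1 (fun _ v κ => sysNot (v κ)) := by
  let o : Flip (SysWire m K) :=
    ⟨ancWire, flagWire 0, flagWire 0, by simp [ancWire, flagWire], by simp [ancWire, flagWire],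
      fun _ _ => true⟩
  refine LogicalImpl.of_impl (impl_flip o) fun D v => ?_
  funext x
  simp only [Flip.step, o, lift_update_anc, Bool.xor_true]
  rfl

theorem implLogical_cnot (τ : K) :
    LogicalImpl (m := m) T 1 (fun _ v κ => if κ τ then sysNot (v κ) else v κ) := by
  let o : Flip (SysWire m K) :=
    ⟨ancWire, Sum.inl τ, Sum.inl τ, by simp [ancWire], by simp [ancWire], fun a _ => a⟩
  refine LogicalImpl.of_impl (impl_flip o) fun D v => ?_
  funext x
  simp only [Flip.step, o, lift_update_anc]
  simp only [lift]
  by_cases h2 : x (Sum.inl τ) = true <;> simp [h2, sysNot]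

theorem implLogical_select (adj : Bool) :
    LogicalImpl (m := m) (K := K) T (2 * T + 2) (fun D v κ => sysSelect (fun a =>
      if adj = true then (D.prep a).1.conjTranspose else (D.prep a).1) (v κ)) := by
  refine ((((implLogical_not.comp (implLogical_target (T := T) (m := m) (K := K) false adj)).comp
    implLogical_not)).comp (implLogical_target true adj)).mono (by linarith) fun D v => ?_
  funext κ a y
  cases a <;> simp [sysSelect, sysNot, Matrix.one_apply]

/-! #### The reflection, controlled by a test qubit -/

theorem flagChain_forward (x : SysWire m K → Bool) (hx : ∀ r, x (flagWire r) = false) (n : ℕ)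
    (h : n ≤ m) :
    (∀ κ, flipForward (flagChain K n h) x (Sum.inl κ) = x (Sum.inl κ)) ∧
    (∀ t, flipForward (flagChain K n h) x (targetWire t) = x (targetWire t)) ∧
    (∀ r : Fin (m + 1), (r : ℕ) ≤ n → (flipForward (flagChain K n h) x (flagWire r) = true ↔
      x ancWire = false ∧ ∀ t : Fin m, (t : ℕ) < r → x (targetWire t) = false)) ∧
    (∀ r : Fin (m + 1), n < (r : ℕ) → flipForward (flagChain K n h) x (flagWire r) = false) := by
  induction n with
  | zero =>
    simp only [flagChain, flipForward, List.foldl_cons, List.foldl_nil, Flip.step]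
    refine ⟨fun κ => ?_, fun t => ?_, fun r hr => ?_, fun r hr => ?_⟩
    · rw [Function.update_of_ne (by simp [flagWire])]
    · rw [Function.update_of_ne (by simp [flagWire, targetWire])]
    · obtain rfl : r = 0 := Fin.ext (by simpa using hr)
      simp [hx]
    · rw [Function.update_of_ne, hx]
      rintro h'
      have : r = 0 := by simpa [flagWire] using h'
      simp [this] at hr
  | succ n ih =>
    obtain ⟨i1, i2, i3, i4⟩ := ih (Nat.le_of_succ_le h)
    have hstep : flipForward (flagChain K (n + 1) h) x
        = Function.update (flipForward (flagChain K n (Nat.le_of_succ_le h)) x)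
          (flagWire (Fin.succ ⟨n, h⟩))
          (flipForward (flagChain K n (Nat.le_of_succ_le h)) x
            (flagWire (Fin.castSucc ⟨n, h⟩)) && !x (targetWire ⟨n, h⟩)) := by
      rw [← i2]
      simp only [flagChain, flipForward, List.foldl_append, List.foldl_cons, List.foldl_nil,
        Flip.step]
      congr 1
      have h4 := i4 (Fin.succ ⟨n, h⟩) (by simp)
      simp only [flipForward, Flip.step] at h4
      rw [h4, Bool.false_xor]
    rw [hstep]
    refine ⟨fun κ => ?_, fun t => ?_, fun r hr => ?_, fun r hr => ?_⟩
    · rw [Function.update_of_ne (by simp [flagWire]), i1]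
    · rw [Function.update_of_ne (by simp [flagWire, targetWire]), i2]
    · rcases Nat.lt_or_eq_of_le hr with hlt | heq
      · rw [Function.update_of_ne, i3 r (by omega)]
        intro h'
        have : r = Fin.succ ⟨n, h⟩ := by simpa [flagWire] using h'
        simp [this] at hlt
      · obtain rfl : r = Fin.succ ⟨n, h⟩ := Fin.ext (by simpa using heq)
        rw [Function.update_self, Bool.and_eq_true, i3 _ (by simp)]
        simp only [Fin.val_castSucc, Fin.val_succ, Bool.not_eq_true', and_assoc]
        refine and_congr_right fun _ => ⟨fun hh t ht => ?_, fun hh => ⟨fun t ht => ?_, ?_⟩⟩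
        · rcases Nat.lt_or_eq_of_le (Nat.le_of_lt_succ ht) with h1 | h1
          · exact hh.1 t h1
          · obtain rfl : t = ⟨n, h⟩ := Fin.ext h1
            exact hh.2
        · exact hh t (by omega)
        · exact hh ⟨n, h⟩ (by simp)
    · rw [Function.update_of_ne, i4 r (by omega)]
      intro h'
      have : r = Fin.succ ⟨n, h⟩ := by simpa [flagWire] using h'
      simp [this] at hr

/-- The reflection is applied by computing whether the register is `0`, changing the sign, and
uncomputing. -/
theorem implLogical_reflect (τ : K) :
    LogicalImpl (m := m) T (2 * m + 3)
      (fun _ v κ => if κ τ then sysReflect (v κ) else v κ) := by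
  have h1 := impl_flips (m := m) (T := T) (flagChain (m := m) K m le_rfl)
  have h2 := impl_phase₂ (m := m) (T := T) (Sum.inl τ : SysWire m K) (flagWire (Fin.last m))
    (by simp [flagWire]) (fun p q => if p = true ∧ q = false then -1 else 1)
    (by intro a b; split_ifs <;> simp)
  have h3 := impl_flips (m := m) (T := T) (flagChain (m := m) K m le_rfl).reverse
  have ht : ((flagChain (m := m) K m le_rfl).length : ℝ) + 1
      + (flagChain (m := m) K m le_rfl).reverse.length = 2 * m + 3 := by
    rw [List.length_reverse, flagChain_length]
    push_cast
    ring
  rw [← ht]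
  refine LogicalImpl.of_impl ((h1.comp h2).comp h3) fun D v => ?_
  funext x
  simp only [flipBackward_reverse, flipBackward_forward]
  by_cases hx : ∀ r, x (flagWire r) = false
  · obtain ⟨i1, i2, i3, -⟩ := flagChain_forward x hx m le_rfl
    have i5 := i3 (Fin.last m) (by simp)
    rw [i1]
    have i6 : flipForward (flagChain K m le_rfl) x (flagWire (Fin.last m)) = false ↔
        ¬ (x ancWire = false ∧ (fun t => x (targetWire t)) = fun _ => false) := by
      rw [← Bool.not_eq_true, i5]
      refine not_congr (and_congr_right fun _ => ⟨fun hh => ?_, fun hh t _ => congrFun hh t⟩)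
      funext t
      exact hh t (by simp)
    simp only [lift, if_pos hx, i6]
    by_cases hτ : x (Sum.inl τ) = true
    · simp only [hτ, true_and, if_true, sysReflect]
      split_ifs <;> simp_all
    · simp [hτ]
  · simp [lift, hx]

/-- The rotation, controlled by the test qubit `τ`. Without the controlled gates, the other ones
cancel. -/
theorem implLogical_rotate (τ : K) :
    LogicalImpl (m := m) T (4 * T + 2 * m + 10) (fun D v κ => if κ τ then
      sysRotate (fun a => (D.prep a).1) (v κ) else v κ) := by
  refine ((((((implLogical_select (T := T) (m := m) (K := K) false).comp
    (implLogical_cnot τ)).comp (implLogical_select true)).comp implLogical_hadamard_anc).comp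
    (implLogical_reflect τ)).comp implLogical_hadamard_anc).mono (by linarith) fun D v => ?_
  funext κ
  cases hκ : κ τ
  · simp [hκ, sysSelect_adjoint, sysHadamard_sysHadamard]
  · simp [hκ, sysRotate]

end Logical

/-! ### Tests on product states -/

section Tests

variable {m : ℕ} {K : Type} {T : ℝ}

/-- The logical state `q ⊗ e`. -/
def tensor (q : QState K) (e : SysState m) : LogicalState m K := fun κ => q κ • e

theorem tensor_add_right (q : QState K) (e e' : SysState m) :
    tensor q (e + e') = tensor q e + tensor q e' := by
  funext κ
  simp [tensor]

/-- The powers of the controlled rotation act on an eigenvector by a phase on the control qubit. -/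
theorem rotate_iterate_tensor (U : Bool → Matrix (Fin m → Bool) (Fin m → Bool) ℂ) (τ : K)
    (e : SysState m) (μ : ℂ) (he : sysRotate U e = μ • e) (n : ℕ) (q : QState K) :
    (fun (v : LogicalState m K) κ => if κ τ then sysRotate U (v κ) else v κ)^[n] (tensor q e)
      = tensor (fun κ => (if κ τ then μ ^ n else 1) * q κ) e := by
  have hs : ∀ c : ℂ, sysRotate U (c • e) = (c * μ) • e := by
    intro c
    rw [mul_smul, ← he]
    have hsel : ∀ (W : Bool → Matrix (Fin m → Bool) (Fin m → Bool) ℂ) (φ : SysState m),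
        sysSelect W (c • φ) = c • sysSelect W φ := by
      intro W φ
      funext a y
      simp [sysSelect, Finset.mul_sum, mul_left_comm]
    have hnot : ∀ φ : SysState m, sysNot (c • φ) = c • sysNot φ := fun _ => rfl
    have hhad : ∀ φ : SysState m, sysHadamard (c • φ) = c • sysHadamard φ := by
      intro φ
      funext a y
      simp only [sysHadamard, hadamard, Pi.smul_apply, smul_eq_mul]
      ring
    have hrefl : ∀ φ : SysState m, sysReflect (c • φ) = c • sysReflect φ := by
      intro φ
      funext a y
      simp only [sysReflect, Pi.smul_apply, smul_eq_mul]
      split_ifs <;> ring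
    simp only [sysRotate, hsel, hnot, hhad, hrefl]
  induction n generalizing q with
  | zero => simp
  | succ n ih =>
    have h1 : (fun κ => if κ τ then sysRotate U (tensor q e κ) else tensor q e κ)
        = tensor (fun κ => (if κ τ then μ else 1) * q κ) e := by
      funext κ
      cases h : κ τ <;> simp [tensor, hs, h, mul_comm]
    rw [Function.iterate_succ_apply, h1, ih]
    congr 1
    funext κ
    split_ifs <;> ring

variable [Fintype K] [DecidableEq K]

/-- The product state with amplitudes `α w` on the qubit `w`. -/
def prodState (α : K → Bool → ℂ) : QState K := fun κ => ∏ w, α w (κ w)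

/-- The qubit state `|0⟩`. -/
def ketZero : Bool → ℂ := fun b => if b then 0 else 1

theorem prodState_update_left (α : K → Bool → ℂ) (τ : K) (β : Bool → ℂ) (κ : K → Bool) :
    prodState (Function.update α τ β) κ = β (κ τ) * ∏ w ∈ Finset.univ.erase τ, α w (κ w) := by
  unfold prodState
  rw [← Finset.mul_prod_erase _ _ (Finset.mem_univ τ), Function.update_self]
  congr 1
  refine Finset.prod_congr rfl fun w hw => ?_
  rw [Function.update_of_ne (Finset.ne_of_mem_erase hw)]

theorem prodState_update_right (α : K → Bool → ℂ) (τ : K) (b : Bool) (κ : K → Bool) :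
    prodState α (Function.update κ τ b) = α τ b * ∏ w ∈ Finset.univ.erase τ, α w (κ w) := by
  unfold prodState
  rw [← Finset.mul_prod_erase _ _ (Finset.mem_univ τ), Function.update_self]
  congr 1
  refine Finset.prod_congr rfl fun w hw => ?_
  rw [Function.update_of_ne (Finset.ne_of_mem_erase hw)]

theorem prodState_eq (α : K → Bool → ℂ) (τ : K) (κ : K → Bool) :
    prodState α κ = α τ (κ τ) * ∏ w ∈ Finset.univ.erase τ, α w (κ w) :=
  (Finset.mul_prod_erase _ _ (Finset.mem_univ τ)).symm

theorem hadamard_prodState (α : K → Bool → ℂ) (τ : K) (κ : K → Bool) :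
    hadamard (fun b => prodState α (Function.update κ τ b)) (κ τ)
      = prodState (Function.update α τ (hadamard (α τ))) κ := by
  simp only [prodState_update_left, prodState_update_right, hadamard]
  ring

theorem phase_prodState (α : K → Bool → ℂ) (τ : K) (c : ℂ) (κ : K → Bool) :
    (if κ τ then c else 1) * prodState α κ
      = prodState (Function.update α τ (fun b => (if b then c else 1) * α τ b)) κ := by
  rw [prodState_update_left, prodState_eq α τ, mul_assoc]

/-- The state of a test qubit after a test whose controlled operator has eigenvalue `μ`. -/
def testState (μ : ℂ) : Bool → ℂ := fun b => (1 + (if b then -1 else 1) * μ) / 2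

theorem hadamard_phase_hadamard (c μ : ℂ) :
    hadamard (fun b => (if b then μ else 1) * ((if b then c else 1) * hadamard ketZero b))
      = testState (c * μ) := by
  have h := invSqrtTwo_mul_self
  funext b
  cases b <;> simp only [hadamard, testState, ketZero, if_true, Bool.false_eq_true, if_false]
  · linear_combination (1 + c * μ) * h
  · linear_combination (1 - c * μ) * h

/-- The Hadamard test on the qubit `τ`: between two Hadamard gates, the phase `c` and the rotation,
repeated `n` times and controlled by `τ`. -/
theorem exists_test (τ : K) (c : ℂ) (hc : ‖c‖ = 1) (n : ℕ) :
    ∃ P : List (BlockGate m (SysWire m K)), blockTime T P ≤ 3 + n * (4 * T + 2 * m + 10) ∧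
      ∀ D e μ (α : K → Bool → ℂ), sysRotate (fun a => (D.prep a).1) e = μ • e → α τ = ketZero →
        blockRun D P (lift (tensor (prodState α) e))
          = lift (tensor (prodState (Function.update α τ (testState (c * μ ^ n)))) e) := by
  obtain ⟨P, hP, hP'⟩ := ((((implLogical_hadamard_test (m := m) (T := T) τ).comp
    (implLogical_phase τ c hc)).comp ((implLogical_rotate τ).iterate n)).comp
    (implLogical_hadamard_test τ))
  refine ⟨P, by linarith, fun D e μ α he hα => ?_⟩
  rw [hP']
  dsimp only
  have h1 : ∀ (α' : K → Bool → ℂ) κ a y,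
      hadamard (fun b => tensor (prodState α') e (Function.update κ τ b) a y) (κ τ)
        = tensor (prodState (Function.update α' τ (hadamard (α' τ)))) e κ a y := by
    intro α' κ a y
    simp only [tensor, Pi.smul_apply, smul_eq_mul, ← hadamard_prodState]
    simp only [hadamard]
    ring
  have h2 : ∀ (α' : K → Bool → ℂ) κ a y,
      (if κ τ then c else 1) * tensor (prodState α') e κ a y
        = tensor (prodState (Function.update α' τ
            (fun b => (if b then c else 1) * α' τ b))) e κ a y := by
    intro α' κ a y
    simp only [tensor, Pi.smul_apply, smul_eq_mul, ← mul_assoc, phase_prodState]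
  have h3 := rotate_iterate_tensor (K := K) (fun a => (D.prep a).1) τ e μ he n
    (prodState (Function.update α τ (fun b => (if b then c else 1) * hadamard (α τ) b)))
  simp only [phase_prodState] at h3
  simp only [h1, h2, Function.update_self, Function.update_idem] at h3 ⊢
  rw [h3]
  simp only [h1, Function.update_self, Function.update_idem, hα, hadamard_phase_hadamard]

/-- Tests on the distinct qubits of a list, the test on `τ` using the power `n τ` of the rotation
and the additional phase `c τ`. -/
theorem exists_tests (L : List K) (hL : L.Nodup) (c : K → ℂ) (hc : ∀ τ, ‖c τ‖ = 1) (n : K → ℕ) :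
    ∃ P : List (BlockGate m (SysWire m K)),
      blockTime T P ≤ (L.map fun τ => 3 + n τ * (4 * T + 2 * m + 10)).sum ∧
      ∀ D e μ (α : K → Bool → ℂ), sysRotate (fun a => (D.prep a).1) e = μ • e →
        (∀ τ ∈ L, α τ = ketZero) →
        blockRun D P (lift (tensor (prodState α) e))
          = lift (tensor (prodState
              (fun w => if w ∈ L then testState (c w * μ ^ n w) else α w)) e) := by
  induction L with
  | nil => exact ⟨[], by simp [blockTime], fun D e μ α _ _ => by simp [blockRun]⟩
  | cons τ L ih =>
    obtain ⟨hτ, hL⟩ := List.nodup_cons.1 hL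
    obtain ⟨P, hP, hP'⟩ := exists_test (m := m) (T := T) τ (c τ) (hc τ) (n τ)
    obtain ⟨Q, hQ, hQ'⟩ := ih hL
    refine ⟨P ++ Q, ?_, fun D e μ α he hα => ?_⟩
    · simp only [blockTime, List.map_append, List.sum_append, List.map_cons, List.sum_cons]
        at hP hQ ⊢
      linarith
    · have h1 := hP' D e μ α he (hα τ (by simp))
      have h2 := hQ' D e μ (Function.update α τ (testState (c τ * μ ^ n τ))) he (fun w hw => by
        rw [Function.update_of_ne (by rintro rfl; exact hτ hw)]
        exact hα w (by simp [hw]))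
      simp only [blockRun, List.foldl_append] at h1 h2 ⊢
      rw [h1, h2]
      congr 3
      funext w
      by_cases hw : w = τ
      · subst hw; simp [hτ]
      · simp [hw]

/-- Loading digits of the norms into the distinct qubits of a list. -/
theorem exists_loads (L : List K) (hL : L.Nodup) (c : K → Bool) (s : K → ℤ) :
    ∃ P : List (BlockGate m (SysWire m K)), blockTime T P ≤ L.length * T ∧
      ∀ D (e : SysState m) (α : K → Bool → ℂ),
        blockRun D P (lift (tensor (prodState α) e))
          = lift (tensor (prodState
              (fun w => if w ∈ L then (fun b => α w (xor b (D.digit (c w) (s w)))) else α w)) e)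
            := by
  induction L with
  | nil => exact ⟨[], by simp [blockTime], fun D e α => by simp [blockRun]⟩
  | cons τ L ih =>
    obtain ⟨hτ, hL⟩ := List.nodup_cons.1 hL
    obtain ⟨P, hP, hP'⟩ := implLogical_norm (m := m) (T := T) (c τ) (s τ) τ
    obtain ⟨Q, hQ, hQ'⟩ := ih hL
    refine ⟨P ++ Q, ?_, fun D e α => ?_⟩
    · simp only [blockTime, List.map_append, List.sum_append, List.length_cons] at hP hQ ⊢
      push_cast
      linarith
    · have h1 := hP' D (tensor (prodState α) e)
      have h0 : (fun κ => tensor (prodState α) e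
          (Function.update κ τ (xor (κ τ) (D.digit (c τ) (s τ)))))
          = tensor (prodState (Function.update α τ
              (fun b => α τ (xor b (D.digit (c τ) (s τ)))))) e := by
        funext κ
        simp only [tensor, prodState_update_left, prodState_update_right]
      have h2 := hQ' D e (Function.update α τ (fun b => α τ (xor b (D.digit (c τ) (s τ)))))
      simp only [blockRun, List.foldl_append] at h1 h2 ⊢
      rw [h1, h0, h2]
      congr 3
      funext w
      by_cases hw : w = τ
      · subst hw; simp [hτ]
      · simp [hw]

end Tests

/-! ### Eigenvectors of the rotation -/

section Eigen

variable {m : ℕ}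

/-- The inner product of states of the ancilla and the target register. -/
def sysInner (φ ψ : SysState m) : ℂ := ∑ a, star (φ a) ⬝ᵥ ψ a

/-- The squared norm of a state of the ancilla and the target register. -/
def sysNormSq (φ : SysState m) : ℝ := ∑ a, ∑ y, ‖φ a y‖ ^ 2

theorem sysInner_self (φ : SysState m) : sysInner φ φ = sysNormSq φ := by
  simp [sysInner, sysNormSq, dotProduct, Complex.conj_mul']

theorem sysInner_conj (φ ψ : SysState m) : star (sysInner φ ψ) = sysInner ψ φ := by
  simp [sysInner, dotProduct, mul_comm]

theorem sysInner_add_right (φ ψ ψ' : SysState m) :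
    sysInner φ (ψ + ψ') = sysInner φ ψ + sysInner φ ψ' := by
  simp only [sysInner, Pi.add_apply, dotProduct_add, Finset.sum_add_distrib]

theorem sysInner_smul_right (φ ψ : SysState m) (c : ℂ) :
    sysInner φ (c • ψ) = c * sysInner φ ψ := by
  simp [sysInner, mul_add]

theorem sysInner_add_left (φ φ' ψ : SysState m) :
    sysInner (φ + φ') ψ = sysInner φ ψ + sysInner φ' ψ := by
  simp only [sysInner, Pi.add_apply, star_add, add_dotProduct, Finset.sum_add_distrib]

theorem sysInner_smul_left (φ ψ : SysState m) (c : ℂ) :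
    sysInner (c • φ) ψ = star c * sysInner φ ψ := by
  simp [sysInner, mul_add]

theorem sysInner_not (φ ψ : SysState m) :
    sysInner (sysNot φ) ψ = sysInner φ (sysNot ψ) := by
  simp [sysInner, sysNot, add_comm]

theorem sysInner_select (U : Bool → Matrix (Fin m → Bool) (Fin m → Bool) ℂ) (φ ψ : SysState m) :
    sysInner (sysSelect U φ) ψ = sysInner φ (sysSelect (fun a => (U a).conjTranspose) ψ) := by
  unfold sysInner
  refine Finset.sum_congr rfl fun a _ => ?_
  have h1 : sysSelect U φ a = (U a).mulVec (φ a) := rfl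
  have h2 : sysSelect (fun a => (U a).conjTranspose) ψ a = (U a).conjTranspose.mulVec (ψ a) := rfl
  rw [h1, h2, Matrix.star_mulVec, Matrix.dotProduct_mulVec]

theorem sysNormSq_add_of_orthogonal (e₁ e₂ : SysState m) (h : sysInner e₁ e₂ = 0) (p q : ℂ) :
    sysNormSq (p • e₁ + q • e₂) = ‖p‖ ^ 2 * sysNormSq e₁ + ‖q‖ ^ 2 * sysNormSq e₂ := by
  have h' : sysInner e₂ e₁ = 0 := by rw [← sysInner_conj, h, star_zero]
  have h1 : ((sysNormSq (p • e₁ + q • e₂) : ℝ) : ℂ)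
      = ((‖p‖ ^ 2 * sysNormSq e₁ + ‖q‖ ^ 2 * sysNormSq e₂ : ℝ) : ℂ) := by
    rw [← sysInner_self]
    simp only [sysInner_add_left, sysInner_add_right, sysInner_smul_left, sysInner_smul_right,
      h, h']
    simp only [sysInner_self]
    push_cast
    rw [← Complex.conj_mul', ← Complex.conj_mul']
    simp only [starRingEnd_apply]
    ring
  exact_mod_cast h1

/-- The state `|+⟩|0⟩`. -/
def plusState (m : ℕ) : SysState m := fun _ y => if y = (fun _ => false) then invSqrtTwo else 0

theorem sysReflect_conj (φ : SysState m) (a : Bool) (y : Fin m → Bool) :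
    sysHadamard (sysReflect (sysHadamard φ)) a y
      = (if y = (fun _ => false) then φ false y + φ true y else 0) - φ a y := by
  have h := invSqrtTwo_mul_self
  by_cases hy : y = (fun _ => false)
  · cases a <;> simp only [sysHadamard, hadamard, sysReflect, hy, if_true, Bool.false_eq_true,
      if_false, and_true, Bool.true_eq_false]
    · linear_combination 2 * φ true (fun _ => false) * h
    · linear_combination 2 * φ false (fun _ => false) * h
  · cases a <;> simp only [sysHadamard, hadamard, sysReflect, hy, if_true, Bool.false_eq_true,
      if_false, and_false]
    · linear_combination (-2) * φ false y * h
    · linear_combination (-2) * φ true y * h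

/-- The real part of the inner product of the two prepared states. -/
def overlap (U : Bool → Matrix (Fin m → Bool) (Fin m → Bool) ℂ) : ℝ :=
  (∑ y, star (U false y (fun _ => false)) * U true y (fun _ => false)).re

/-- The involution in the rotation. -/
def sysSwap (U : Bool → Matrix (Fin m → Bool) (Fin m → Bool) ℂ) (φ : SysState m) : SysState m :=
  sysSelect (fun a => (U a).conjTranspose) (sysNot (sysSelect U φ))

theorem sysRotate_apply (U : Bool → Matrix (Fin m → Bool) (Fin m → Bool) ℂ) (φ : SysState m)
    (a : Bool) (y : Fin m → Bool) :
    sysRotate U φ a y = (if y = (fun _ => false) then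
      sysSwap U φ false y + sysSwap U φ true y else 0) - sysSwap U φ a y :=
  sysReflect_conj _ a y

theorem sysSwap_sysSwap (U : Bool → Matrix.unitaryGroup (Fin m → Bool) ℂ) (φ : SysState m) :
    sysSwap (fun a => (U a).1) (sysSwap (fun a => (U a).1) φ) = φ := by
  have h : ∀ φ : SysState m, sysSelect (fun a => (U a).1)
      (sysSelect (fun a => (U a).1.conjTranspose) φ) = φ := by
    intro φ
    funext a
    have h : (U a).1.mulVec ((U a).1.conjTranspose.mulVec (φ a)) = φ a := by
      have h0 := (U a).2
      rw [Matrix.mem_unitaryGroup_iff] at h0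
      rw [Matrix.mulVec_mulVec, ← Matrix.star_eq_conjTranspose, h0, Matrix.one_mulVec]
    exact h
  have hn : ∀ φ : SysState m, sysNot (sysNot φ) = φ := by
    intro φ; funext a; simp [sysNot]
  simp only [sysSwap, h, hn, sysSelect_adjoint]

theorem sysInner_swap (U : Bool → Matrix (Fin m → Bool) (Fin m → Bool) ℂ) (φ ψ : SysState m) :
    sysInner (sysSwap U φ) ψ = sysInner φ (sysSwap U ψ) := by
  simp only [sysSwap, sysInner_select, sysInner_not, Matrix.conjTranspose_conjTranspose]

theorem sysInner_plus (ψ : SysState m) :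
    sysInner (plusState m) ψ
      = invSqrtTwo * (ψ false (fun _ => false) + ψ true (fun _ => false)) := by
  have h1 : star invSqrtTwo = invSqrtTwo := Complex.conj_ofReal _
  have h2 : ∀ a, star (plusState m a) = plusState m a := by
    intro a
    funext y
    simp only [plusState, Pi.star_apply]
    split_ifs <;> simp [h1]
  simp only [sysInner, h2, Fintype.sum_bool, dotProduct, plusState, ite_mul, zero_mul,
    Finset.sum_ite_eq', Finset.mem_univ, if_true]
  ring

theorem sysInner_plus_swap (U : Bool → Matrix (Fin m → Bool) (Fin m → Bool) ℂ) :
    sysInner (plusState m) (sysSwap U (plusState m)) = overlap U := by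
  set w : ℂ := ∑ y, star (U false y (fun _ => false)) * U true y (fun _ => false) with hw
  have h1 : sysSwap U (plusState m) false (fun _ => false) = invSqrtTwo * w := by
    simp [sysSwap, sysSelect, sysNot, plusState, hw, Finset.mul_sum, mul_comm, mul_left_comm]
  have h2 : sysSwap U (plusState m) true (fun _ => false) = invSqrtTwo * star w := by
    simp [sysSwap, sysSelect, sysNot, plusState, hw, Finset.mul_sum, mul_comm, mul_left_comm]
  rw [sysInner_plus, h1, h2]
  have h3 : w + star w = 2 * (overlap U : ℂ) := by
    have h4 := Complex.add_conj w
    have h5 : overlap U = w.re := rfl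
    rw [h5]
    exact_mod_cast h4
  linear_combination (w + star w) * invSqrtTwo_mul_self + h3 / 2

theorem sysNormSq_plus : sysNormSq (plusState m) = 1 := by
  have h : ((sysNormSq (plusState m) : ℝ) : ℂ) = ((1 : ℝ) : ℂ) := by
    rw [← sysInner_self, sysInner_plus]
    simp only [plusState, if_true]
    push_cast
    linear_combination 2 * invSqrtTwo_mul_self
  exact_mod_cast h

theorem sysRotate_plus (U : Bool → Matrix.unitaryGroup (Fin m → Bool) ℂ) :
    sysRotate (fun a => (U a).1) (plusState m)
      = (2 * (overlap (fun a => (U a).1) : ℂ)) • plusState m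
        - sysSwap (fun a => (U a).1) (plusState m) := by
  have h := sysInner_plus_swap (fun a => (U a).1)
  rw [sysInner_plus] at h
  funext a y
  rw [sysRotate_apply]
  simp only [Pi.sub_apply, Pi.smul_apply, smul_eq_mul]
  congr 1
  by_cases hy : y = (fun _ => false)
  · subst hy
    simp only [if_true, plusState]
    rw [← h]
    linear_combination (-2) * (sysSwap (fun a => (U a).1) (plusState m) false (fun _ => false)
      + sysSwap (fun a => (U a).1) (plusState m) true (fun _ => false)) * invSqrtTwo_mul_self
  · simp [plusState, hy]

theorem sysRotate_swap (U : Bool → Matrix.unitaryGroup (Fin m → Bool) ℂ) :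
    sysRotate (fun a => (U a).1) (sysSwap (fun a => (U a).1) (plusState m)) = plusState m := by
  funext a y
  rw [sysRotate_apply, sysSwap_sysSwap]
  by_cases hy : y = (fun _ => false) <;> simp [plusState, hy]

theorem sysRotate_add (U : Bool → Matrix (Fin m → Bool) (Fin m → Bool) ℂ) (φ ψ : SysState m)
    (c d : ℂ) : sysRotate U (c • φ + d • ψ) = c • sysRotate U φ + d • sysRotate U ψ := by
  have h : ∀ a y, sysSwap U (c • φ + d • ψ) a y = c * sysSwap U φ a y + d * sysSwap U ψ a y := by
    intro a y
    simp only [sysSwap, sysSelect, sysNot, Pi.add_apply, Pi.smul_apply, smul_eq_mul, mul_add,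
      Finset.sum_add_distrib, Finset.mul_sum]
    congr 1 <;>
    · refine Finset.sum_congr rfl fun _ _ => Finset.sum_congr rfl fun _ _ => ?_
      ring
  funext a y
  simp only [sysRotate_apply, h, Pi.add_apply, Pi.smul_apply, smul_eq_mul]
  split_ifs <;> ring

/-- The start state `|+⟩|0⟩` is the sum of two orthogonal eigenvectors of the rotation, with
eigenvalues `exp (± i θ)` where `cos θ` is the overlap of the two prepared states. If the overlap
is `± 1`, the start state itself is an eigenvector. -/
theorem exists_eigenvectors (U : Bool → Matrix.unitaryGroup (Fin m → Bool) ℂ) :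
    ∃ (e₁ e₂ : SysState m) (θ₁ θ₂ : ℝ), e₁ + e₂ = plusState m ∧ sysInner e₁ e₂ = 0 ∧
      sysRotate (fun a => (U a).1) e₁ = Complex.exp (θ₁ * Complex.I) • e₁ ∧
      sysRotate (fun a => (U a).1) e₂ = Complex.exp (θ₂ * Complex.I) • e₂ ∧
      Real.cos θ₁ = overlap (fun a => (U a).1) ∧ Real.cos θ₂ = overlap (fun a => (U a).1) := by
  set G := sysRotate (fun a => (U a).1) with hG
  set s := overlap (fun a => (U a).1) with hs
  set ψ := plusState m with hψ
  set χ := sysSwap (fun a => (U a).1) ψ with hχ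
  have hψψ : sysInner ψ ψ = 1 := by rw [sysInner_self, sysNormSq_plus]; simp
  have hψχ : sysInner ψ χ = s := sysInner_plus_swap _
  have hχψ : sysInner χ ψ = s := by
    rw [← sysInner_conj, hψχ]; exact Complex.conj_ofReal s
  have hχχ : sysInner χ χ = 1 := by
    rw [hχ, sysInner_swap, sysSwap_sysSwap, hψψ]
  have hGψ : G ψ = (2 * (s : ℂ)) • ψ - χ := sysRotate_plus U
  have hGχ : G χ = ψ := sysRotate_swap U
  have hdiff : sysNormSq (χ + (-(s : ℂ)) • ψ) = 1 - s ^ 2 := by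
    have : ((sysNormSq (χ + (-(s : ℂ)) • ψ) : ℝ) : ℂ) = ((1 - s ^ 2 : ℝ) : ℂ) := by
      rw [← sysInner_self]
      simp only [sysInner_add_left, sysInner_add_right, sysInner_smul_left, sysInner_smul_right,
        hψψ, hψχ, hχψ, hχχ]
      have : star (-(s : ℂ)) = -(s : ℂ) := by
        rw [star_neg]; congr 1; exact Complex.conj_ofReal s
      rw [this]
      push_cast
      ring
    exact_mod_cast this
  have hs1 : s ^ 2 ≤ 1 := by
    have : 0 ≤ sysNormSq (χ + (-(s : ℂ)) • ψ) :=
      Finset.sum_nonneg fun _ _ => Finset.sum_nonneg fun _ _ => by positivity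
    linarith
  have hcos : Real.cos (Real.arccos s) = s :=
    Real.cos_arccos (by nlinarith) (by nlinarith)
  -- the plane spanned by `ψ` and `χ` is invariant; it degenerates to a line if `s = ± 1`
  by_cases hs2 : s ^ 2 = 1
  · have h0 : χ = (s : ℂ) • ψ := by
      rw [hs2, sub_self] at hdiff
      have h1 := (Finset.sum_eq_zero_iff_of_nonneg (fun _ _ =>
        Finset.sum_nonneg fun _ _ => by positivity)).1 hdiff
      funext a y
      have h2 := (Finset.sum_eq_zero_iff_of_nonneg (fun _ _ => by positivity)).1
        (h1 a (Finset.mem_univ _)) y (Finset.mem_univ _)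
      have h3 : (χ + (-(s : ℂ)) • ψ) a y = 0 := by
        simpa using h2
      have h4 : χ a y + -(s : ℂ) * ψ a y = 0 := h3
      simp only [Pi.smul_apply, smul_eq_mul]
      linear_combination h4
    have hexp : Complex.exp (Real.arccos s * Complex.I) = s := by
      rw [Complex.exp_mul_I, ← Complex.ofReal_cos, ← Complex.ofReal_sin, hcos, Real.sin_arccos,
        hs2]
      simp
    refine ⟨ψ, 0, Real.arccos s, Real.arccos s, add_zero _, ?_, ?_, ?_, hcos, hcos⟩
    · simp [sysInner]
    · rw [hGψ, hexp, h0, ← sub_smul]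
      congr 1
      ring
    · have := sysRotate_add (fun a => (U a).1) ψ ψ 0 0
      simpa using this
  · set φ := Real.arccos s with hφ
    set z := Complex.exp (φ * Complex.I) with hz
    set z' := Complex.exp ((-φ : ℝ) * Complex.I) with hz'
    have hzz : z * z' = 1 := by
      rw [hz, hz', ← Complex.exp_add]; simp
    have hsum : z + z' = 2 * s := by
      rw [hz, hz', Complex.exp_mul_I, Complex.exp_mul_I]
      push_cast
      rw [Complex.cos_neg, Complex.sin_neg, ← Complex.ofReal_cos, hcos]
      ring
    have hconj : star z = z' := by
      rw [hz, hz']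
      change (starRingEnd ℂ) _ = _
      rw [← Complex.exp_conj]
      simp
    have hne : z' - z ≠ 0 := by
      intro h
      have h1 : z = (s : ℂ) := by linear_combination hsum / 2 - h / 2
      have h2 : z' = (s : ℂ) := by linear_combination hsum / 2 + h / 2
      rw [h1, h2] at hzz
      apply hs2
      have : ((s ^ 2 : ℝ) : ℂ) = ((1 : ℝ) : ℂ) := by
        push_cast
        linear_combination hzz
      exact_mod_cast this
    -- in the plane, `G` has the characteristic polynomial `X ^ 2 - 2 s X + 1`
    have heig : ∀ u u' : ℂ, u * u' = 1 → u + u' = 2 * s → ∀ c : ℂ,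
        G (c • ψ + (-(c * u)) • χ) = u' • (c • ψ + (-(c * u)) • χ) := by
      intro u u' h1 h2 c
      rw [hG, sysRotate_add, ← hG, hGψ, hGχ]
      funext a y
      simp only [Pi.add_apply, Pi.sub_apply, Pi.smul_apply, smul_eq_mul]
      linear_combination (-(c * ψ a y)) * h2 + c * χ a y * h1
    -- the coefficients make the sum equal to `ψ`
    refine ⟨(z' / (z' - z)) • ψ + (-((z' / (z' - z)) * z)) • χ,
      (-z / (z' - z)) • ψ + (-((-z / (z' - z)) * z')) • χ, -φ, φ, ?_, ?_,
      heig z z' hzz hsum _,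
      heig z' z (by rw [mul_comm]; exact hzz) (by rw [add_comm]; exact hsum) _,
      by rw [Real.cos_neg, hcos], hcos⟩
    · funext a y
      simp only [Pi.add_apply, Pi.smul_apply, smul_eq_mul]
      field_simp
      ring
    · simp only [sysInner_add_left, sysInner_add_right, sysInner_smul_left, sysInner_smul_right,
        hψψ, hψχ, hχψ, hχχ, star_neg, star_mul', hconj]
      linear_combination (star (z' / (z' - z)) * (-z / (z' - z))) * (z' * hsum - hzz)

end Eigen

/-! ### Straight-line programs -/

section Programs

variable {Ω : Type}

/-- A straight-line program over the Boolean functions `B`: the list (latest first) of the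
functions that it computes, each obtained by a binary operation from two functions that are in `B`
or computed earlier. -/
inductive Program (B : Set (Ω → Bool)) : List (Ω → Bool) → Prop
  | nil : Program B []
  | cons {l : List (Ω → Bool)} {u v : Ω → Bool} (op : Bool → Bool → Bool)
      (hu : u ∈ B ∨ u ∈ l) (hv : v ∈ B ∨ v ∈ l) (hl : Program B l) :
      Program B ((fun ω => op (u ω) (v ω)) :: l)

/-- All functions in `F` can be computed from those in `B` by a single program with at most `L`
instructions. -/
def Computes (B : Set (Ω → Bool)) (L : ℕ) (F : Set (Ω → Bool)) : Prop :=
  ∃ l, Program B l ∧ l.length ≤ L ∧ ∀ f ∈ F, f ∈ B ∨ f ∈ l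

theorem Program.append {B B' : Set (Ω → Bool)} {l l' : List (Ω → Bool)} (h : Program B l)
    (h' : Program B' l') (hB : ∀ f ∈ B', f ∈ B ∨ f ∈ l) : Program B (l' ++ l) := by
  induction h' with
  | nil => exact h
  | @cons l' u v op hu hv hl ih =>
    have key : ∀ w, w ∈ B' ∨ w ∈ l' → w ∈ B ∨ w ∈ l' ++ l := by
      rintro w (hw | hw)
      · rcases hB w hw with h1 | h1
        · exact Or.inl h1
        · exact Or.inr (List.mem_append_right _ h1)
      · exact Or.inr (List.mem_append_left _ hw)
    exact Program.cons op (key u hu) (key v hv) ih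

theorem Computes.of_subset {B F : Set (Ω → Bool)} (h : F ⊆ B) : Computes B 0 F :=
  ⟨[], Program.nil, le_rfl, fun _ hf => Or.inl (h hf)⟩

theorem Computes.bind {B F F' : Set (Ω → Bool)} {L L' : ℕ} (h : Computes B L F)
    (h' : Computes (B ∪ F) L' F') : Computes B (L + L') F' := by
  obtain ⟨l, hl, hlen, hF⟩ := h
  obtain ⟨l', hl', hlen', hF'⟩ := h'
  have hB : ∀ f ∈ B ∪ F, f ∈ B ∨ f ∈ l := by
    rintro f (hf | hf)
    · exact Or.inl hf
    · exact hF f hf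
  refine ⟨l' ++ l, hl.append hl' hB, by rw [List.length_append]; omega, fun f hf => ?_⟩
  rcases hF' f hf with h1 | h1
  · rcases hB f h1 with h2 | h2
    · exact Or.inl h2
    · exact Or.inr (List.mem_append_right _ h2)
  · exact Or.inr (List.mem_append_left _ h1)

theorem Computes.mono {B B' F F' : Set (Ω → Bool)} {L L' : ℕ} (h : Computes B L F) (hB : B ⊆ B')
    (hL : L ≤ L') (hF : F' ⊆ F) : Computes B' L' F' := by
  obtain ⟨l, hl, hlen, hF0⟩ := h
  refine ⟨l, ?_, hlen.trans hL, fun f hf => (hF0 f (hF hf)).imp (fun h => hB h) id⟩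
  have := (Program.nil (B := B')).append hl (fun f hf => Or.inl (hB hf))
  simpa using this

theorem Computes.union {B F F' : Set (Ω → Bool)} {L L' : ℕ} (h : Computes B L F)
    (h' : Computes B L' F') : Computes B (L + L') (F ∪ F') := by
  obtain ⟨l, hl, hlen, hF⟩ := h
  obtain ⟨l', hl', hlen', hF'⟩ := h'
  refine ⟨l' ++ l, hl.append hl' (fun f hf => Or.inl hf), by rw [List.length_append]; omega, ?_⟩
  rintro f (hf | hf)
  · exact (hF f hf).imp id (List.mem_append_right _)
  · exact (hF' f hf).imp id (List.mem_append_left _)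

theorem Computes.op {B : Set (Ω → Bool)} {u v : Ω → Bool} (hu : u ∈ B) (hv : v ∈ B)
    (op : Bool → Bool → Bool) : Computes B 1 {fun ω => op (u ω) (v ω)} :=
  ⟨[_], Program.cons op (Or.inl hu) (Or.inl hv) Program.nil, le_rfl, fun f hf => by
    right; simpa using hf⟩

theorem Computes.family {B : Set (Ω → Bool)} {c : ℕ} (g : ℕ → Ω → Bool) (n : ℕ)
    (h : ∀ i < n, Computes B c {g i}) : Computes B (n * c) {f | ∃ i < n, f = g i} := by
  induction n with
  | zero => exact (Computes.of_subset (F := ∅) (by simp)).mono subset_rfl (by simp) (by simp)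
  | succ n ih =>
    refine ((ih fun i hi => h i (by omega)).union (h n (by omega))).mono subset_rfl
      (by rw [Nat.succ_mul]) ?_
    rintro f ⟨i, hi, rfl⟩
    rcases Nat.lt_succ_iff_lt_or_eq.1 hi with h1 | rfl
    · exact Or.inl ⟨i, h1, rfl⟩
    · exact Or.inr rfl

/-- The majority of three bits. -/
def maj₃ (a b c : Bool) : Bool := (a && b) || (xor a b && c)

/-- The parity of three bits. -/
def xor₃ (a b c : Bool) : Bool := xor (xor a b) c

theorem Computes.fullAdder {B : Set (Ω → Bool)} {a b c : Ω → Bool} (ha : a ∈ B) (hb : b ∈ B)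
    (hc : c ∈ B) : Computes B 5 {fun ω => xor₃ (a ω) (b ω) (c ω),
      fun ω => maj₃ (a ω) (b ω) (c ω)} := by
  have h1 : Computes B 1 {fun ω => xor (a ω) (b ω)} := Computes.op ha hb xor
  have h2 : Computes (B ∪ {fun ω => xor (a ω) (b ω)}) 3
      ({fun ω => xor₃ (a ω) (b ω) (c ω)} ∪ {fun ω => xor (a ω) (b ω) && c ω} ∪
        {fun ω => a ω && b ω}) :=
    ((Computes.op (Or.inr rfl) (Or.inl hc) xor).union
      (Computes.op (Or.inr rfl) (Or.inl hc) and)).union (Computes.op (Or.inl ha) (Or.inl hb) and)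
  have h3 := h1.bind (h2.bind ((Computes.of_subset (B := (B ∪ {fun ω => xor (a ω) (b ω)}) ∪
    ({fun ω => xor₃ (a ω) (b ω) (c ω)} ∪ {fun ω => xor (a ω) (b ω) && c ω} ∪
        {fun ω => a ω && b ω})) (F := {fun ω => xor₃ (a ω) (b ω) (c ω)}) (by simp)).union
    (Computes.op (u := fun ω => a ω && b ω) (v := fun ω => xor (a ω) (b ω) && c ω)
      (by simp) (by simp) or)))
  refine h3.mono subset_rfl le_rfl ?_
  rintro f (rfl | rfl)
  · exact Or.inl rfl
  · exact Or.inr rfl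

theorem Computes.mux {B : Set (Ω → Bool)} {c u v : Ω → Bool} (hc : c ∈ B) (hu : u ∈ B)
    (hv : v ∈ B) : Computes B 3 {fun ω => if c ω then u ω else v ω} := by
  have h1 : Computes B 2 ({fun ω => c ω && u ω} ∪ {fun ω => !c ω && v ω}) :=
    (Computes.op hc hu and).union (Computes.op hc hv (fun p q => !p && q))
  refine (h1.bind (Computes.op (u := fun ω => c ω && u ω) (v := fun ω => !c ω && v ω)
    (by simp) (by simp) or)).mono subset_rfl le_rfl ?_
  rintro f rfl
  refine Set.mem_singleton_iff.2 (funext fun ω => ?_)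
  cases c ω <;> simp

/-! #### Table lookup -/

/-- The number with the binary digits `b 0, …, b (n - 1)`. -/
def bitsValue (b : ℕ → Bool) (n : ℕ) : ℕ := ∑ i ∈ Finset.range n, if b i then 2 ^ i else 0

theorem bitsValue_succ (b : ℕ → Bool) (n : ℕ) :
    bitsValue b (n + 1) = bitsValue b n + if b n then 2 ^ n else 0 := by
  simp [bitsValue, Finset.sum_range_succ]

theorem bitsValue_lt (b : ℕ → Bool) (n : ℕ) : bitsValue b n < 2 ^ n := by
  induction n with
  | zero => simp [bitsValue]
  | succ n ih =>
    rw [bitsValue_succ, pow_succ]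
    split_ifs <;> omega

theorem bitsValue_add (b : ℕ → Bool) (n k : ℕ) :
    bitsValue b (n + k) = bitsValue b n + 2 ^ n * bitsValue (fun i => b (n + i)) k := by
  unfold bitsValue
  rw [Finset.sum_range_add, Finset.mul_sum]
  congr 1
  refine Finset.sum_congr rfl fun i _ => ?_
  split_ifs <;> simp [pow_add]

/-- Every function of `n` bits has a program of length `O(2 ^ n)`: a multiplexer on the highest bit
chooses between two functions of the other bits. -/
theorem Computes.table {B : Set (Ω → Bool)} (h0 : (fun _ => false) ∈ B) (b : ℕ → Ω → Bool) (n : ℕ)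
    (hb : ∀ i < n, b i ∈ B) (g : ℕ → Bool) :
    Computes B (4 * 2 ^ n - 3) {fun ω => g (bitsValue (fun i => b i ω) n)} := by
  induction n generalizing g with
  | zero =>
    refine (Computes.op h0 h0 (fun _ _ => g 0)).mono subset_rfl (by norm_num) ?_
    simp [bitsValue]
  | succ n ih =>
    have h1 := (ih (fun i hi => hb i (by omega)) (fun i => g (i + 2 ^ n))).union
      (ih (fun i hi => hb i (by omega)) g)
    refine (h1.bind (Computes.mux (c := b n)
      (u := fun ω => g (bitsValue (fun i => b i ω) n + 2 ^ n))
      (v := fun ω => g (bitsValue (fun i => b i ω) n)) (Or.inl (hb n (by omega)))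
      (by simp) (by simp))).mono subset_rfl ?_ ?_
    · have : 1 ≤ 2 ^ n := Nat.one_le_two_pow
      rw [pow_succ]
      omega
    · rintro f rfl
      refine Set.mem_singleton_iff.2 (funext fun ω => ?_)
      rw [bitsValue_succ]
      split_ifs <;> simp

/-! #### Integer arithmetic in two's complement -/

/-- The binary digit of weight `2 ^ i` of an integer, in two's complement. -/
def intBit (z : ℤ) (i : ℕ) : Bool := decide (z / 2 ^ i % 2 = 1)

/-- The lowest `Q` binary digits of an integer that depends on `ω`. -/
def lowBits (Z : Ω → ℤ) (Q : ℕ) : Set (Ω → Bool) := {f | ∃ i < Q, f = fun ω => intBit (Z ω) i}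

theorem mem_lowBits {Z : Ω → ℤ} {Q i : ℕ} (h : i < Q) :
    (fun ω => intBit (Z ω) i) ∈ lowBits Z Q := ⟨i, h, rfl⟩

theorem emod_two_pow_succ (z : ℤ) (i : ℕ) :
    z % 2 ^ (i + 1) = z % 2 ^ i + if intBit z i then 2 ^ i else 0 := by
  have hp : (0 : ℤ) < 2 ^ i := by positivity
  have h1 := Int.mul_ediv_add_emod z (2 ^ i)
  have h2 := Int.mul_ediv_add_emod (z / 2 ^ i) 2
  have h3 := Int.emod_nonneg z hp.ne'
  have h4 := Int.emod_lt_of_pos z hp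
  have h5 : z % 2 ^ (i + 1) = (z % 2 ^ i + 2 ^ i * (z / 2 ^ i % 2)) % 2 ^ (i + 1) := by
    have : z = (z % 2 ^ i + 2 ^ i * (z / 2 ^ i % 2)) + 2 ^ (i + 1) * (z / 2 ^ i / 2) := by
      rw [pow_succ]
      linear_combination (-1 : ℤ) * h1 - 2 ^ i * h2
    conv_lhs => rw [this]
    rw [Int.add_mul_emod_self_left]
  rcases Int.emod_two_eq_zero_or_one (z / 2 ^ i) with h | h
  · rw [h5, h, mul_zero, add_zero, Int.emod_eq_of_lt h3 (by rw [pow_succ]; linarith)]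
    simp [intBit, h]
  · rw [h5, h, mul_one, Int.emod_eq_of_lt (by linarith) (by rw [pow_succ]; linarith)]
    simp [intBit, h]

/-- The carry into position `i` when two integers are added. -/
def carryBit (z z' : ℤ) (i : ℕ) : Bool := decide (2 ^ i ≤ z % 2 ^ i + z' % 2 ^ i)

theorem carryBit_succ (z z' : ℤ) (i : ℕ) :
    carryBit z z' (i + 1) = maj₃ (intBit z i) (intBit z' i) (carryBit z z' i) := by
  have hp : (0 : ℤ) < 2 ^ i := by positivity
  have h3 := Int.emod_nonneg z hp.ne'
  have h4 := Int.emod_lt_of_pos z hp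
  have h5 := Int.emod_nonneg z' hp.ne'
  have h6 := Int.emod_lt_of_pos z' hp
  unfold carryBit
  rw [emod_two_pow_succ, emod_two_pow_succ, pow_succ]
  cases intBit z i <;> cases intBit z' i <;> simp [maj₃] <;> omega

theorem intBit_add (z z' : ℤ) (i : ℕ) :
    intBit (z + z') i = xor₃ (intBit z i) (intBit z' i) (carryBit z z' i) := by
  have hp : (0 : ℤ) < 2 ^ i := by positivity
  have h1 := Int.mul_ediv_add_emod z (2 ^ i)
  have h2 := Int.mul_ediv_add_emod z' (2 ^ i)
  have h3 := Int.emod_nonneg z hp.ne'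
  have h4 := Int.emod_lt_of_pos z hp
  have h5 := Int.emod_nonneg z' hp.ne'
  have h6 := Int.emod_lt_of_pos z' hp
  have h7 : (z + z') / 2 ^ i = z / 2 ^ i + z' / 2 ^ i + (z % 2 ^ i + z' % 2 ^ i) / 2 ^ i := by
    have : z + z' = (z % 2 ^ i + z' % 2 ^ i) + 2 ^ i * (z / 2 ^ i + z' / 2 ^ i) := by
      linear_combination (-1 : ℤ) * h1 - h2
    rw [this, Int.add_mul_ediv_left _ _ hp.ne']
    ring
  have h8 : (z % 2 ^ i + z' % 2 ^ i) / 2 ^ i = if carryBit z z' i then 1 else 0 := by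
    unfold carryBit
    by_cases h : 2 ^ i ≤ z % 2 ^ i + z' % 2 ^ i
    · simp only [h, decide_true, if_true]
      rw [Int.ediv_eq_iff_of_pos hp]
      constructor <;> linarith
    · simp only [h, decide_false, Bool.false_eq_true, if_false]
      exact Int.ediv_eq_zero_of_lt (by linarith) (by linarith)
  unfold intBit
  rw [h7, h8]
  generalize z / 2 ^ i = p
  generalize z' / 2 ^ i = q
  rcases Int.emod_two_eq_zero_or_one p with hp' | hp' <;>
  rcases Int.emod_two_eq_zero_or_one q with hq' | hq' <;>
  cases carryBit z z' i <;> simp [xor₃, hp', hq'] <;> omega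

/-- Addition modulo `2 ^ Q` by a chain of full adders. -/
theorem Computes.add {B : Set (Ω → Bool)} (h0 : (fun _ => false) ∈ B) {Z Z' : Ω → ℤ} (Q : ℕ)
    (hZ : lowBits Z Q ⊆ B) (hZ' : lowBits Z' Q ⊆ B) :
    Computes B (Q * 5) (lowBits (fun ω => Z ω + Z' ω) Q) := by
  suffices h : ∀ q ≤ Q, Computes B (q * 5) (lowBits (fun ω => Z ω + Z' ω) q ∪
      {fun ω => carryBit (Z ω) (Z' ω) q}) from
    (h Q le_rfl).mono subset_rfl le_rfl Set.subset_union_left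
  intro q hq
  induction q with
  | zero =>
    refine (Computes.of_subset (F := {fun _ => false}) (by simpa using h0)).mono subset_rfl
      (by simp) ?_
    rintro f (⟨i, hi, -⟩ | rfl)
    · omega
    · simp [carryBit]
  | succ q ih =>
    have h1 := ih (by omega)
    refine (h1.bind ((Computes.of_subset (F := lowBits (fun ω => Z ω + Z' ω) q) ?_).union
      (Computes.fullAdder (a := fun ω => intBit (Z ω) q) (b := fun ω => intBit (Z' ω) q)
        (c := fun ω => carryBit (Z ω) (Z' ω) q) ?_ ?_ ?_))).mono subset_rfl (by omega) ?_
    · exact fun f hf => Or.inr (Or.inl hf)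
    · exact Or.inl (hZ (mem_lowBits (by omega)))
    · exact Or.inl (hZ' (mem_lowBits (by omega)))
    · exact Or.inr (Or.inr rfl)
    · rintro f (⟨i, hi, rfl⟩ | rfl)
      · rcases Nat.lt_succ_iff_lt_or_eq.1 hi with h1 | rfl
        · exact Or.inl (mem_lowBits h1)
        · right; left
          funext ω
          exact intBit_add _ _ _
      · right; right
        funext ω
        exact carryBit_succ _ _ _

theorem intBit_not (z : ℤ) (i : ℕ) : intBit (-1 - z) i = !intBit z i := by
  have hp : (0 : ℤ) < 2 ^ i := by positivity
  have h1 := Int.mul_ediv_add_emod z (2 ^ i)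
  have h3 := Int.emod_nonneg z hp.ne'
  have h4 := Int.emod_lt_of_pos z hp
  have h : (-1 - z) / 2 ^ i = -1 - z / 2 ^ i := by
    rw [Int.ediv_eq_iff_of_pos hp]
    constructor <;> nlinarith
  unfold intBit
  rw [h]
  generalize z / 2 ^ i = p
  rcases Int.emod_two_eq_zero_or_one p with hp' | hp' <;> simp [hp'] <;> omega

theorem Computes.not {B : Set (Ω → Bool)} {Z : Ω → ℤ} (Q : ℕ) (hZ : lowBits Z Q ⊆ B) :
    Computes B (Q * 1) (lowBits (fun ω => -1 - Z ω) Q) := by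
  refine Computes.family (fun i ω => intBit (-1 - Z ω) i) Q fun i hi => ?_
  have := Computes.op (hZ (mem_lowBits hi)) (hZ (mem_lowBits hi)) (fun p _ => !p)
  simpa only [intBit_not] using this

theorem Computes.sub {B : Set (Ω → Bool)} (h0 : (fun _ => false) ∈ B) {Z Z' : Ω → ℤ} (Q : ℕ)
    (hZ : lowBits Z Q ⊆ B) (hZ' : lowBits Z' Q ⊆ B) :
    Computes B (Q * 7) (lowBits (fun ω => Z ω - Z' ω) Q) := by
  -- `z - z' = -1 - ((-1 - z) + z')`
  have h1 := Computes.not Q hZ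
  have h2 := h1.bind (Computes.add (Or.inl h0) Q (Set.subset_union_right)
    (hZ'.trans Set.subset_union_left))
  have h3 := h2.bind (Computes.not Q Set.subset_union_right)
  refine h3.mono subset_rfl (by omega) ?_
  have : (fun ω => -1 - (-1 - Z ω + Z' ω)) = fun ω => Z ω - Z' ω := by
    funext ω; ring
  rw [this]

theorem intBit_shift (z : ℤ) (n i : ℕ) :
    intBit (2 ^ n * z) i = if i < n then false else intBit z (i - n) := by
  split_ifs with h
  · unfold intBit
    obtain ⟨k, rfl⟩ := Nat.exists_eq_add_of_lt h
    have : (2 : ℤ) ^ (i + k + 1) * z = 2 ^ i * (2 * (2 ^ k * z)) := by ring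
    rw [this, Int.mul_ediv_cancel_left _ (by positivity)]
    simp
  · obtain ⟨k, rfl⟩ := Nat.exists_eq_add_of_le (not_lt.1 h)
    unfold intBit
    rw [Nat.add_sub_cancel_left, pow_add, Int.mul_ediv_mul_of_pos _ _ (by positivity)]

/-- Multiplication by repeated addition of shifted summands. The multiplicand `Z` may be negative,
but the multiplier `Z'` may not, since its digits are used without a sign. -/
theorem Computes.mul {B : Set (Ω → Bool)} (h0 : (fun _ => false) ∈ B) {Z Z' : Ω → ℤ} (Q n : ℕ)
    (hZ : lowBits Z Q ⊆ B) (hZ' : lowBits Z' n ⊆ B) (hpos : ∀ ω, 0 ≤ Z' ω)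
    (hlt : ∀ ω, Z' ω < 2 ^ n) :
    Computes B (n * (Q * 6)) (lowBits (fun ω => Z ω * Z' ω) Q) := by
  suffices h : ∀ k ≤ n, Computes B (k * (Q * 6)) (lowBits (fun ω => Z ω * (Z' ω % 2 ^ k)) Q) by
    have h1 := h n le_rfl
    have : (fun ω => Z ω * (Z' ω % 2 ^ n)) = fun ω => Z ω * Z' ω := by
      funext ω
      rw [Int.emod_eq_of_lt (hpos ω) (hlt ω)]
    rwa [this] at h1
  intro k hk
  induction k with
  | zero =>
    refine (Computes.of_subset (F := {fun _ => false}) (by simpa using h0)).mono subset_rfl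
      (by simp) ?_
    rintro f ⟨i, hi, rfl⟩
    simp [intBit]
  | succ k ih =>
    have h1 := ih (by omega)
    have h2 : Computes B (Q * 1)
        (lowBits (fun ω => 2 ^ k * (if intBit (Z' ω) k then Z ω else 0)) Q) := by
      refine Computes.family
        (fun i ω => intBit (2 ^ k * (if intBit (Z' ω) k then Z ω else 0)) i) Q fun i hi => ?_
      have hb : (fun ω => intBit (Z' ω) k) ∈ B := hZ' (mem_lowBits (by omega))
      by_cases hik : i < k
      · refine (Computes.op h0 h0 (fun _ _ => false)).mono subset_rfl le_rfl ?_
        rintro f rfl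
        refine Set.mem_singleton_iff.2 (funext fun ω => ?_)
        rw [intBit_shift, if_pos hik]
      · refine (Computes.op hb (hZ (mem_lowBits (i := i - k) (by omega))) and).mono subset_rfl
          le_rfl ?_
        rintro f rfl
        refine Set.mem_singleton_iff.2 (funext fun ω => ?_)
        rw [intBit_shift, if_neg hik]
        cases intBit (Z' ω) k <;> simp
        simp [intBit]
    have h3 := (h1.union h2).bind (Computes.add (Or.inl h0) Q
      (Set.subset_union_left.trans Set.subset_union_right)
      (Set.subset_union_right.trans Set.subset_union_right))
    refine h3.mono subset_rfl (by rw [Nat.succ_mul]; omega) ?_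
    have : (fun ω => Z ω * (Z' ω % 2 ^ (k + 1))) = fun ω => Z ω * (Z' ω % 2 ^ k) +
        2 ^ k * (if intBit (Z' ω) k then Z ω else 0) := by
      funext ω
      rw [emod_two_pow_succ]
      split_ifs <;> ring
    rw [this]

/-- The lowest `p + 1` digits of a small integer represent it in two's complement. -/
theorem twosComplement_eq (z : ℤ) (p : ℕ) (h1 : -2 ^ p ≤ z) (h2 : z < 2 ^ p) :
    (∑ b : Fin p, if intBit z b = true then (2 : ℝ) ^ (b : ℕ) else 0) -
      (if intBit z p = true then (2 : ℝ) ^ p else 0) = z := by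
  have hmod : ∀ q : ℕ, ((z % 2 ^ q : ℤ) : ℝ)
      = ∑ b : Fin q, if intBit z b = true then (2 : ℝ) ^ (b : ℕ) else 0 := by
    intro q
    induction q with
    | zero => simp
    | succ q ih =>
      rw [Fin.sum_univ_castSucc, emod_two_pow_succ]
      simp only [Fin.val_castSucc, Fin.val_last, ← ih]
      split_ifs <;> simp
  rw [← hmod]
  have hp : (0 : ℤ) < 2 ^ p := by positivity
  have key : z % 2 ^ p - (if intBit z p = true then (2 : ℤ) ^ p else 0) = z := by
    have hd := Int.mul_ediv_add_emod z (2 ^ p)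
    rcases le_or_gt 0 z with hz | hz
    · have : z / 2 ^ p = 0 := Int.ediv_eq_zero_of_lt hz h2
      simp [intBit, this, Int.emod_eq_of_lt hz h2]
    · have : z / 2 ^ p = -1 := by
        rw [Int.ediv_eq_iff_of_pos hp]
        constructor <;> linarith
      rw [this] at hd
      simp only [intBit, this]
      norm_num
      linarith
  exact_mod_cast congrArg (Int.cast : ℤ → ℝ) key

/-! #### Majority -/

/-- The carries of a chain of full adders that adds up the bits of a list and the bit `s`. -/
def carries (s : Ω → Bool) : List (Ω → Bool) → List (Ω → Bool)
  | a :: b :: l => (fun ω => maj₃ (a ω) (b ω) (s ω)) ::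
      carries (fun ω => xor₃ (a ω) (b ω) (s ω)) l
  | _ => []

/-- The majority of `2 ^ (h + 1) - 1` bits, computed through carries. -/
def majority : ℕ → List (Ω → Bool) → (Ω → Bool)
  | 0, a :: _ => a
  | h + 1, s :: l => majority h (carries s l)
  | _, [] => fun _ => false

/-- The number of functions of a list that are true at `ω`. -/
def trueCount (l : List (Ω → Bool)) (ω : Ω) : ℕ := l.countP fun f => f ω

theorem carries_length (n : ℕ) (s : Ω → Bool) (l : List (Ω → Bool)) (hl : l.length = 2 * n) :
    (carries s l).length = n := by
  induction n generalizing s l with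
  | zero =>
    obtain rfl := List.length_eq_zero_iff.1 (by simpa using hl)
    rfl
  | succ n ih =>
    match l, hl with
    | a :: b :: l, hl =>
      simp only [List.length_cons] at hl
      simp [carries, ih _ l (by omega)]

/-- A full adder preserves the weighted sum of its bits. So the number of true bits is twice the
number of true carries, up to the last sum bit. -/
theorem carries_count (n : ℕ) (s : Ω → Bool) (l : List (Ω → Bool)) (hl : l.length = 2 * n)
    (ω : Ω) : 2 * trueCount (carries s l) ω ≤ trueCount (s :: l) ω ∧
      trueCount (s :: l) ω ≤ 2 * trueCount (carries s l) ω + 1 := by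
  induction n generalizing s l with
  | zero =>
    obtain rfl := List.length_eq_zero_iff.1 (by simpa using hl)
    simp only [carries, trueCount, List.countP_cons, List.countP_nil]
    split_ifs <;> simp
  | succ n ih =>
    match l, hl with
    | a :: b :: l, hl =>
      simp only [List.length_cons] at hl
      have h := ih (fun ω => xor₃ (a ω) (b ω) (s ω)) l (by omega)
      simp only [QCentroid.carries, trueCount, List.countP_cons] at h ⊢
      rcases Bool.eq_false_or_eq_true (a ω) with ha | ha <;>
      rcases Bool.eq_false_or_eq_true (b ω) with hb | hb <;>
      rcases Bool.eq_false_or_eq_true (s ω) with hs | hs <;>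
        simp [maj₃, xor₃, ha, hb, hs] at h ⊢ <;> omega

/-- Passing to the carries halves the number of true bits, rounding down, and so preserves whether
it reaches the threshold. -/
theorem majority_iff (h : ℕ) (l : List (Ω → Bool)) (hl : l.length + 1 = 2 ^ (h + 1)) (ω : Ω) :
    majority h l ω = true ↔ 2 ^ h ≤ trueCount l ω := by
  induction h generalizing l with
  | zero =>
    obtain ⟨a, rfl⟩ := List.length_eq_one_iff.1 (by simpa using hl)
    simp only [majority, trueCount, List.countP_cons, List.countP_nil]
    cases a ω <;> simp
  | succ h ih =>
    match l, hl with
    | [], hl =>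
      have := Nat.one_lt_two_pow (n := h + 1 + 1) (by omega)
      rw [← hl] at this
      simp at this
    | s :: l, hl =>
      rw [List.length_cons] at hl
      have h2 : l.length = 2 * (2 ^ (h + 1) - 1) := by
        have : 1 ≤ 2 ^ (h + 1) := Nat.one_le_two_pow
        rw [pow_succ 2 (h + 1)] at hl
        omega
      have h3 := carries_length _ s l h2
      have h4 := carries_count _ s l h2 ω
      rw [majority, ih (carries s l) (by
        have : 1 ≤ 2 ^ (h + 1) := Nat.one_le_two_pow
        omega), pow_succ 2 h]
      omega

theorem Computes.carries {B : Set (Ω → Bool)} (n : ℕ) (s : Ω → Bool) (l : List (Ω → Bool))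
    (hl : l.length = 2 * n) (hs : s ∈ B) (hB : ∀ f ∈ l, f ∈ B) :
    Computes B (n * 5) {f | f ∈ carries s l} := by
  induction n generalizing s l B with
  | zero =>
    obtain rfl := List.length_eq_zero_iff.1 (by simpa using hl)
    exact (Computes.of_subset (by simp [QCentroid.carries])).mono subset_rfl (by simp) subset_rfl
  | succ n ih =>
    match l, hl with
    | a :: b :: l, hl =>
      simp only [List.length_cons] at hl
      have h1 := Computes.fullAdder (hB a (by simp)) (hB b (by simp)) hs
      have h2 := ih (B := B ∪ {fun ω => xor₃ (a ω) (b ω) (s ω), fun ω => maj₃ (a ω) (b ω) (s ω)})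
        (fun ω => xor₃ (a ω) (b ω) (s ω)) l (by omega) (by simp)
        (fun f hf => Or.inl (hB f (by simp [hf])))
      have h3 := h1.bind (h2.union (Computes.of_subset
        (F := {fun ω => maj₃ (a ω) (b ω) (s ω)}) (by simp)))
      refine h3.mono subset_rfl (by omega) ?_
      intro f hf
      simp only [QCentroid.carries, List.mem_cons, Set.mem_ofPred_eq] at hf
      rcases hf with rfl | hf
      · exact Or.inr rfl
      · exact Or.inl hf

theorem Computes.majority {B : Set (Ω → Bool)} (h : ℕ) (l : List (Ω → Bool))
    (hl : l.length + 1 = 2 ^ (h + 1)) (hB : ∀ f ∈ l, f ∈ B) :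
    Computes B (2 ^ (h + 1) * 5) {majority h l} := by
  induction h generalizing l B with
  | zero =>
    obtain ⟨a, rfl⟩ := List.length_eq_one_iff.1 (by simpa using hl)
    exact (Computes.of_subset (by simpa [QCentroid.majority] using hB)).mono subset_rfl
      (by simp) subset_rfl
  | succ h ih =>
    match l, hl with
    | [], hl =>
      have := Nat.one_lt_two_pow (n := h + 1 + 1) (by omega)
      rw [← hl] at this
      simp at this
    | s :: l, hl =>
      rw [List.length_cons] at hl
      have h1 : 1 ≤ 2 ^ (h + 1) := Nat.one_le_two_pow
      have h2 : l.length = 2 * (2 ^ (h + 1) - 1) := by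
        rw [pow_succ 2 (h + 1)] at hl
        omega
      have h3 := carries_length _ s l h2
      have h4 := Computes.carries _ s l h2 (hB s (by simp)) (fun f hf => hB f (by simp [hf]))
      have h5 := h4.bind (ih (B := B ∪ {f | f ∈ QCentroid.carries s l}) (QCentroid.carries s l)
        (by omega) (fun f hf => Or.inr hf))
      refine h5.mono subset_rfl ?_ subset_rfl
      rw [pow_succ 2 (h + 1)]
      omega

/-! #### Programs as classical circuits -/

theorem Program.copy {B : Set (Ω → Bool)} {l : List (Ω → Bool)} (h : Program B l)
    (g : ℕ → Ω → Bool) (Q : ℕ) (hg : ∀ i < Q, g i ∈ B ∨ g i ∈ l) :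
    Program B (((List.range Q).map g).reverse ++ l) := by
  induction Q with
  | zero => simpa using h
  | succ Q ih =>
    have h1 : g Q ∈ B ∨ g Q ∈ ((List.range Q).map g).reverse ++ l :=
      (hg Q (by omega)).imp id (List.mem_append_right _)
    have h2 := Program.cons (fun p _ => p) h1 h1 (ih fun i hi => hg i (by omega))
    simpa [List.range_succ] using h2

/-- A program over the coordinates of `ι → Bool` can be carried out by classical instructions that
write its functions into fresh bits. -/
theorem Program.exists_flips {ι : Type} [DecidableEq ι] {l : List ((ι → Bool) → Bool)}
    (h : Program (Set.range fun (i : ι) (ω : ι → Bool) => ω i) l) (n : ℕ) (hn : l.length ≤ n) :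
    ∃ ops : List (Flip (ι ⊕ Fin n)), ops.length = l.length ∧ ∀ ω : ι → Bool,
      (∀ i, flipForward ops (Sum.elim ω fun _ => false) (Sum.inl i) = ω i) ∧
      (∀ r : Fin n, l.length ≤ r →
        flipForward ops (Sum.elim ω fun _ => false) (Sum.inr r) = false) ∧
      (∀ (r : Fin n) (f : (ι → Bool) → Bool), l.reverse[(r : ℕ)]? = some f →
        flipForward ops (Sum.elim ω fun _ => false) (Sum.inr r) = f ω) := by
  induction h with
  | nil => exact ⟨[], rfl, fun ω => ⟨fun i => rfl, fun r _ => rfl, fun r f hf => by simp at hf⟩⟩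
  | @cons l u v op hu hv hl ih =>
    rw [List.length_cons] at hn
    obtain ⟨ops, hlen, hops⟩ := ih (by omega)
    have key : ∀ u : (ι → Bool) → Bool,
        (u ∈ (Set.range fun (i : ι) (ω : ι → Bool) => ω i) ∨ u ∈ l) →
        ∃ a : ι ⊕ Fin n, a ≠ Sum.inr ⟨l.length, hn⟩ ∧
          ∀ ω, flipForward ops (Sum.elim ω fun _ => false) a = u ω := by
      rintro u (⟨i, rfl⟩ | hu)
      · exact ⟨Sum.inl i, by simp, fun ω => (hops ω).1 i⟩
      · obtain ⟨k, hk, hk'⟩ := List.getElem_of_mem (List.mem_reverse.2 hu)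
        rw [List.length_reverse] at hk
        refine ⟨Sum.inr ⟨k, by omega⟩, by simp; omega, fun ω => (hops ω).2.2 _ u ?_⟩
        rw [List.getElem?_eq_getElem (by simpa using hk)]
        simpa using hk'
    obtain ⟨a, ha, ha'⟩ := key u hu
    obtain ⟨b, hb, hb'⟩ := key v hv
    refine ⟨ops ++ [⟨Sum.inr ⟨l.length, hn⟩, a, b, ha, hb, op⟩], by simp [hlen], fun ω => ?_⟩
    obtain ⟨i1, i2, i3⟩ := hops ω
    have hstep : flipForward (ops ++ [⟨Sum.inr ⟨l.length, hn⟩, a, b, ha, hb, op⟩])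
        (Sum.elim ω fun _ => false) = Function.update (flipForward ops
          (Sum.elim ω fun _ => false)) (Sum.inr ⟨l.length, hn⟩) (op (u ω) (v ω)) := by
      rw [← ha', ← hb']
      have h5 := i2 ⟨l.length, hn⟩ le_rfl
      simp only [flipForward, List.foldl_append, List.foldl_cons, List.foldl_nil] at h5 ⊢
      simp only [Flip.step] at h5 ⊢
      rw [h5, Bool.false_xor]
    rw [hstep]
    refine ⟨fun i => ?_, fun r hr => ?_, fun r f hf => ?_⟩
    · rw [Function.update_of_ne (by simp), i1]
    · rw [List.length_cons] at hr
      rw [Function.update_of_ne, i2 r (by omega)]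
      intro h'
      have := congrArg Fin.val (Sum.inr_injective h')
      simp at this
      omega
    · rw [List.reverse_cons] at hf
      by_cases hr : (r : ℕ) < l.length
      · rw [List.getElem?_append_left (by simpa using hr)] at hf
        rw [Function.update_of_ne, i3 r f hf]
        intro h'
        have := congrArg Fin.val (Sum.inr_injective h')
        simp at this
        omega
      · rw [List.getElem?_append_right (by simpa using hr), List.length_reverse] at hf
        have h6 : (r : ℕ) - l.length = 0 := by
          by_contra h7
          rw [List.getElem?_eq_none (by simp; omega)] at hf
          simp at hf
        rw [h6] at hf
        have h8 : r = ⟨l.length, hn⟩ := Fin.ext (by simp; omega)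
        rw [h8, Function.update_self]
        simp at hf
        rw [← hf]

end Programs

/-! ### Decoding the phase -/

section Decode

/-- The binary digits of a phase, least significant first, from the signs `C u` and `S u` (`true`
for negative) of the cosine and the sine of its multiples by powers of `2`. The second component
is the digit found one step earlier. -/
def decode (C S : ℕ → Bool) : ℕ → Bool × Bool
  | 0 => (false, false)
  | u + 1 => (if xor (decode C S u).1 (decode C S u).2 then S u else xor (C u) (decode C S u).1,
      (decode C S u).1)

/-- The angle whose binary expansion, as a fraction of `2π`, consists of the digits decoded so
far. -/
def decodedAngle (C S : ℕ → Bool) : ℕ → ℝ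
  | 0 => 0
  | u + 1 => decodedAngle C S u / 2 + if (decode C S (u + 1)).1 then Real.pi else 0

theorem decodedAngle_nonneg (C S : ℕ → Bool) (u : ℕ) : 0 ≤ decodedAngle C S u := by
  induction u with
  | zero => simp [decodedAngle]
  | succ u ih =>
    have := Real.pi_pos
    rw [decodedAngle]
    split_ifs <;> linarith

theorem decodedAngle_le (C S : ℕ → Bool) (u : ℕ) : decodedAngle C S u ≤ 2 * Real.pi := by
  induction u with
  | zero => simp [decodedAngle, Real.pi_pos.le]
  | succ u ih =>
    have := Real.pi_pos
    rw [decodedAngle]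
    split_ifs <;> linarith

theorem decodedAngle_eq (C S : ℕ → Bool) (u : ℕ) :
    decodedAngle C S u
      = 2 * Real.pi * bitsValue (fun i => (decode C S (i + 1)).1) u / 2 ^ u := by
  induction u with
  | zero => simp [decodedAngle, bitsValue]
  | succ u ih =>
    rw [decodedAngle, ih, bitsValue_succ]
    split_ifs
    · push_cast
      rw [pow_succ]
      field_simp
    · push_cast
      rw [pow_succ]
      field_simp
      ring

theorem exists_abs_sub_le_of_cos (y : ℝ) (h : -Real.sin (Real.pi / 10) ≤ Real.cos y) :
    ∃ k : ℤ, |y - 2 * Real.pi * k| ≤ 3 * Real.pi / 5 := by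
  have hpi := Real.pi_pos
  refine ⟨round (y / (2 * Real.pi)), ?_⟩
  set k := round (y / (2 * Real.pi))
  have h1 : |y - 2 * Real.pi * k| ≤ Real.pi := by
    have h2 := abs_sub_round (y / (2 * Real.pi))
    have h3 : y - 2 * Real.pi * k = 2 * Real.pi * (y / (2 * Real.pi) - k) := by
      field_simp
    rw [h3, abs_mul, abs_of_pos (by positivity)]
    nlinarith
  by_contra hlt
  rw [not_le] at hlt
  have h2 : Real.cos |y - 2 * Real.pi * k| < Real.cos (3 * Real.pi / 5) :=
    Real.cos_lt_cos_of_nonneg_of_le_pi (by positivity) h1 hlt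
  have h3 : Real.cos (y - 2 * Real.pi * k) = Real.cos y := by
    rw [mul_comm]
    exact Real.cos_sub_int_mul_two_pi y k
  have h4 : Real.cos (3 * Real.pi / 5) = -Real.sin (Real.pi / 10) := by
    rw [← Real.cos_add_pi_div_two]
    congr 1
    ring
  rw [Real.cos_abs, h3, h4] at h2
  linarith

/-- If half of the decoded angle is known up to a multiple `k π` and rounded to `ρ`, then the sign
of `cos (x - ρ)` reveals the parity of `k`. -/
theorem sin_le_cos_of_close (x ρ half E D : ℝ) (k : ℤ) (h1 : |x - half - Real.pi * k| ≤ E)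
    (h2 : |ρ - half| ≤ D) (h3 : E + D ≤ 2 * Real.pi / 5) :
    Real.sin (Real.pi / 10) ≤ (-1) ^ k * Real.cos (x - ρ) := by
  have hpi := Real.pi_pos
  have h4 : |x - ρ - k * Real.pi| ≤ 2 * Real.pi / 5 := by
    have : x - ρ - k * Real.pi = (x - half - Real.pi * k) - (ρ - half) := by ring
    rw [this]
    exact (abs_sub _ _).trans (by linarith)
  have h5 : Real.cos (2 * Real.pi / 5) ≤ Real.cos |x - ρ - k * Real.pi| :=
    Real.cos_le_cos_of_nonneg_of_le_pi (abs_nonneg _) (by linarith) h4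
  have h6 : Real.cos (2 * Real.pi / 5) = Real.sin (Real.pi / 10) := by
    rw [← Real.cos_pi_div_two_sub]
    congr 1
    ring
  rw [Real.cos_abs, Real.cos_sub_int_mul_pi, h6] at h5
  exact h5

/-- A sign bit is correct whenever the number is not close to `0`. -/
def SignBit (b : Bool) (t : ℝ) : Prop :=
  (Real.sin (Real.pi / 10) ≤ t → b = false) ∧ (t ≤ -Real.sin (Real.pi / 10) → b = true)

theorem sin_pi_div_ten_pos : 0 < Real.sin (Real.pi / 10) :=
  Real.sin_pos_of_pos_of_lt_pi (by positivity) (by linarith [Real.pi_pos])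

theorem SignBit.not {b : Bool} {t : ℝ} (h : SignBit b t) : SignBit (!b) (-t) :=
  ⟨fun h1 => by rw [h.2 (by linarith)]; rfl, fun h1 => by rw [h.1 (by linarith)]; rfl⟩

theorem exists_of_signBit (b : Bool) (x ρ half E D : ℝ) (k : ℤ)
    (h1 : |x - half - Real.pi * k| ≤ E) (h2 : |ρ - half| ≤ D) (h3 : E + D ≤ 2 * Real.pi / 5)
    (hb : SignBit b (Real.cos (x - ρ))) :
    ∃ k' : ℤ, |x - (half + if b then Real.pi else 0) - 2 * Real.pi * k'| ≤ E := by
  have h := sin_le_cos_of_close x ρ half E D k h1 h2 h3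
  rcases Int.even_or_odd' k with ⟨k', rfl | rfl⟩
  · rw [(even_two_mul k').neg_one_zpow, one_mul] at h
    rw [hb.1 h]
    refine ⟨k', le_of_eq_of_le ?_ h1⟩
    congr 1
    push_cast
    ring
  · rw [Odd.neg_one_zpow ⟨k', rfl⟩] at h
    rw [hb.2 (by linarith)]
    refine ⟨k', le_of_eq_of_le ?_ h1⟩
    congr 1
    push_cast
    rw [if_pos rfl]
    ring

/-- Robustness of the decoding: sign bits that are only correct away from `0` suffice. The next
digit is read off the sign of `cos (θ - ρ)`, where `ρ ∈ {0, π/2, π}` is half of the angle decoded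
so far, rounded; there this cosine is never close to `0`. -/
theorem decodedAngle_close (C S : ℕ → Bool) (θ : ℕ → ℝ) (M : ℕ)
    (hθ : ∀ u < M, θ u = 2 * θ (u + 1))
    (hC : ∀ u < M, SignBit (C u) (Real.cos (θ (u + 1))))
    (hS : ∀ u < M, SignBit (S u) (Real.sin (θ (u + 1)))) (u : ℕ) (hu : u < M) :
    ∃ k : ℤ, |θ (u + 1) - decodedAngle C S (u + 1) - 2 * Real.pi * k|
      ≤ 3 * Real.pi / 5 / 2 ^ u := by
  have hpi := Real.pi_pos
  have hsin := sin_pi_div_ten_pos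
  induction u with
  | zero =>
    -- before any digit is known, the sign of the cosine decides between the angles `0` and `π`
    have hb := hC 0 hu
    have hd : decodedAngle C S 1 = if C 0 then Real.pi else 0 := by
      simp [decodedAngle, decode]
    rw [pow_zero, div_one, hd]
    apply exists_abs_sub_le_of_cos
    cases h : C 0
    · rw [h] at hb
      by_contra hlt
      exact Bool.noConfusion (hb.2 (by simp at hlt; linarith))
    · rw [h] at hb
      simp only [if_true, Real.cos_sub_pi]
      by_contra hlt
      exact Bool.noConfusion (hb.1 (by linarith))
  | succ u ih =>
    obtain ⟨k, hk⟩ := ih (by omega)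
    rw [hθ (u + 1) hu] at hk
    have hk' : |θ (u + 2) - decodedAngle C S (u + 1) / 2 - Real.pi * k|
        ≤ 3 * Real.pi / 5 / 2 ^ (u + 1) := by
      have : 2 * θ (u + 1 + 1) - decodedAngle C S (u + 1) - 2 * Real.pi * k
          = 2 * (θ (u + 2) - decodedAngle C S (u + 1) / 2 - Real.pi * k) := by ring
      rw [this, abs_mul, abs_two] at hk
      rw [pow_succ, ← div_div]
      linarith
    have hstep : decodedAngle C S (u + 2) = decodedAngle C S (u + 1) / 2 +
        if (decode C S (u + 2)).1 then Real.pi else 0 := rfl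
    rw [hstep]
    have hrec : (decode C S (u + 2)).1 = if xor (decode C S (u + 1)).1 (decode C S u).1
      then S (u + 1) else xor (C (u + 1)) (decode C S (u + 1)).1 := rfl
    have hang : decodedAngle C S (u + 1) = decodedAngle C S u / 2 +
        if (decode C S (u + 1)).1 then Real.pi else 0 := rfl
    -- half of the decoded angle is within `π / 4` of `ρ`: if the two highest digits differ, it lies
    -- in the middle of the upper half plane, and `ρ = π / 2`
    have hD : ∀ ρ : ℝ, ρ = (if xor (decode C S (u + 1)).1 (decode C S u).1 then Real.pi / 2 else
        if (decode C S (u + 1)).1 then Real.pi else 0) →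
        3 * Real.pi / 5 / 2 ^ (u + 1) + |ρ - decodedAngle C S (u + 1) / 2| ≤ 2 * Real.pi / 5 := by
      rintro ρ rfl
      rcases u with _ | u
      · rw [hang]
        cases (decode C S (0 + 1)).1 <;> simp [decode, decodedAngle] <;> linarith
      · have h4 : 3 * Real.pi / 5 / 2 ^ (u + 1 + 1) ≤ 3 * Real.pi / 20 := by
          rw [div_le_iff₀ (by positivity)]
          have : (1 : ℝ) ≤ 2 ^ u := one_le_pow₀ (by norm_num)
          rw [pow_succ, pow_succ]
          nlinarith
        have h5 : decodedAngle C S (u + 1) = decodedAngle C S u / 2 +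
          if (decode C S (u + 1)).1 then Real.pi else 0 := rfl
        have h6 := decodedAngle_nonneg C S u
        have h7 := decodedAngle_le C S u
        have h8 : |(if xor (decode C S (u + 1 + 1)).1 (decode C S (u + 1)).1 then Real.pi / 2 else
            if (decode C S (u + 1 + 1)).1 then Real.pi else 0) -
            decodedAngle C S (u + 1 + 1) / 2| ≤ Real.pi / 4 := by
          rw [hang, h5, abs_le]
          cases (decode C S (u + 1 + 1)).1 <;> cases (decode C S (u + 1)).1 <;>
            simp <;> constructor <;> linarith
        linarith
    have hbit : SignBit (decode C S (u + 2)).1 (Real.cos (θ (u + 2) -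
        (if xor (decode C S (u + 1)).1 (decode C S u).1 then Real.pi / 2 else
        if (decode C S (u + 1)).1 then Real.pi else 0))) := by
      rw [hrec]
      have hC' := hC (u + 1) hu
      have hS' := hS (u + 1) hu
      cases (decode C S (u + 1)).1 <;> cases (decode C S u).1
      · simpa using hC'
      · simpa [Real.cos_sub_pi_div_two] using hS'
      · simpa [Real.cos_sub_pi_div_two] using hS'
      · simpa [Real.cos_sub_pi] using hC'.not
    exact exists_of_signBit _ _ _ _ _ _ k hk' le_rfl (hD _ rfl) hbit

theorem cos_decodedAngle_close (C S : ℕ → Bool) (θ : ℕ → ℝ) (M : ℕ) (hM : 0 < M)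
    (hθ : ∀ u < M, θ u = 2 * θ (u + 1))
    (hC : ∀ u < M, SignBit (C u) (Real.cos (θ (u + 1))))
    (hS : ∀ u < M, SignBit (S u) (Real.sin (θ (u + 1)))) :
    |Real.cos (decodedAngle C S M) - Real.cos (θ M)| ≤ 4 / 2 ^ M := by
  obtain ⟨u, rfl⟩ := Nat.exists_eq_succ_of_ne_zero hM.ne'
  obtain ⟨k, hk⟩ := decodedAngle_close C S θ (u + 1) hθ hC hS u (by omega)
  have h1 : Real.cos (decodedAngle C S (u + 1))
      = Real.cos (decodedAngle C S (u + 1) + k * (2 * Real.pi)) :=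
    (Real.cos_add_int_mul_two_pi _ _).symm
  rw [Nat.succ_eq_add_one, h1]
  refine (Real.abs_cos_sub_cos_le _ _).trans ?_
  rw [abs_sub_comm]
  have h2 : θ (u + 1) - (decodedAngle C S (u + 1) + k * (2 * Real.pi))
      = θ (u + 1) - decodedAngle C S (u + 1) - 2 * Real.pi * k := by ring
  rw [h2]
  refine hk.trans ?_
  rw [pow_succ, div_le_div_iff₀ (by positivity) (by positivity)]
  have := Real.pi_lt_d2
  have h3 : (0 : ℝ) < 2 ^ u := by positivity
  nlinarith

end Decode

/-! ### From digits to the estimate -/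

section Estimate

theorem floor_mul_floor_close (P : ℕ) (hP : 0 < P) (a b : ℝ) (ha : |a| ≤ 1) (hb : |b| ≤ 1) :
    |(⌊P * a⌋ * ⌊P * b⌋ : ℝ) / P ^ 2 - a * b| ≤ 2 / P := by
  have hP' : (0 : ℝ) < P := by exact_mod_cast hP
  have h1 := Int.floor_le (P * a)
  have h2 := Int.lt_floor_add_one (P * a)
  have h3 := Int.floor_le (P * b)
  have h4 := Int.lt_floor_add_one (P * b)
  rw [abs_le] at ha hb
  have h5 : (-(P : ℝ)) ≤ ⌊P * a⌋ := by
    have : (-(P : ℤ)) ≤ ⌊P * a⌋ := by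
      rw [Int.le_floor]
      push_cast
      nlinarith
    exact_mod_cast this
  have h6 : (⌊P * a⌋ : ℝ) ≤ P := h1.trans (by nlinarith)
  generalize (⌊P * a⌋ : ℝ) = A at *
  generalize (⌊P * b⌋ : ℝ) = B at *
  have h7 : A * B / P ^ 2 - a * b = (A * (B - P * b) + P * b * (A - P * a)) / P ^ 2 := by
    field_simp
    ring
  have h8 : |A * (B - P * b) + P * b * (A - P * a)| ≤ 2 * P := by
    refine (abs_add_le _ _).trans ?_
    have i1 : |A * (B - P * b)| ≤ P * 1 := by
      rw [abs_mul]
      exact mul_le_mul (abs_le.2 ⟨h5, h6⟩) (abs_le.2 ⟨by linarith, by linarith⟩) (abs_nonneg _)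
        hP'.le
    have i2 : |P * b * (A - P * a)| ≤ P * 1 := by
      rw [abs_mul]
      refine mul_le_mul (abs_le.2 ⟨by nlinarith, by nlinarith⟩)
        (abs_le.2 ⟨by linarith, by linarith⟩) (abs_nonneg _) hP'.le
    linarith
  rw [h7, abs_div, abs_of_pos (by positivity : (0 : ℝ) < P ^ 2), div_le_div_iff₀ (by positivity)
    hP']
  nlinarith

/-- The cosine of the angle `2π h / 2 ^ q`, as a fixed-point number with `M` binary places. -/
def fixedCos (M q h : ℕ) : ℤ := ⌊((2 ^ M : ℕ) : ℝ) * Real.cos (2 * Real.pi * h / 2 ^ q)⌋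

/-- The sine of the angle `2π h / 2 ^ q`, as a fixed-point number with `M` binary places. -/
def fixedSin (M q h : ℕ) : ℤ := ⌊((2 ^ M : ℕ) : ℝ) * Real.sin (2 * Real.pi * h / 2 ^ q)⌋

/-- The cosine of the angle with `2 n` binary digits, with upper half `hi` and lower half `lo`, by
the addition formula. -/
def angleCos (n hi lo : ℕ) : ℤ :=
  fixedCos (2 * n) n hi * fixedCos (2 * n) (2 * n) lo -
    fixedSin (2 * n) n hi * fixedSin (2 * n) (2 * n) lo

theorem angleCos_close (n hi lo : ℕ) :
    |(angleCos n hi lo : ℝ) / (2 ^ (2 * n)) ^ 2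
      - Real.cos (2 * Real.pi * (lo + 2 ^ n * hi : ℕ) / 2 ^ (2 * n))| ≤ 4 / 2 ^ (2 * n) := by
  have h1 := floor_mul_floor_close (2 ^ (2 * n)) (by positivity)
    (Real.cos (2 * Real.pi * hi / 2 ^ n)) (Real.cos (2 * Real.pi * lo / 2 ^ (2 * n)))
    (Real.abs_cos_le_one _) (Real.abs_cos_le_one _)
  have h2 := floor_mul_floor_close (2 ^ (2 * n)) (by positivity)
    (Real.sin (2 * Real.pi * hi / 2 ^ n)) (Real.sin (2 * Real.pi * lo / 2 ^ (2 * n)))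
    (Real.abs_sin_le_one _) (Real.abs_sin_le_one _)
  have h3 : 2 * Real.pi * (lo + 2 ^ n * hi : ℕ) / 2 ^ (2 * n)
      = 2 * Real.pi * hi / 2 ^ n + 2 * Real.pi * lo / 2 ^ (2 * n) := by
    push_cast
    rw [two_mul n, pow_add]
    field_simp
    ring
  have hP : ((2 ^ (2 * n) : ℕ) : ℝ) = 2 ^ (2 * n) := by push_cast; rfl
  rw [hP] at h1 h2
  rw [h3, Real.cos_add, angleCos, fixedCos, fixedCos, fixedSin, fixedSin, hP]
  push_cast
  rw [sub_div]
  rw [abs_le] at h1 h2 ⊢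
  have h4 : (4 : ℝ) / 2 ^ (2 * n) = 2 / 2 ^ (2 * n) + 2 / 2 ^ (2 * n) := by ring
  constructor <;> linarith

theorem fixedCos_abs_le (M q h : ℕ) : |fixedCos M q h| ≤ 2 ^ M := by
  have h1 := Real.neg_one_le_cos (2 * Real.pi * h / 2 ^ q)
  have h2 := Real.cos_le_one (2 * Real.pi * h / 2 ^ q)
  have hP : (0 : ℝ) < 2 ^ M := by positivity
  rw [abs_le, fixedCos]
  constructor
  · rw [Int.le_floor]
    push_cast
    nlinarith
  · rw [← Int.cast_le (R := ℝ)]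
    refine (Int.floor_le _).trans ?_
    push_cast
    nlinarith

theorem fixedSin_abs_le (M q h : ℕ) : |fixedSin M q h| ≤ 2 ^ M := by
  have h1 := Real.neg_one_le_sin (2 * Real.pi * h / 2 ^ q)
  have h2 := Real.sin_le_one (2 * Real.pi * h / 2 ^ q)
  have hP : (0 : ℝ) < 2 ^ M := by positivity
  rw [abs_le, fixedSin]
  constructor
  · rw [Int.le_floor]
    push_cast
    nlinarith
  · rw [← Int.cast_le (R := ℝ)]
    refine (Int.floor_le _).trans ?_
    push_cast
    nlinarith

theorem lowAngle_le (n lo : ℕ) (hn : 2 ≤ n) (hlo : lo < 2 ^ n) :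
    0 ≤ 2 * Real.pi * lo / 2 ^ (2 * n) ∧ 2 * Real.pi * lo / 2 ^ (2 * n) ≤ Real.pi / 2 := by
  have hpi := Real.pi_pos
  refine ⟨by positivity, ?_⟩
  rw [div_le_iff₀ (by positivity), two_mul n, pow_add]
  have h1 : (lo : ℝ) ≤ 2 ^ n := by exact_mod_cast hlo.le
  have h2 : (4 : ℝ) ≤ 2 ^ n := by
    calc (4 : ℝ) = 2 ^ 2 := by norm_num
      _ ≤ 2 ^ n := pow_le_pow_right₀ (by norm_num) hn
  have h3 : Real.pi * lo ≤ Real.pi * 2 ^ n := by gcongr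
  nlinarith [mul_pos hpi (by positivity : (0 : ℝ) < 2 ^ n)]

/-- The angle of the lower half of the digits is acute, so that its cosine and sine can be used as
multipliers. -/
theorem fixedCos_low_nonneg (n lo : ℕ) (hn : 2 ≤ n) (hlo : lo < 2 ^ n) :
    0 ≤ fixedCos (2 * n) (2 * n) lo := by
  obtain ⟨h1, h2⟩ := lowAngle_le n lo hn hlo
  have := Real.pi_pos
  exact Int.floor_nonneg.2 (mul_nonneg (by positivity)
    (Real.cos_nonneg_of_neg_pi_div_two_le_of_le (by linarith) h2))

theorem fixedSin_low_nonneg (n lo : ℕ) (hn : 2 ≤ n) (hlo : lo < 2 ^ n) :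
    0 ≤ fixedSin (2 * n) (2 * n) lo := by
  obtain ⟨h1, h2⟩ := lowAngle_le n lo hn hlo
  have := Real.pi_pos
  exact Int.floor_nonneg.2 (mul_nonneg (by positivity)
    (Real.sin_nonneg_of_nonneg_of_le_pi h1 (by linarith)))

/-- The error of the estimate: `R` and `R'` are the norms `r` and `r'` with `M` digits, and `X` is
the cosine with `2 M` digits. -/
theorem product_close (M : ℕ) (e : ℤ) (η r r' s X : ℝ) (hη : 0 ≤ η) (hr0 : 0 ≤ r)
    (hr : r ≤ Real.sqrt η) (hr0' : 0 ≤ r') (hr' : r' ≤ Real.sqrt η)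
    (he : (2 : ℝ) ^ e ≤ 2 * Real.sqrt η) (hs : |s| ≤ 1) (hX : |X / (2 ^ M) ^ 2 - s| ≤ 8 / 2 ^ M) :
    |(2 : ℝ) ^ (-(2 * (M - e) + 2 * M : ℤ)) *
      (X * ⌊r * 2 ^ ((M : ℤ) - e)⌋ * ⌊r' * 2 ^ ((M : ℤ) - e)⌋) - r * r' * s|
      ≤ 12 * η / 2 ^ M := by
  set S : ℝ := (2 : ℝ) ^ ((M : ℤ) - e) with hS
  have hS0 : 0 < S := by positivity
  have hpow : (2 : ℝ) ^ (-(2 * (M - e) + 2 * M : ℤ)) = 1 / (S ^ 2 * (2 ^ M) ^ 2) := by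
    have h1 : S ^ 2 = (2 : ℝ) ^ (2 * (M - e) : ℤ) := by
      rw [hS, ← zpow_natCast, ← zpow_mul]
      congr 1
      push_cast
      ring
    have h2 : ((2 : ℝ) ^ M) ^ 2 = (2 : ℝ) ^ (2 * M : ℤ) := by
      rw [← pow_mul, ← zpow_natCast]
      congr 1
      push_cast
      ring
    rw [h1, h2, ← zpow_add₀ (by norm_num), zpow_neg, one_div]
  have hSe : S * 2 ^ e = 2 ^ M := by
    rw [hS, ← zpow_add₀ (by norm_num), sub_add_cancel, zpow_natCast]
  have i1 := Int.floor_le (r * S)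
  have i2 := Int.lt_floor_add_one (r * S)
  have i3 := Int.floor_le (r' * S)
  have i4 := Int.lt_floor_add_one (r' * S)
  have i5 : (0 : ℝ) ≤ ⌊r * S⌋ := by exact_mod_cast Int.floor_nonneg.2 (by positivity)
  have i6 : (0 : ℝ) ≤ ⌊r' * S⌋ := by exact_mod_cast Int.floor_nonneg.2 (by positivity)
  generalize (⌊r * S⌋ : ℝ) = R at *
  generalize (⌊r' * S⌋ : ℝ) = R' at *
  set X' := X / (2 ^ M) ^ 2 with hX'
  have h1 : 1 / (S ^ 2 * (2 ^ M) ^ 2) * (X * R * R') = (R / S) * (R' / S) * X' := by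
    rw [hX']
    field_simp
  have j1 : R / S ≤ r := by rw [div_le_iff₀ hS0]; exact i1
  have j2 : R' / S ≤ r' := by rw [div_le_iff₀ hS0]; exact i3
  have j3 : r - 1 / S ≤ R / S := by
    rw [le_div_iff₀ hS0, sub_mul, one_div_mul_cancel hS0.ne']; linarith
  have j4 : r' - 1 / S ≤ R' / S := by
    rw [le_div_iff₀ hS0, sub_mul, one_div_mul_cancel hS0.ne']; linarith
  have j5 : 0 ≤ R / S := by positivity
  have j6 : 0 ≤ R' / S := by positivity
  have hsq : Real.sqrt η * Real.sqrt η = η := Real.mul_self_sqrt hη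
  have j7 : 1 / S ≤ 2 * Real.sqrt η / 2 ^ M := by
    rw [div_le_div_iff₀ hS0 (by positivity), ← hSe]
    nlinarith
  rw [hpow, h1]
  set p := R / S
  set p' := R' / S
  have k1 : |r * r' - p * p'| ≤ 4 * η / 2 ^ M := by
    have k2 : |r * r' - p * p'| ≤ Real.sqrt η * (1 / S) + Real.sqrt η * (1 / S) := by
      rw [abs_of_nonneg (by nlinarith)]
      have : r * r' - p * p' = r * (r' - p') + p' * (r - p) := by ring
      rw [this]
      exact add_le_add (mul_le_mul hr (by linarith) (by linarith) (Real.sqrt_nonneg _))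
        (mul_le_mul (j2.trans hr') (by linarith) (by linarith) (Real.sqrt_nonneg _))
    refine k2.trans ?_
    calc Real.sqrt η * (1 / S) + Real.sqrt η * (1 / S)
        ≤ Real.sqrt η * (2 * Real.sqrt η / 2 ^ M) + Real.sqrt η * (2 * Real.sqrt η / 2 ^ M) := by
          gcongr
      _ = 4 * (Real.sqrt η * Real.sqrt η) / 2 ^ M := by ring
      _ = 4 * η / 2 ^ M := by rw [hsq]
  have k3 : p * p' ≤ η := by
    rw [← hsq]
    exact mul_le_mul (j1.trans hr) (j2.trans hr') j6 (Real.sqrt_nonneg _)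
  have k4 : p * p' * X' - r * r' * s = p * p' * (X' - s) - (r * r' - p * p') * s := by ring
  rw [k4]
  refine (abs_sub _ _).trans ?_
  rw [abs_mul (p * p'), abs_mul _ s, abs_of_nonneg (mul_nonneg j5 j6)]
  have k5 : p * p' * |X' - s| ≤ η * (8 / 2 ^ M) :=
    mul_le_mul k3 hX (abs_nonneg _) hη
  have k6 : |r * r' - p * p'| * |s| ≤ 4 * η / 2 ^ M * 1 :=
    mul_le_mul k1 hs (abs_nonneg _) (by positivity)
  calc p * p' * |X' - s| + |r * r' - p * p'| * |s| ≤ η * (8 / 2 ^ M) + 4 * η / 2 ^ M * 1 := by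
        linarith
    _ = 12 * η / 2 ^ M := by ring

/-- The number that the classical part of the algorithm computes from the sign bits and the
truncated norms. -/
def estimate (n : ℕ) (C S : ℕ → Bool) (R R' : ℤ) : ℤ :=
  angleCos n (bitsValue (fun i => (decode C S (n + i + 1)).1) n)
    (bitsValue (fun i => (decode C S (i + 1)).1) n) * R * R'

theorem estimate_cos_close (n : ℕ) (C S : ℕ → Bool) :
    |(angleCos n (bitsValue (fun i => (decode C S (n + i + 1)).1) n)
      (bitsValue (fun i => (decode C S (i + 1)).1) n) : ℝ) / (2 ^ (2 * n)) ^ 2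
      - Real.cos (decodedAngle C S (2 * n))| ≤ 4 / 2 ^ (2 * n) := by
  have h := angleCos_close n (bitsValue (fun i => (decode C S (n + i + 1)).1) n)
    (bitsValue (fun i => (decode C S (i + 1)).1) n)
  rw [← bitsValue_add (fun i => (decode C S (i + 1)).1) n n, ← two_mul] at h
  rw [decodedAngle_eq]
  exact h

theorem estimate_abs_le (n : ℕ) (C S : ℕ → Bool) (R R' : ℤ) (hR0 : 0 ≤ R) (hR : R < 2 ^ (2 * n))
    (hR0' : 0 ≤ R') (hR' : R' < 2 ^ (2 * n)) :
    |estimate n C S R R'| ≤ 2 ^ (8 * n + 1) := by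
  unfold estimate angleCos
  generalize bitsValue (fun i => (decode C S (n + i + 1)).1) n = hi
  generalize bitsValue (fun i => (decode C S (i + 1)).1) n = lo
  have h1 := fixedCos_abs_le (2 * n) n hi
  have h2 := fixedCos_abs_le (2 * n) (2 * n) lo
  have h3 := fixedSin_abs_le (2 * n) n hi
  have h4 := fixedSin_abs_le (2 * n) (2 * n) lo
  have hP : (0 : ℤ) ≤ 2 ^ (2 * n) := by positivity
  have h5 : |fixedCos (2 * n) n hi * fixedCos (2 * n) (2 * n) lo -
      fixedSin (2 * n) n hi * fixedSin (2 * n) (2 * n) lo|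
      ≤ 2 ^ (2 * n) * 2 ^ (2 * n) + 2 ^ (2 * n) * 2 ^ (2 * n) := by
    refine (abs_sub _ _).trans ?_
    rw [abs_mul, abs_mul]
    exact add_le_add (mul_le_mul h1 h2 (abs_nonneg _) hP) (mul_le_mul h3 h4 (abs_nonneg _) hP)
  rw [abs_mul, abs_mul, abs_of_nonneg hR0, abs_of_nonneg hR0']
  calc _ ≤ (2 ^ (2 * n) * 2 ^ (2 * n) + 2 ^ (2 * n) * 2 ^ (2 * n)) * 2 ^ (2 * n) * 2 ^ (2 * n) := by
        gcongr
    _ = (2 : ℤ) ^ (8 * n + 1) := by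
      rw [pow_succ, show 8 * n = 2 * n + 2 * n + 2 * n + 2 * n by ring, pow_add, pow_add, pow_add]
      ring

variable {Ω : Type}

theorem Computes.decode {B : Set (Ω → Bool)} (h0 : (fun _ => false) ∈ B) (C S : ℕ → Ω → Bool)
    (M : ℕ) (hC : ∀ u < M, C u ∈ B) (hS : ∀ u < M, S u ∈ B) :
    Computes B (M * 5) {f | ∃ u ≤ M, f = fun ω =>
      (QCentroid.decode (fun i => C i ω) (fun i => S i ω) u).1} := by
  suffices h : Computes B (M * 5) ({f | ∃ u ≤ M, f = fun ω =>
      (QCentroid.decode (fun i => C i ω) (fun i => S i ω) u).1} ∪ {fun ω =>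
      (QCentroid.decode (fun i => C i ω) (fun i => S i ω) M).2}) from
    h.mono subset_rfl le_rfl Set.subset_union_left
  induction M with
  | zero =>
    refine (Computes.of_subset (F := {fun _ => false}) (by simpa using h0)).mono subset_rfl
      (by simp) ?_
    rintro f (⟨u, hu, rfl⟩ | rfl)
    · obtain rfl : u = 0 := by omega
      rfl
    · rfl
  | succ M ih =>
    have h1 := ih (fun u hu => hC u (by omega)) (fun u hu => hS u (by omega))
    set F : Set (Ω → Bool) := {f | ∃ u ≤ M, f = fun ω =>
      (QCentroid.decode (fun i => C i ω) (fun i => S i ω) u).1} with hF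
    set d₁ : Ω → Bool := fun ω => (QCentroid.decode (fun i => C i ω) (fun i => S i ω) M).1 with hd₁
    set d₂ : Ω → Bool := fun ω => (QCentroid.decode (fun i => C i ω) (fun i => S i ω) M).2 with hd₂
    have m1 : d₁ ∈ B ∪ (F ∪ {d₂}) := Or.inr (Or.inl ⟨M, le_rfl, rfl⟩)
    have m2 : d₂ ∈ B ∪ (F ∪ {d₂}) := Or.inr (Or.inr rfl)
    have mC : C M ∈ B ∪ (F ∪ {d₂}) := Or.inl (hC M (by omega))
    have mS : S M ∈ B ∪ (F ∪ {d₂}) := Or.inl (hS M (by omega))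
    have h2 := (Computes.op m1 m2 xor).union (Computes.op mC m1 xor)
    have h3 := h2.bind (Computes.mux (c := fun ω => xor (d₁ ω) (d₂ ω)) (u := S M)
      (v := fun ω => xor (C M ω) (d₁ ω)) (by simp) (Or.inl mS) (by simp))
    have h4 := h1.bind (h3.union (Computes.of_subset (F := F)
      (fun f hf => Or.inr (Or.inl hf))))
    refine h4.mono subset_rfl (by omega) ?_
    rintro f (⟨u, hu, rfl⟩ | rfl)
    · rcases Nat.lt_or_eq_of_le hu with h5 | rfl
      · exact Or.inr ⟨u, by omega, rfl⟩
      · exact Or.inl rfl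
    · exact Or.inr ⟨M, le_rfl, rfl⟩

theorem Computes.tableInt {B : Set (Ω → Bool)} (h0 : (fun _ => false) ∈ B) (b : ℕ → Ω → Bool)
    (n : ℕ) (hb : ∀ i < n, b i ∈ B) (g : ℕ → ℤ) (Q : ℕ) :
    Computes B (Q * (4 * 2 ^ n)) (lowBits (fun ω => g (bitsValue (fun i => b i ω) n)) Q) :=
  Computes.family (fun i ω => intBit (g (bitsValue (fun i => b i ω) n)) i) Q fun i _ =>
    (Computes.table h0 b n hb (fun k => intBit (g k) i)).mono subset_rfl (by omega) subset_rfl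

/-- The estimate is computed by a short program: table lookups for the two halves of the angle,
four multiplications and one subtraction. -/
theorem Computes.estimate {B : Set (Ω → Bool)} (h0 : (fun _ => false) ∈ B) (n Q : ℕ) (hn : 2 ≤ n)
    (hQ : 2 * n < Q) (C S : ℕ → Ω → Bool) (R R' : Ω → ℤ)
    (hC : ∀ u < 2 * n, C u ∈ B) (hS : ∀ u < 2 * n, S u ∈ B)
    (hR : lowBits R (2 * n) ⊆ B) (hR' : lowBits R' (2 * n) ⊆ B)
    (hR0 : ∀ ω, 0 ≤ R ω) (hR1 : ∀ ω, R ω < 2 ^ (2 * n))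
    (hR0' : ∀ ω, 0 ≤ R' ω) (hR1' : ∀ ω, R' ω < 2 ^ (2 * n)) :
    Computes B (2 * n * 5 + 4 * (Q * (4 * 2 ^ n)) + 4 * (Q * (Q * 6)) + Q * 7)
      (lowBits (fun ω =>
        QCentroid.estimate n (fun i => C i ω) (fun i => S i ω) (R ω) (R' ω)) Q) := by
  have h1 := Computes.decode h0 C S (2 * n) hC hS
  set F : Set (Ω → Bool) := {f | ∃ u ≤ 2 * n, f = fun ω =>
      (QCentroid.decode (fun i => C i ω) (fun i => S i ω) u).1} with hF
  set bl : ℕ → Ω → Bool := fun i ω =>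
    (QCentroid.decode (fun i => C i ω) (fun i => S i ω) (i + 1)).1 with hbl
  set bh : ℕ → Ω → Bool := fun i ω =>
    (QCentroid.decode (fun i => C i ω) (fun i => S i ω) (n + i + 1)).1 with hbh
  have ml : ∀ i < n, bl i ∈ B ∪ F := fun i hi => Or.inr ⟨i + 1, by omega, rfl⟩
  have mh : ∀ i < n, bh i ∈ B ∪ F := fun i hi => Or.inr ⟨n + i + 1, by omega, rfl⟩
  set Ac : Ω → ℤ := fun ω => fixedCos (2 * n) n (bitsValue (fun i => bh i ω) n) with hAc
  set As : Ω → ℤ := fun ω => fixedSin (2 * n) n (bitsValue (fun i => bh i ω) n) with hAs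
  set Bc : Ω → ℤ := fun ω => fixedCos (2 * n) (2 * n) (bitsValue (fun i => bl i ω) n) with hBc
  set Bs : Ω → ℤ := fun ω => fixedSin (2 * n) (2 * n) (bitsValue (fun i => bl i ω) n) with hBs
  have t1 : Computes (B ∪ F) _ (lowBits Ac Q) :=
    Computes.tableInt (Or.inl h0) bh n mh (fixedCos (2 * n) n) Q
  have t2 : Computes (B ∪ F) _ (lowBits As Q) :=
    Computes.tableInt (Or.inl h0) bh n mh (fixedSin (2 * n) n) Q
  have t3 : Computes (B ∪ F) _ (lowBits Bc Q) :=
    Computes.tableInt (Or.inl h0) bl n ml (fixedCos (2 * n) (2 * n)) Q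
  have t4 : Computes (B ∪ F) _ (lowBits Bs Q) :=
    Computes.tableInt (Or.inl h0) bl n ml (fixedSin (2 * n) (2 * n)) Q
  have t := (t1.union t2).union (t3.union t4)
  set G := (lowBits Ac Q ∪ lowBits As Q) ∪ (lowBits Bc Q ∪ lowBits Bs Q) with hG
  have hlt : (2 : ℤ) ^ (2 * n) < 2 ^ Q := pow_lt_pow_right₀ (by norm_num) hQ
  have p1 : Computes (B ∪ F ∪ G) _ (lowBits (fun ω => Ac ω * Bc ω) Q) :=
    Computes.mul (Or.inl (Or.inl h0)) Q Q (fun f hf => Or.inr (Or.inl (Or.inl hf)))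
      (fun f hf => Or.inr (Or.inr (Or.inl hf)))
      (fun ω => fixedCos_low_nonneg n _ hn (bitsValue_lt _ _))
      (fun ω => lt_of_le_of_lt ((le_abs_self _).trans (fixedCos_abs_le _ _ _)) hlt)
  have p2 : Computes (B ∪ F ∪ G) _ (lowBits (fun ω => As ω * Bs ω) Q) :=
    Computes.mul (Or.inl (Or.inl h0)) Q Q (fun f hf => Or.inr (Or.inl (Or.inr hf)))
      (fun f hf => Or.inr (Or.inr (Or.inr hf)))
      (fun ω => fixedSin_low_nonneg n _ hn (bitsValue_lt _ _))
      (fun ω => lt_of_le_of_lt ((le_abs_self _).trans (fixedSin_abs_le _ _ _)) hlt)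
  have s1 := (p1.union p2).bind (Computes.sub (Or.inl (Or.inl (Or.inl h0))) Q
    (fun f hf => Or.inr (Or.inl hf)) (fun f hf => Or.inr (Or.inr hf)))
  have u1 := t.bind s1
  set W : Ω → ℤ := fun ω => Ac ω * Bc ω - As ω * Bs ω with hW
  have v1 : Computes (B ∪ F ∪ lowBits W Q) _ (lowBits (fun ω => W ω * R ω) Q) :=
    Computes.mul (Or.inl (Or.inl h0)) Q (2 * n) (fun f hf => Or.inr hf)
      (fun f hf => Or.inl (Or.inl (hR hf))) hR0 hR1
  have v2 : Computes (B ∪ F ∪ lowBits (fun ω => W ω * R ω) Q) _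
      (lowBits (fun ω => W ω * R ω * R' ω) Q) :=
    Computes.mul (Or.inl (Or.inl h0)) Q (2 * n) (fun f hf => Or.inr hf)
      (fun f hf => Or.inl (Or.inl (hR' hf))) hR0' hR1'
  have w := h1.bind ((u1.bind v1).bind v2)
  refine w.mono subset_rfl ?_ subset_rfl
  have hle : 2 * n * (Q * 6) ≤ Q * (Q * 6) := Nat.mul_le_mul_right _ hQ.le
  omega

end Estimate

/-! ### Product distributions and majority votes -/

section Probability

variable {K : Type} [Fintype K] [DecidableEq K]

open Classical in
/-- The probability of the event `E` when the bits `w` are independent with distribution `P w`. -/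
def productProb (P : K → Bool → ℝ) (E : (K → Bool) → Prop) : ℝ :=
  ∑ κ, if E κ then ∏ w, P w (κ w) else 0

theorem sum_prod_eq (P : K → Bool → ℝ) : ∑ κ : K → Bool, ∏ w, P w (κ w) = ∏ w, ∑ b, P w b :=
  (Fintype.prod_sum P).symm

theorem productProb_true (P : K → Bool → ℝ) (hP : ∀ w, ∑ b, P w b = 1) :
    productProb P (fun _ => True) = 1 := by
  simp only [productProb, if_true, sum_prod_eq, hP, Finset.prod_const_one]

theorem productProb_mono (P : K → Bool → ℝ) (h0 : ∀ w b, 0 ≤ P w b) {E E' : (K → Bool) → Prop}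
    (h : ∀ κ, (∏ w, P w (κ w)) ≠ 0 → E κ → E' κ) : productProb P E ≤ productProb P E' := by
  classical
  refine Finset.sum_le_sum fun κ _ => ?_
  have h1 : 0 ≤ ∏ w, P w (κ w) := Finset.prod_nonneg fun w _ => h0 _ _
  split_ifs with h2 h3 h3
  · exact le_rfl
  · by_contra h4
    exact h3 (h κ (fun h5 => h4 h5.le) h2)
  · exact h1
  · exact le_rfl

theorem productProb_not (P : K → Bool → ℝ) (hP : ∀ w, ∑ b, P w b = 1) (E : (K → Bool) → Prop) :
    productProb P E + productProb P (fun κ => ¬ E κ) = 1 := by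
  classical
  rw [← productProb_true P hP, productProb, productProb, productProb, ← Finset.sum_add_distrib]
  refine Finset.sum_congr rfl fun κ _ => ?_
  by_cases h : E κ <;> simp [h]

theorem productProb_exists_le {ι : Type} (P : K → Bool → ℝ) (h0 : ∀ w b, 0 ≤ P w b)
    (s : Finset ι) (E : ι → (K → Bool) → Prop) :
    productProb P (fun κ => ∃ i ∈ s, E i κ) ≤ ∑ i ∈ s, productProb P (E i) := by
  classical
  unfold productProb
  rw [Finset.sum_comm]
  refine Finset.sum_le_sum fun κ _ => ?_
  have h1 : 0 ≤ ∏ w, P w (κ w) := Finset.prod_nonneg fun w _ => h0 _ _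
  split_ifs with h2
  · obtain ⟨i, hi, hE⟩ := h2
    refine le_of_eq_of_le ?_ (Finset.single_le_sum
      (f := fun i => if E i κ then ∏ w, P w (κ w) else 0) (fun j _ => ?_) hi)
    · simp [hE]
    · split_ifs <;> simp [h1]
  · exact Finset.sum_nonneg fun j _ => by split_ifs <;> simp [h1]

/-- Chernoff's bound: if each bit of `s` has the value `b` with probability at least `3/5`, then
most of them have this value, except with exponentially small probability. -/
theorem productProb_minority_le (P : K → Bool → ℝ) (h0 : ∀ w b, 0 ≤ P w b)
    (hP : ∀ w, ∑ b, P w b = 1) (s : Finset K) (b : Bool) (hs : ∀ w ∈ s, P w (!b) ≤ 2 / 5) :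
    productProb P (fun κ => (s.filter fun w => κ w = b).card ≤ (s.filter fun w => κ w ≠ b).card)
      ≤ (49 / 50) ^ s.card := by
  classical
  -- the bound on the moment generating function with ratio `5/4`
  set g : K → Bool → ℝ := fun w b' => if w ∈ s then (if b' = b then 4 / 5 else 5 / 4) else 1
  have h1 : productProb P (fun κ => (s.filter fun w => κ w = b).card ≤
      (s.filter fun w => κ w ≠ b).card) ≤ ∑ κ : K → Bool, ∏ w, (P w (κ w) * g w (κ w)) := by
    refine Finset.sum_le_sum fun κ _ => ?_
    have h2 : 0 ≤ ∏ w, P w (κ w) := Finset.prod_nonneg fun w _ => h0 _ _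
    have h3 : ∏ w, g w (κ w) = (4 / 5 : ℝ) ^ (s.filter fun w => κ w = b).card *
        (5 / 4) ^ (s.filter fun w => κ w ≠ b).card := by
      simp only [g]
      rw [← Finset.prod_filter, Finset.filter_mem_eq_inter, Finset.univ_inter,
        Finset.prod_ite, Finset.prod_const, Finset.prod_const]
    rw [Finset.prod_mul_distrib, h3]
    split_ifs with h4
    · refine le_mul_of_one_le_right h2 ?_
      obtain ⟨k, hk⟩ := Nat.exists_eq_add_of_le h4
      rw [hk, pow_add, ← mul_assoc, ← mul_pow]
      norm_num
      exact one_le_pow₀ (by norm_num)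
    · positivity
  refine h1.trans ?_
  rw [sum_prod_eq (fun w b' => P w b' * g w b')]
  have h5 : ∀ w, ∑ b', P w b' * g w b' ≤ if w ∈ s then 49 / 50 else 1 := by
    intro w
    have hw := hP w
    rw [Fintype.sum_bool] at hw ⊢
    by_cases hws : w ∈ s
    · have h6 := hs w hws
      simp only [g, hws, if_true]
      cases b <;> simp at h6 ⊢ <;> linarith
    · simp only [g, hws, if_false, mul_one]
      exact hw.le
  refine (Finset.prod_le_prod (fun w _ => Finset.sum_nonneg fun b' _ =>
    mul_nonneg (h0 _ _) ?_) fun w _ => h5 w).trans ?_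
  · simp only [g]
    split_ifs <;> norm_num
  · rw [← Finset.prod_filter, Finset.filter_mem_eq_inter, Finset.univ_inter, Finset.prod_const]

/-! #### The distribution of the test outcomes -/

theorem testState_sq (μ : ℂ) (hμ : ‖μ‖ = 1) (b : Bool) :
    ‖testState μ b‖ ^ 2 = (1 + (if b then -1 else 1) * μ.re) / 2 := by
  have h1 : μ.re * μ.re + μ.im * μ.im = 1 := by
    have := Complex.normSq_apply μ
    rw [Complex.normSq_eq_norm_sq, hμ] at this
    linarith
  rw [← Complex.normSq_eq_norm_sq, Complex.normSq_apply, testState]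
  cases b <;> simp <;> nlinarith

theorem one_fifth_le_sin : 1 / 5 ≤ Real.sin (Real.pi / 10) := by
  have h := Real.mul_le_sin (x := Real.pi / 10) (by positivity) (by linarith [Real.pi_pos])
  have : 2 / Real.pi * (Real.pi / 10) = 1 / 5 := by
    field_simp
    norm_num
  linarith

/-- The majority of the outcomes of equal tests is a correct sign bit, with high probability. -/
theorem productProb_not_signBit_le (P : K → Bool → ℝ) (h0 : ∀ w b, 0 ≤ P w b)
    (hP : ∀ w, ∑ b, P w b = 1) (s : Finset K) (t : ℝ)
    (hs : ∀ w ∈ s, ∀ b, P w b = (1 + (if b then -1 else 1) * t) / 2)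
    (β : (K → Bool) → Bool) (hβ : ∀ κ, (s.filter fun w => κ w = β κ).card >
      (s.filter fun w => κ w ≠ β κ).card) :
    productProb P (fun κ => ¬ SignBit (β κ) t) ≤ (49 / 50) ^ s.card := by
  have h5 := one_fifth_le_sin
  have key : ∀ b : Bool, (∀ κ, ¬ SignBit (β κ) t → β κ ≠ b) → (∀ w ∈ s, P w (!b) ≤ 2 / 5) →
      productProb P (fun κ => ¬ SignBit (β κ) t) ≤ (49 / 50) ^ s.card := by
    intro b h1 h2
    refine (productProb_mono P h0 fun κ _ hκ => ?_).trans
      (productProb_minority_le P h0 hP s b h2)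
    have h3 : β κ = !b := by
      have := h1 κ hκ
      cases b <;> cases h : β κ <;> simp_all
    have h4 := hβ κ
    rw [h3] at h4
    have h6 : (s.filter fun w => κ w = !b) = s.filter fun w => κ w ≠ b :=
      Finset.filter_congr fun w _ => by cases κ w <;> cases b <;> simp
    have h7 : (s.filter fun w => κ w ≠ !b) = s.filter fun w => κ w = b :=
      Finset.filter_congr fun w _ => by cases κ w <;> cases b <;> simp
    rw [h6, h7] at h4
    exact h4.le
  rcases le_or_gt 0 t with ht | ht
  · by_cases h : Real.sin (Real.pi / 10) ≤ t
    · refine key false (fun κ hκ hb => hκ ⟨fun _ => hb, fun h' => ?_⟩) fun w hw => ?_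
      · have := sin_pi_div_ten_pos
        linarith
      · rw [hs w hw]
        norm_num
        linarith
    · refine le_trans (productProb_mono (E' := fun _ => False) P h0 fun κ _ hκ => hκ
        ⟨fun h' => absurd h' h, fun h' => ?_⟩) ?_
      · have := sin_pi_div_ten_pos
        linarith
      · simp only [productProb, if_false, Finset.sum_const_zero]
        positivity
  · by_cases h : t ≤ -Real.sin (Real.pi / 10)
    · refine key true (fun κ hκ hb => hκ ⟨fun h' => ?_, fun _ => hb⟩) fun w hw => ?_
      · have := sin_pi_div_ten_pos
        linarith
      · rw [hs w hw]
        norm_num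
        linarith
    · refine le_trans (productProb_mono (E' := fun _ => False) P h0 fun κ _ hκ => hκ
        ⟨fun h' => ?_, fun h' => absurd h' h⟩) ?_
      · have := sin_pi_div_ten_pos
        linarith
      · simp only [productProb, if_false, Finset.sum_const_zero]
        positivity

/-- The failure probabilities of the sign bits add up to at most `Δ`. -/
theorem sum_failure_le (h M : ℕ) (Δ : ℝ) (hΔ : 0 < Δ) (hΔ1 : Δ ≤ 1)
    (hh : 100 * Real.log (2 / Δ) ≤ 2 ^ h) :
    ∑ u ∈ Finset.range M, (49 / 50 : ℝ) ^ (2 ^ (h + u / 2 + 1) - 1) ≤ Δ := by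
  have h1 : ∀ u : ℕ, (49 / 50 : ℝ) ^ (2 ^ (h + u / 2 + 1) - 1) ≤ Δ * (1 / 2) ^ (u + 1) := by
    intro u
    have h2 : (2 : ℝ) ^ h * (u + 1) / 2 ≤ (2 ^ (h + u / 2 + 1) - 1 : ℕ) := by
      have h3 : u + 1 ≤ 2 * 2 ^ (u / 2) := by
        have h4 : u / 2 + 1 ≤ 2 ^ (u / 2) := Nat.lt_two_pow_self
        omega
      have h5 : 2 ^ h * (u + 1) ≤ 2 * (2 ^ (h + u / 2 + 1) - 1) := by
        have h6 : 2 ^ h * (u + 1) ≤ 2 ^ h * (2 * 2 ^ (u / 2)) := Nat.mul_le_mul_left _ h3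
        have h7 : 2 ^ h * (2 * 2 ^ (u / 2)) = 2 ^ (h + u / 2 + 1) := by ring
        have h8 : 2 ≤ 2 ^ (h + u / 2 + 1) := by
          calc 2 = 2 ^ 1 := rfl
            _ ≤ _ := Nat.pow_le_pow_right (by norm_num) (by omega)
        omega
      have h9 : ((2 ^ h * (u + 1) : ℕ) : ℝ) ≤ ((2 * (2 ^ (h + u / 2 + 1) - 1) : ℕ) : ℝ) := by
        exact_mod_cast h5
      rw [Nat.cast_mul 2] at h9
      push_cast at h9 ⊢
      linarith
    have h3 : (49 / 50 : ℝ) ≤ Real.exp (-(1 / 50)) := by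
      have := Real.add_one_le_exp (-(1 / 50) : ℝ)
      linarith
    have h4 : (49 / 50 : ℝ) ^ (2 ^ (h + u / 2 + 1) - 1)
        ≤ Real.exp (-(1 / 50)) ^ (2 ^ (h + u / 2 + 1) - 1) := by gcongr
    refine h4.trans ?_
    rw [← Real.exp_nat_mul]
    have h5 : ((2 ^ (h + u / 2 + 1) - 1 : ℕ) : ℝ) * (-(1 / 50))
        ≤ (u + 1 : ℕ) * Real.log (Δ / 2) := by
      have h6 : Real.log (Δ / 2) = -Real.log (2 / Δ) := by
        rw [← Real.log_inv, inv_div]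
      rw [h6]
      push_cast
      have h7 : (u + 1 : ℝ) * (100 * Real.log (2 / Δ)) ≤ (u + 1) * 2 ^ h := by gcongr
      linarith
    refine (Real.exp_le_exp.2 h5).trans ?_
    rw [Real.exp_nat_mul, Real.exp_log (by positivity), div_pow, one_div, inv_pow, div_eq_mul_inv]
    gcongr
    rw [pow_succ]
    exact mul_le_of_le_one_left hΔ.le (pow_le_one₀ hΔ.le hΔ1)
  refine (Finset.sum_le_sum fun u _ => h1 u).trans ?_
  rw [← Finset.mul_sum]
  refine mul_le_of_le_one_right hΔ.le ?_
  have h2 : ∀ M : ℕ, ∑ u ∈ Finset.range M, (1 / 2 : ℝ) ^ (u + 1) = 1 - (1 / 2) ^ M := by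
    intro M
    induction M with
    | zero => simp
    | succ M ih => rw [Finset.sum_range_succ, ih]; ring
  rw [h2]
  have : (0 : ℝ) ≤ (1 / 2) ^ M := by positivity
  linarith

end Probability

/-! ### Digits of the norms -/

section Digits

theorem bitsValue_congr {b b' : ℕ → Bool} {n : ℕ} (h : ∀ i < n, b i = b' i) :
    bitsValue b n = bitsValue b' n :=
  Finset.sum_congr rfl fun i hi => by rw [h i (Finset.mem_range.1 hi)]

theorem bitsValue_intBit (z : ℤ) (n : ℕ) : ((bitsValue (intBit z) n : ℕ) : ℤ) = z % 2 ^ n := by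
  induction n with
  | zero => simp [bitsValue]
  | succ n ih =>
    rw [bitsValue_succ, emod_two_pow_succ, ← ih]
    split_ifs <;> simp

theorem intBit_bitsValue (b : ℕ → Bool) (n i : ℕ) (h : i < n) :
    intBit (bitsValue b n : ℕ) i = b i := by
  obtain ⟨k, rfl⟩ := Nat.exists_eq_add_of_lt h
  rw [add_assoc, bitsValue_add]
  have h1 := bitsValue_lt b i
  have h2 : bitsValue (fun j => b (i + j)) (k + 1)
      = (if b i then 1 else 0) + 2 * bitsValue (fun j => b (i + 1 + j)) k := by
    rw [add_comm k 1, bitsValue_add]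
    have : bitsValue (fun j => b (i + j)) 1 = if b i then 1 else 0 := by simp [bitsValue]
    rw [this, pow_one]
    simp only [add_assoc]
  rw [h2]
  unfold intBit
  have h3 : (((bitsValue b i + 2 ^ i * ((if b i then 1 else 0) +
      2 * bitsValue (fun j => b (i + 1 + j)) k) : ℕ) : ℤ) / 2 ^ i)
      = ((if b i then 1 else 0) + 2 * bitsValue (fun j => b (i + 1 + j)) k : ℕ) := by
    have : (2 : ℤ) ^ i = ((2 ^ i : ℕ) : ℤ) := by push_cast; rfl
    rw [this, ← Int.natCast_ediv, Nat.add_mul_div_left _ _ (by positivity),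
      Nat.div_eq_of_lt h1, zero_add]
  rw [h3]
  cases b i <;> simp

theorem intBit_floor (r : ℝ) (s : ℤ) (i : ℕ) :
    intBit ⌊r * (2 : ℝ) ^ s⌋ i = binaryDigit r (s - i) := by
  unfold intBit binaryDigit
  have h : ⌊r * (2 : ℝ) ^ s⌋ / 2 ^ i = ⌊r * (2 : ℝ) ^ (s - i)⌋ := by
    have h1 : r * (2 : ℝ) ^ (s - i) = r * (2 : ℝ) ^ s / ((2 ^ i : ℕ) : ℝ) := by
      rw [zpow_sub₀ (by norm_num), zpow_natCast]
      push_cast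
      ring
    rw [h1, Int.floor_div_natCast]
    push_cast
    rfl
  rw [h]

/-- The digits of a nonnegative number below `2 ^ e` determine its integer part at scale
`2 ^ (M - e)`. -/
theorem bitsValue_binaryDigit (r : ℝ) (hr : 0 ≤ r) (e : ℤ) (he : r < 2 ^ e) (M : ℕ) :
    ((bitsValue (fun i => binaryDigit r ((M : ℤ) - e - i)) M : ℕ) : ℤ)
      = ⌊r * (2 : ℝ) ^ ((M : ℤ) - e)⌋ := by
  simp only [← intBit_floor]
  rw [bitsValue_intBit, Int.emod_eq_of_lt]
  · exact Int.floor_nonneg.2 (by positivity)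
  · rw [Int.floor_lt]
    push_cast
    calc r * (2 : ℝ) ^ ((M : ℤ) - e) < 2 ^ e * (2 : ℝ) ^ ((M : ℤ) - e) := by gcongr
      _ = 2 ^ M := by
        rw [← zpow_add₀ (by norm_num), add_sub_cancel, zpow_natCast]

end Digits

/-! ### Measuring the qubits of a block -/

section Measure

variable {m : ℕ} {K : Type} {T : ℝ}

/-- The basis states of a block, split into its registers. -/
def sysWireEquiv (m : ℕ) (K : Type) :
    ((K → Bool) × Bool × (Fin m → Bool) × (Fin (m + 1) → Bool)) ≃ (SysWire m K → Bool) where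
  toFun z := Sum.elim z.1 (Sum.elim (fun _ => z.2.1) (Sum.elim z.2.2.1 z.2.2.2))
  invFun y := (fun κ => y (Sum.inl κ), y ancWire, fun t => y (targetWire t),
    fun r => y (flagWire r))
  left_inv _ := rfl
  right_inv y := by
    funext v
    rcases v with _ | _ | _ | _ <;> rfl

theorem lift_sysWireEquiv (v : LogicalState m K) (κ : K → Bool) (a : Bool) (t : Fin m → Bool)
    (r : Fin (m + 1) → Bool) :
    lift v (sysWireEquiv m K (κ, a, t, r)) = if r = (fun _ => false) then v κ a t else 0 := by
  by_cases h : r = fun _ => false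
  · subst h
    rw [if_pos rfl]
    exact if_pos fun _ => rfl
  · rw [if_neg h]
    exact if_neg fun h' => h (funext h')

theorem zeroState_eq_lift [Fintype K] : zeroState (SysWire m K) =
    lift (tensor (prodState fun _ => ketZero)
      (fun a y => if a = false ∧ y = (fun _ => false) then 1 else 0)) := by
  funext x
  obtain ⟨⟨κ, a, t, r⟩, rfl⟩ := (sysWireEquiv m K).surjective x
  rw [lift_sysWireEquiv]
  have h0 : (fun _ => false) = sysWireEquiv m K
      (fun _ => false, false, fun _ => false, fun _ => false) := by
    funext v
    rcases v with _ | _ | _ | _ <;> rfl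
  have h1 : (prodState fun _ => ketZero) κ = if κ = (fun _ => false) then (1 : ℂ) else 0 := by
    unfold prodState ketZero
    by_cases h : κ = fun _ => false
    · subst h; simp
    · rw [if_neg h]
      obtain ⟨w, hw⟩ := Function.ne_iff.1 h
      exact Finset.prod_eq_zero (Finset.mem_univ w) (by simp at hw; simp [hw])
  have h2 : sysWireEquiv m K (κ, a, t, r) = (fun _ => false) ↔ κ = (fun _ => false) ∧ a = false ∧
      t = (fun _ => false) ∧ r = fun _ => false := by
    rw [h0, (sysWireEquiv m K).injective.eq_iff]
    simp only [Prod.mk.injEq]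
  simp only [zeroState, h2, tensor, Pi.smul_apply, smul_eq_mul, h1]
  by_cases hκ : κ = (fun _ => false) <;> by_cases hr : r = (fun _ => false) <;>
    simp [hκ, hr]

theorem sysHadamard_zero : sysHadamard (m := m)
    (fun a y => if a = false ∧ y = (fun _ => false) then 1 else 0) = plusState m := by
  funext a y
  by_cases hy : y = (fun _ => false) <;> simp [sysHadamard, hadamard, plusState, hy]

variable [DecidableEq K]

/-- The distribution of a qubit of the block before the classical computation, if the rotation has
the phase `θ`: qubits in `St` hold the outcomes of tests of the power `n w` of the rotation with
additional phase `c w`, qubits in `Sd` digits of norms, and the others are `0`. -/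
def outcome (D : BlockData m) (St Sd : Finset K) (c : K → ℂ) (n : K → ℕ) (g : K → Bool) (s : K → ℤ)
    (θ : ℝ) (w : K) (b : Bool) : ℝ :=
  if w ∈ St then (1 + (if b then -1 else 1) * (c w * Complex.exp (θ * Complex.I) ^ n w).re) / 2
  else if b = (if w ∈ Sd then D.digit (g w) (s w) else false) then 1 else 0

theorem outcome_nonneg (D : BlockData m) (St Sd : Finset K) (c : K → ℂ) (hc : ∀ w, ‖c w‖ = 1)
    (n : K → ℕ) (g : K → Bool) (s : K → ℤ) (θ : ℝ) (w : K) (b : Bool) :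
    0 ≤ outcome D St Sd c n g s θ w b := by
  unfold outcome
  by_cases hw : w ∈ St
  · rw [if_pos hw, ← testState_sq _
      (by rw [norm_mul, norm_pow, hc, Complex.norm_exp_ofReal_mul_I]; simp)]
    positivity
  · rw [if_neg hw]
    split_ifs <;> norm_num

theorem sum_outcome (D : BlockData m) (St Sd : Finset K) (c : K → ℂ) (n : K → ℕ) (g : K → Bool)
    (s : K → ℤ) (θ : ℝ) (w : K) : ∑ b, outcome D St Sd c n g s θ w b = 1 := by
  rw [Fintype.sum_bool]
  unfold outcome
  by_cases hw : w ∈ St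
  · simp only [hw, if_true, Bool.false_eq_true, if_false]
    ring
  · simp only [hw, if_false]
    cases (if w ∈ Sd then D.digit (g w) (s w) else false) <;> simp

variable [Fintype K]

open Classical in
/-- The distribution of the qubits `K` in the block state given by a logical state. -/
theorem sum_lift (v : LogicalState m K) (E : (K → Bool) → Prop) :
    ∑ y : SysWire m K → Bool, (if E (fun κ => y (Sum.inl κ)) then ‖lift v y‖ ^ 2 else 0)
      = ∑ κ, if E κ then sysNormSq (v κ) else 0 := by
  rw [← (sysWireEquiv m K).sum_comp]
  simp only [Fintype.sum_prod_type]
  refine Finset.sum_congr rfl fun κ _ => ?_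
  by_cases h : E κ
  · rw [if_pos h, sysNormSq]
    refine Finset.sum_congr rfl fun a _ => Finset.sum_congr rfl fun t _ => ?_
    rw [Fintype.sum_eq_single (fun _ => false)]
    · rw [lift_sysWireEquiv, if_pos rfl]
      exact if_pos h
    · intro r hr
      rw [lift_sysWireEquiv, if_neg hr]
      simp
  · rw [if_neg h]
    refine Finset.sum_eq_zero fun a _ => Finset.sum_eq_zero fun t _ =>
      Finset.sum_eq_zero fun r _ => if_neg h

/-- A block circuit that loads digits, performs tests and then computes classically. As the start
state of ancilla and target register is the sum of two orthogonal eigenvectors of the rotation, the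
qubits `K` end up in a mixture of two product distributions, transformed by the computation. -/
theorem exists_blockCircuit (St Sd : Finset K) (hdisj : ∀ w ∈ St, w ∉ Sd) (c : K → ℂ)
    (hc : ∀ w, ‖c w‖ = 1) (n : K → ℕ) (g : K → Bool) (s : K → ℤ) (ops : List (Flip K)) :
    ∃ P : List (BlockGate m (SysWire m K)),
      blockTime T P ≤ 1 + Sd.card * T + ∑ w ∈ St, (3 + n w * (4 * T + 2 * m + 10)) + ops.length ∧
      ∀ D, ∃ θ₁ θ₂ p₁ p₂ : ℝ, 0 ≤ p₁ ∧ 0 ≤ p₂ ∧ p₁ + p₂ = 1 ∧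
        Real.cos θ₁ = overlap (fun a => (D.prep a).1) ∧
        Real.cos θ₂ = overlap (fun a => (D.prep a).1) ∧
        ∀ E : (K → Bool) → Prop,
          (∑ y : SysWire m K → Bool, open Classical in if E (fun κ => y (Sum.inl κ)) then
            ‖blockRun D P (zeroState (SysWire m K)) y‖ ^ 2 else 0)
          = p₁ * productProb (outcome D St Sd c n g s θ₁) (fun κ => E (flipForward ops κ)) +
            p₂ * productProb (outcome D St Sd c n g s θ₂) (fun κ => E (flipForward ops κ)) := by
  classical
  obtain ⟨P₁, t₁, h₁⟩ := implLogical_hadamard_anc (m := m) (K := K) (T := T)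
  obtain ⟨P₂, t₂, h₂⟩ := exists_loads (m := m) (T := T) Sd.toList Sd.nodup_toList g s
  obtain ⟨P₃, t₃, h₃⟩ := exists_tests (m := m) (T := T) St.toList St.nodup_toList c hc n
  obtain ⟨P₄, t₄, h₄⟩ := implLogical_flips (m := m) (T := T) ops
  refine ⟨P₁ ++ (P₂ ++ (P₃ ++ P₄)), ?_, fun D => ?_⟩
  · rw [Finset.sum_map_toList] at t₃
    rw [Finset.length_toList] at t₂
    simp only [blockTime, List.map_append, List.sum_append] at t₁ t₂ t₃ t₄ ⊢
    linarith
  · obtain ⟨e₁, e₂, θ₁, θ₂, hadd, horth, r₁, r₂, o₁, o₂⟩ := exists_eigenvectors D.prep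
    refine ⟨θ₁, θ₂, sysNormSq e₁, sysNormSq e₂,
      Finset.sum_nonneg fun _ _ => Finset.sum_nonneg fun _ _ => sq_nonneg _,
      Finset.sum_nonneg fun _ _ => Finset.sum_nonneg fun _ _ => sq_nonneg _, ?_, o₁, o₂,
      fun E => ?_⟩
    · have := sysNormSq_add_of_orthogonal e₁ e₂ horth 1 1
      simpa [hadd, sysNormSq_plus] using this.symm
    set α : ℝ → K → Bool → ℂ := fun θ w => if w ∈ St then
      testState (c w * Complex.exp (θ * Complex.I) ^ n w) else
      if w ∈ Sd then fun b => ketZero (xor b (D.digit (g w) (s w))) else ketZero with hα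
    have hrun : blockRun D (P₁ ++ (P₂ ++ (P₃ ++ P₄))) (zeroState (SysWire m K))
        = lift (fun κ => prodState (α θ₁) (flipBackward ops κ) • e₁
            + prodState (α θ₂) (flipBackward ops κ) • e₂) := by
      have hA := h₁ D (tensor (prodState fun _ => ketZero)
        (fun a y => if a = false ∧ y = (fun _ => false) then 1 else 0))
      have hA' : (fun κ => sysHadamard (tensor (prodState fun _ : K => ketZero)
          (fun (a : Bool) (y : Fin m → Bool) => if a = false ∧ y = (fun _ => false) then 1 else 0)
          κ)) = tensor (prodState fun _ => ketZero) (plusState m) := by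
        rw [← sysHadamard_zero]
        funext κ a y
        simp only [tensor, sysHadamard, hadamard, Pi.smul_apply, smul_eq_mul]
        ring
      replace hA := hA.trans (congrArg lift hA')
      have hB := h₂ D (plusState m) (fun _ => ketZero)
      have hloaded : ∀ τ ∈ St.toList, (fun w => if w ∈ Sd.toList then
          (fun b => ketZero (xor b (D.digit (g w) (s w)))) else ketZero) τ = ketZero := by
        intro τ hτ
        dsimp only
        rw [if_neg (by simpa using hdisj τ (by simpa using hτ))]
      have hC₁ := h₃ D e₁ _ _ r₁ hloaded
      have hC₂ := h₃ D e₂ _ _ r₂ hloaded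
      have hD := h₄ D (tensor (prodState (α θ₁)) e₁ + tensor (prodState (α θ₂)) e₂)
      have hC := blockRun_add D P₃
        (lift (tensor (prodState (fun w => if w ∈ Sd.toList then
          (fun b => ketZero (xor b (D.digit (g w) (s w)))) else ketZero)) e₁))
        (lift (tensor (prodState (fun w => if w ∈ Sd.toList then
          (fun b => ketZero (xor b (D.digit (g w) (s w)))) else ketZero)) e₂))
      rw [hC₁, hC₂, ← lift_add, ← lift_add, ← tensor_add_right, hadd] at hC
      simp only [Finset.mem_toList] at hB hC
      rw [zeroState_eq_lift]
      simp only [blockRun, List.foldl_append] at hA hB hC hD ⊢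
      rw [hA, hB, hC]
      exact hD
    rw [hrun, sum_lift, ← (flipEquiv ops).sum_comp]
    -- `flipForward` appears since the amplitude at `κ` is the one at `flipBackward ops κ` before
    have hw : ∀ θ w b, ‖α θ w b‖ ^ 2 = outcome D St Sd c n g s θ w b := by
      intro θ w b
      simp only [hα, outcome]
      by_cases hw : w ∈ St
      · simp only [hw, if_true]
        exact testState_sq _ (by rw [norm_mul, norm_pow, hc, Complex.norm_exp_ofReal_mul_I]; simp) b
      · by_cases hw' : w ∈ Sd
        · simp only [hw, hw', if_true, if_false]
          cases b <;> cases D.digit (g w) (s w) <;> simp [ketZero]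
        · simp only [hw, hw', if_false]
          cases b <;> simp [ketZero]
    have hq : ∀ θ κ, ‖prodState (α θ) κ‖ ^ 2 = ∏ w, outcome D St Sd c n g s θ w (κ w) := by
      intro θ κ
      rw [prodState, norm_prod, ← Finset.prod_pow]
      exact Finset.prod_congr rfl fun w _ => hw _ _ _
    unfold productProb
    rw [Finset.mul_sum, Finset.mul_sum, ← Finset.sum_add_distrib]
    refine Finset.sum_congr rfl fun κ _ => ?_
    have hf : flipBackward ops (flipEquiv ops κ) = κ := flipBackward_forward ops κ
    have hf' : flipEquiv ops κ = flipForward ops κ := rfl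
    rw [sysNormSq_add_of_orthogonal e₁ e₂ horth, hf, hf', hq, hq]
    split_ifs <;> ring

end Measure

/-! ### The classical part of the algorithm -/

section Classical

/-- Functions of the coordinates that have a short program can be written into fresh bits by few
classical instructions. The results are copied at the end, so that their positions are distinct
even if some of the functions agree. -/
theorem Computes.exists_flips {ι : Type} [DecidableEq ι] {Z : (ι → Bool) → ℤ} {L Q : ℕ}
    (h : Computes (Set.range fun (i : ι) (ω : ι → Bool) => ω i) L (lowBits Z Q)) :
    ∃ (n : ℕ) (ops : List (Flip (ι ⊕ Fin n))) (out : Fin Q ↪ Fin n), ops.length ≤ L + Q ∧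
      ∀ (ω : ι → Bool) (i : Fin Q),
        flipForward ops (Sum.elim ω fun _ => false) (Sum.inr (out i)) = intBit (Z ω) i := by
  obtain ⟨l, hl, hlen, hF⟩ := h
  set g : ℕ → (ι → Bool) → Bool := fun i ω => intBit (Z ω) i with hg
  have h1 := hl.copy g Q fun i hi => hF _ (mem_lowBits hi)
  obtain ⟨ops, hops, h2⟩ := h1.exists_flips (l.length + Q) (by simp [add_comm])
  refine ⟨l.length + Q, ops, ⟨fun i => Fin.natAdd _ i, Fin.natAdd_injective _ _⟩, ?_,
    fun ω i => ?_⟩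
  · rw [hops]
    simp
    omega
  · refine (h2 ω).2.2 _ (g i) ?_
    rw [List.reverse_append, List.reverse_reverse, List.getElem?_append_right (by simp)]
    simp

/-- The number of repetitions of the tests for the sign bits of step `u` of the decoding. -/
def reps (h u : ℕ) : ℕ := 2 ^ (h + u / 2 + 1) - 1

/-- The qubits that hold the outcomes of the tests: for each step of the decoding, the repeated
tests for the sign of a cosine (at `false`) and of a sine (at `true`). -/
abbrev TestWire (h M : ℕ) : Type := Σ u : Fin M, Bool × Fin (reps h u)

/-- The instance is declared because the search for one in sums with `TestWire` exceeds the size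
limit. -/
instance (h M : ℕ) : DecidableEq (TestWire h M) := Classical.decEq _

/-- The qubits that hold test outcomes and, for the example (at `false`) and the centroid (at
`true`), the digits of the norm. -/
abbrev InWire (h M : ℕ) : Type := TestWire h M ⊕ (Bool × Fin M)

/-- The sign bit of the cosine (for `t = false`) or the sine (for `t = true`) at step `u`. -/
def signFun (h M : ℕ) (t : Bool) (u : ℕ) : (InWire h M → Bool) → Bool :=
  if hu : u < M then
    majority (h + u / 2) (List.ofFn fun (r : Fin (reps h u)) (ω : InWire h M → Bool) =>
      ω (Sum.inl ⟨⟨u, hu⟩, t, r⟩))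
  else fun _ => false

/-- A digit of a norm, by increasing weight. -/
def digitFun (h M : ℕ) (c : Bool) (i : ℕ) : (InWire h M → Bool) → Bool :=
  if hi : i < M then fun ω => ω (Sum.inr (c, ⟨i, hi⟩)) else fun _ => false

/-- The truncated norm with the given digits. -/
def normFun (h M : ℕ) (c : Bool) (ω : InWire h M → Bool) : ℤ :=
  (bitsValue (fun i => digitFun h M c i ω) M : ℕ)

/-- The estimate as a function of the test outcomes and the digits of the norms. -/
def resultFun (h n : ℕ) (ω : InWire h (2 * n) → Bool) : ℤ :=
  estimate n (fun u => signFun h (2 * n) false u ω) (fun u => signFun h (2 * n) true u ω)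
    (normFun h (2 * n) false ω) (normFun h (2 * n) true ω)

theorem normFun_nonneg (h M : ℕ) (c : Bool) (ω : InWire h M → Bool) : 0 ≤ normFun h M c ω :=
  Int.natCast_nonneg _

theorem normFun_lt (h M : ℕ) (c : Bool) (ω : InWire h M → Bool) : normFun h M c ω < 2 ^ M := by
  unfold normFun
  exact_mod_cast bitsValue_lt _ _

theorem reps_add_one (h u : ℕ) : reps h u + 1 = 2 ^ (h + u / 2 + 1) :=
  Nat.sub_add_cancel Nat.one_le_two_pow

theorem computes_resultFun (h n Q : ℕ) (hn : 2 ≤ n) (hQ : 2 * n < Q) :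
    Computes (Set.range fun (i : InWire h (2 * n)) (ω : InWire h (2 * n) → Bool) => ω i)
      (1 + 2 * (2 * n * (2 ^ (h + n + 1) * 5)) +
        (2 * n * 5 + 4 * (Q * (4 * 2 ^ n)) + 4 * (Q * (Q * 6)) + Q * 7))
      (lowBits (resultFun h n) Q) := by
  set B := Set.range fun (i : InWire h (2 * n)) (ω : InWire h (2 * n) → Bool) => ω i with hB
  have h0 : Computes B 1 {fun _ => false} :=
    Computes.op (B := B) (u := fun ω => ω (Sum.inr (false, ⟨0, by omega⟩)))
      (v := fun ω => ω (Sum.inr (false, ⟨0, by omega⟩))) ⟨_, rfl⟩ ⟨_, rfl⟩ fun _ _ => false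
  have h1 : ∀ t, Computes B (2 * n * (2 ^ (h + n + 1) * 5))
      {f | ∃ u < 2 * n, f = signFun h (2 * n) t u} := by
    intro t
    refine Computes.family _ _ fun u hu => ?_
    have h2 := Computes.majority (B := B) (h + u / 2)
      (List.ofFn fun (r : Fin (reps h u)) (ω : InWire h (2 * n) → Bool) =>
        ω (Sum.inl ⟨⟨u, hu⟩, t, r⟩)) (by rw [List.length_ofFn, reps_add_one]) (by
        intro f hf
        rw [List.mem_ofFn] at hf
        obtain ⟨r, rfl⟩ := hf
        exact ⟨_, rfl⟩)
    refine h2.mono subset_rfl ?_ ?_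
    · exact Nat.mul_le_mul_right _ (Nat.pow_le_pow_right (by norm_num) (by omega))
    · rw [signFun, dif_pos hu]
  have h3 := (h0.union ((h1 false).union (h1 true)))
  have hnorm : ∀ c, lowBits (normFun h (2 * n) c) (2 * n) ⊆ B := by
    rintro c f ⟨i, hi, rfl⟩
    refine ⟨Sum.inr (c, ⟨i, hi⟩), ?_⟩
    funext ω
    simp only [normFun]
    rw [intBit_bitsValue _ _ _ hi, digitFun, dif_pos hi]
  have h4 := h3.bind (Computes.estimate (Or.inr (Or.inl rfl)) n Q hn hQ
    (signFun h (2 * n) false) (signFun h (2 * n) true) (normFun h (2 * n) false)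
    (normFun h (2 * n) true) (fun u hu => Or.inr (Or.inr (Or.inl ⟨u, hu, rfl⟩)))
    (fun u hu => Or.inr (Or.inr (Or.inr ⟨u, hu, rfl⟩)))
    ((hnorm false).trans Set.subset_union_left) ((hnorm true).trans Set.subset_union_left)
    (normFun_nonneg _ _ _) (normFun_lt _ _ _) (normFun_nonneg _ _ _) (normFun_lt _ _ _))
  refine h4.mono subset_rfl ?_ subset_rfl
  omega

/-- If all sign bits are correct, the estimate is close to the product of the norms and the
overlap. -/
theorem resultFun_close (h n : ℕ) (hn : 2 ≤ n) (ω : InWire h (2 * n) → Bool) (θ η : ℝ) (e : ℤ)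
    (r : Bool → ℝ) (hη : 0 ≤ η) (hr0 : ∀ c, 0 ≤ r c) (hr : ∀ c, r c ≤ Real.sqrt η)
    (he : Real.sqrt η < 2 ^ e) (he' : (2 : ℝ) ^ e ≤ 2 * Real.sqrt η)
    (hdigit : ∀ c (i : Fin (2 * n)), ω (Sum.inr (c, i)) = binaryDigit (r c) ((2 * n : ℕ) - e - i))
    (hC : ∀ u < 2 * n, SignBit (signFun h (2 * n) false u ω)
      (Real.cos ((2 ^ (2 * n - 1 - u) : ℕ) * θ)))
    (hS : ∀ u < 2 * n, SignBit (signFun h (2 * n) true u ω)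
      (Real.sin ((2 ^ (2 * n - 1 - u) : ℕ) * θ))) :
    |(2 : ℝ) ^ (-(2 * ((2 * n : ℕ) - e) + 2 * (2 * n : ℕ) : ℤ)) * resultFun h n ω
      - r false * r true * Real.cos θ| ≤ 12 * η / 2 ^ (2 * n) := by
  have hR : ∀ c, normFun h (2 * n) c ω = ⌊r c * (2 : ℝ) ^ (((2 * n : ℕ) : ℤ) - e)⌋ := by
    intro c
    rw [← bitsValue_binaryDigit (r c) (hr0 c) e ((hr c).trans_lt he) (2 * n), normFun]
    congr 1
    refine bitsValue_congr fun i hi => ?_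
    rw [digitFun, dif_pos hi, hdigit]
  set C := fun u => signFun h (2 * n) false u ω
  set S := fun u => signFun h (2 * n) true u ω
  have h1 := estimate_cos_close n C S
  have h2 := cos_decodedAngle_close C S (fun u => (2 ^ (2 * n - u) : ℕ) * θ) (2 * n) (by omega)
    (fun u hu => by
      have : 2 * n - u = (2 * n - (u + 1)) + 1 := by omega
      rw [this, pow_succ]
      push_cast
      ring)
    (fun u hu => by
      have : 2 * n - (u + 1) = 2 * n - 1 - u := by omega
      rw [this]
      exact hC u hu)
    (fun u hu => by
      have : 2 * n - (u + 1) = 2 * n - 1 - u := by omega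
      rw [this]
      exact hS u hu)
  -- one error `4 / 2 ^ (2 n)` comes from the truncated angle, another one from the tables
  simp only [Nat.sub_self, pow_zero, Nat.cast_one, one_mul] at h2
  have h3 := product_close (2 * n) e η (r false) (r true) (Real.cos θ)
    (angleCos n (bitsValue (fun i => (decode C S (n + i + 1)).1) n)
      (bitsValue (fun i => (decode C S (i + 1)).1) n)) hη (hr0 _) (hr _) (hr0 _) (hr _) he'
    (Real.abs_cos_le_one θ) (by
      refine (abs_sub_le _ (Real.cos (decodedAngle C S (2 * n))) _).trans ?_
      refine (add_le_add h1 h2).trans (le_of_eq ?_)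
      ring)
  unfold resultFun estimate
  rw [hR, hR]
  push_cast at h3 ⊢
  exact h3

end Classical

/-! ### The probability of success -/

section Success

theorem trueCount_ofFn {Ω : Type} {R : ℕ} (f : Fin R → Ω → Bool) (ω : Ω) :
    trueCount (List.ofFn f) ω = (Finset.univ.filter fun r => f r ω = true).card := by
  rw [trueCount, List.ofFn_eq_map, List.countP_map, List.countP_eq_length_filter]
  simp [Finset.card, Finset.filter, Fin.univ_def, Function.comp_def]

/-- The majority of an odd number of bits is the value that most of them have. -/
theorem card_majority {Ω K : Type} [DecidableEq K] {H R : ℕ} (hR : R + 1 = 2 ^ (H + 1))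
    (f : Fin R → Ω → Bool) (g : Fin R ↪ K) (ω : Ω) (κ : K → Bool) (hf : ∀ r, f r ω = κ (g r)) :
    ((Finset.univ.map g).filter fun w => κ w ≠ majority H (List.ofFn f) ω).card <
      ((Finset.univ.map g).filter fun w => κ w = majority H (List.ofFn f) ω).card := by
  have h1 := majority_iff H (List.ofFn f) (by rw [List.length_ofFn, hR]) ω
  rw [trueCount_ofFn] at h1
  simp only [Finset.filter_map, Finset.card_map, Function.comp_def, ← hf]
  have h2 := Finset.card_filter_add_card_filter_not (s := (Finset.univ : Finset (Fin R)))
    (fun r => f r ω = true)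
  rw [Finset.card_univ, Fintype.card_fin] at h2
  rw [pow_succ] at hR
  cases hb : majority H (List.ofFn f) ω
  · simp only [hb, Bool.false_eq_true, false_iff] at h1
    simp only [ne_eq, Bool.not_eq_false, Bool.not_eq_true] at h2 ⊢
    omega
  · simp only [hb, true_iff] at h1
    simp only [ne_eq]
    omega

variable {h n L m : ℕ}

/-- All the qubits of a block other than the quantum registers: the outcomes and digits, and the
memory of the classical computation. -/
abbrev MemWire (h n L : ℕ) : Type := InWire h (2 * n) ⊕ Fin L

/-- The position of a test qubit in the block. -/
def testEmb (h n L : ℕ) : TestWire h (2 * n) ↪ MemWire h n L :=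
  Function.Embedding.inl.trans Function.Embedding.inl

/-- The position of a digit in the block. -/
def digitEmb (h n L : ℕ) : Bool × Fin (2 * n) ↪ MemWire h n L :=
  Function.Embedding.inr.trans Function.Embedding.inl

/-- The test qubits. -/
def testSet (h n L : ℕ) : Finset (MemWire h n L) := Finset.univ.map (testEmb h n L)

/-- The qubits that hold digits of norms. -/
def digitSet (h n L : ℕ) : Finset (MemWire h n L) := Finset.univ.map (digitEmb h n L)

/-- The additional phase of a test: `1` gives the cosine, `-i` the sine. -/
def testPhase : MemWire h n L → ℂ
  | Sum.inl (Sum.inl ⟨_, t, _⟩) => if t then -Complex.I else 1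
  | _ => 1

/-- The power of the rotation used in a test. -/
def testPower : MemWire h n L → ℕ
  | Sum.inl (Sum.inl ⟨u, _, _⟩) => 2 ^ (2 * n - 1 - u)
  | _ => 0

/-- The vector whose norm is read. -/
def digitSource : MemWire h n L → Bool
  | Sum.inl (Sum.inr (c, _)) => c
  | _ => false

/-- The weight of the digit that is read, for norms below `2 ^ e`. -/
def digitWeight (e : ℤ) : MemWire h n L → ℤ
  | Sum.inl (Sum.inr (_, i)) => (2 * n : ℕ) - e - i
  | _ => 0

theorem testPhase_norm (w : MemWire h n L) : ‖testPhase w‖ = 1 := by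
  unfold testPhase
  split
  · split_ifs <;> simp
  · simp

theorem not_mem_digitSet {w : MemWire h n L} (hw : w ∈ testSet h n L) : w ∉ digitSet h n L := by
  obtain ⟨τ, -, rfl⟩ := Finset.mem_map.1 hw
  simp [digitSet, testEmb, digitEmb]

/-- The distribution of the qubits of the block before the classical computation. -/
abbrev memOutcome (D : BlockData m) (h n L : ℕ) (e : ℤ) (θ : ℝ) : MemWire h n L → Bool → ℝ :=
  outcome D (testSet h n L) (digitSet h n L) testPhase testPower digitSource (digitWeight e) θ

theorem memOutcome_test (D : BlockData m) (e : ℤ) (θ : ℝ) (u : Fin (2 * n)) (t : Bool)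
    (r : Fin (reps h u)) (b : Bool) :
    memOutcome D h n L e θ (testEmb h n L ⟨u, t, r⟩) b = (1 + (if b then -1 else 1) *
      (if t then Real.sin ((2 ^ (2 * n - 1 - u) : ℕ) * θ)
        else Real.cos ((2 ^ (2 * n - 1 - u) : ℕ) * θ))) / 2 := by
  have h1 : testEmb h n L ⟨u, t, r⟩ ∈ testSet h n L := Finset.mem_map_of_mem _ (Finset.mem_univ _)
  unfold memOutcome outcome
  rw [if_pos h1]
  have h2 : (testPhase (testEmb h n L ⟨u, t, r⟩)) = if t then -Complex.I else 1 := rfl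
  have h3 : (testPower (testEmb h n L ⟨u, t, r⟩)) = 2 ^ (2 * n - 1 - (u : ℕ)) := rfl
  rw [h2, h3, ← Complex.exp_nat_mul, ← mul_assoc]
  generalize 2 ^ (2 * n - 1 - (u : ℕ)) = N
  have h4 : ((N : ℕ) : ℂ) * (θ : ℂ) = ((N * θ : ℝ) : ℂ) := by push_cast; rfl
  rw [h4]
  generalize (N * θ : ℝ) = x
  congr 3
  cases t
  · simp [Complex.exp_ofReal_mul_I_re]
  · simp [Complex.exp_ofReal_mul_I_im]

/-- Qubits that hold no test outcome have a definite value. -/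
theorem eq_of_memOutcome_ne_zero (D : BlockData m) (e : ℤ) (θ : ℝ) (κ : MemWire h n L → Bool)
    (hκ : (∏ w, memOutcome D h n L e θ w (κ w)) ≠ 0) :
    (∀ c i, κ (Sum.inl (Sum.inr (c, i))) = D.digit c ((2 * n : ℕ) - e - i)) ∧
      ∀ i, κ (Sum.inr i) = false := by
  have h1 : ∀ w, w ∉ testSet h n L → κ w = if w ∈ digitSet h n L then
      D.digit (digitSource w) (digitWeight e w) else false := by
    intro w hw
    have := (Finset.prod_ne_zero_iff.1 hκ) w (Finset.mem_univ w)
    unfold memOutcome outcome at this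
    rw [if_neg hw] at this
    by_contra h2
    exact this (if_neg h2)
  refine ⟨fun c i => ?_, fun i => ?_⟩
  · rw [h1, if_pos]
    · rfl
    · exact Finset.mem_map_of_mem (digitEmb h n L) (Finset.mem_univ (c, i))
    · simp [testSet, testEmb]
  · rw [h1, if_neg]
    · simp [digitSet, digitEmb]
    · simp [testSet, testEmb]

/-- Whatever holds when all sign bits are correct holds with probability at least `1 - 2 Δ`. -/
theorem success_probability (D : BlockData m) (e : ℤ) (θ Δ : ℝ) (hΔ : 0 < Δ) (hΔ1 : Δ ≤ 1)
    (hh : 100 * Real.log (2 / Δ) ≤ 2 ^ h) (E : (MemWire h n L → Bool) → Prop)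
    (hE : ∀ ω : InWire h (2 * n) → Bool,
      (∀ c i, ω (Sum.inr (c, i)) = D.digit c ((2 * n : ℕ) - e - i)) →
      (∀ u < 2 * n, SignBit (signFun h (2 * n) false u ω)
        (Real.cos ((2 ^ (2 * n - 1 - u) : ℕ) * θ))) →
      (∀ u < 2 * n, SignBit (signFun h (2 * n) true u ω)
        (Real.sin ((2 ^ (2 * n - 1 - u) : ℕ) * θ))) →
      E (Sum.elim ω fun _ => false)) :
    1 - 2 * Δ ≤ productProb (memOutcome D h n L e θ) E := by
  have h0 : ∀ w b, 0 ≤ memOutcome D h n L e θ w b :=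
    outcome_nonneg D _ _ _ testPhase_norm _ _ _ _
  have hP : ∀ w, ∑ b, memOutcome D h n L e θ w b = 1 := sum_outcome D _ _ _ _ _ _ _
  have h1 := productProb_not (memOutcome D h n L e θ) hP E
  suffices h2 : productProb (memOutcome D h n L e θ) (fun κ => ¬ E κ) ≤ 2 * Δ by linarith
  set t : ℕ × Bool → ℝ := fun ut => if ut.2 then Real.sin ((2 ^ (2 * n - 1 - ut.1) : ℕ) * θ)
    else Real.cos ((2 ^ (2 * n - 1 - ut.1) : ℕ) * θ) with ht
  -- the union bound over all steps `u` and both kinds of tests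
  have h3 : productProb (memOutcome D h n L e θ) (fun κ => ¬ E κ) ≤
      productProb (memOutcome D h n L e θ) (fun κ => ∃ ut ∈ Finset.range (2 * n) ×ˢ Finset.univ,
        ¬ SignBit (signFun h (2 * n) ut.2 ut.1 (fun i => κ (Sum.inl i))) (t ut)) := by
    refine productProb_mono _ h0 fun κ hκ hne => ?_
    by_contra hcon
    push Not at hcon
    obtain ⟨hd, hz⟩ := eq_of_memOutcome_ne_zero D e θ κ hκ
    refine hne ?_
    have hκ' : κ = Sum.elim (fun i => κ (Sum.inl i)) fun _ => false := by
      funext w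
      rcases w with w | w
      · rfl
      · exact hz w
    rw [hκ']
    refine hE _ hd (fun u hu => ?_) fun u hu => ?_
    · simpa [ht] using hcon (u, false) (by simpa using hu)
    · simpa [ht] using hcon (u, true) (by simpa using hu)
  refine h3.trans ((productProb_exists_le _ h0 _ _).trans ?_)
  have h4 : ∀ ut ∈ Finset.range (2 * n) ×ˢ (Finset.univ : Finset Bool),
      productProb (memOutcome D h n L e θ)
        (fun κ => ¬ SignBit (signFun h (2 * n) ut.2 ut.1 (fun i => κ (Sum.inl i))) (t ut))
      ≤ (49 / 50) ^ reps h ut.1 := by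
    rintro ⟨u, b⟩ hu
    have hu : u < 2 * n := by simpa using hu
    set g : Fin (reps h u) ↪ MemWire h n L :=
      ⟨fun r => testEmb h n L ⟨⟨u, hu⟩, b, r⟩, fun r r' hr => by
        simpa using (testEmb h n L).injective hr⟩ with hg
    have h5 := productProb_not_signBit_le (memOutcome D h n L e θ) h0 hP (Finset.univ.map g)
      (t (u, b)) (fun w hw b' => by
        obtain ⟨r, -, rfl⟩ := Finset.mem_map.1 hw
        exact memOutcome_test D e θ ⟨u, hu⟩ b r b')
      (fun κ => signFun h (2 * n) b u (fun i => κ (Sum.inl i))) (fun κ => by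
        simp only [signFun, dif_pos hu]
        exact card_majority (reps_add_one h u) _ g _ κ fun r => rfl)
    rwa [Finset.card_map, Finset.card_univ, Fintype.card_fin] at h5
  refine (Finset.sum_le_sum h4).trans ?_
  rw [Finset.sum_product_right]
  have h6 := sum_failure_le h (2 * n) Δ hΔ hΔ1 hh
  rw [Fintype.sum_bool]
  dsimp only [reps]
  linarith

end Success

/-! ### The data -/

section Data

variable {N d k : ℕ}

theorem code_injective (n : ℕ) : Function.Injective (code n) := by
  intro i j hij
  refine Fin.ext (Nat.eq_of_testBit_eq fun b => ?_)
  by_cases hb : b < Nat.clog 2 n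
  · exact congrFun hij ⟨b, hb⟩
  · have h : ∀ i : Fin n, (i : ℕ) < 2 ^ b := fun i => i.2.trans_le
      ((Nat.le_pow_clog one_lt_two n).trans (Nat.pow_le_pow_right (by norm_num) (by omega)))
    rw [Nat.testBit_lt_two_pow (h i), Nat.testBit_lt_two_pow (h j)]

theorem amplitudeState_code {d : ℕ} (v : EuclideanSpace ℝ (Fin d)) (l : Fin d) :
    amplitudeState v (code d l) = ((v l / ‖v‖ : ℝ) : ℂ) := by
  unfold amplitudeState
  simp [(code_injective d).eq_iff]

theorem amplitudeState_of_not_mem {d : ℕ} (v : EuclideanSpace ℝ (Fin d))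
    (y : Fin (Nat.clog 2 d) → Bool) (hy : ∀ l, y ≠ code d l) : amplitudeState v y = 0 := by
  unfold amplitudeState
  exact Finset.sum_eq_zero fun l _ => if_neg (hy l)

theorem sum_amplitudeState {d : ℕ} (v v' : EuclideanSpace ℝ (Fin d)) :
    ∑ y, star (amplitudeState v y) * amplitudeState v' y
      = ((∑ l, v l * v' l / (‖v‖ * ‖v'‖) : ℝ) : ℂ) := by
  classical
  rw [Complex.ofReal_sum]
  symm
  refine Finset.sum_of_injOn (code d) (code_injective d).injOn (by simp) (fun y _ hy => ?_)
    fun l _ => ?_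
  · rw [amplitudeState_of_not_mem v' y, mul_zero]
    rintro l rfl
    exact hy (by simp)
  · rw [amplitudeState_code, amplitudeState_code]
    simp only [Complex.star_def, Complex.conj_ofReal, ← Complex.ofReal_mul]
    congr 1
    rw [div_mul_div_comm]

/-- The product of the norms and the overlap is the weighted inner product, also if one of the
vectors is zero. -/
theorem norm_mul_overlap (x : Fin N → EuclideanSpace ℝ (Fin d)) (w : EuclideanSpace ℝ (Fin d))
    (c : Fin k → EuclideanSpace ℝ (Fin d)) (A : QuantumAccess x)
    (B : QuantumAccess fun j => weightedCentroid w (c j)) (i : Fin N) (j : Fin k) :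
    ‖x i‖ * ‖weightedCentroid w (c j)‖ *
      overlap (fun a => ((blockData A B (code N i) (code k j)).prep a).1)
      = weightedInner w (x i) (c j) := by
  have h1 : weightedInner w (x i) (c j) = ∑ l, x i l * weightedCentroid w (c j) l := by
    unfold weightedInner weightedCentroid
    refine Finset.sum_congr rfl fun l _ => ?_
    simp only
    ring
  rw [h1]
  by_cases hx : x i = 0
  · simp [hx]
  by_cases hc : weightedCentroid w (c j) = 0
  · simp [hc]
  have h2 : overlap (fun a => ((blockData A B (code N i) (code k j)).prep a).1)
      = ∑ l, x i l * weightedCentroid w (c j) l / (‖x i‖ * ‖weightedCentroid w (c j)‖) := by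
    unfold overlap
    simp only [blockData, cond_true, cond_false]
    simp only [A.prepare_spec i hx, B.prepare_spec j hc]
    rw [sum_amplitudeState, Complex.ofReal_re]
  rw [h2, ← Finset.sum_div, mul_div_cancel₀]
  exact mul_ne_zero (norm_ne_zero_iff.2 hx) (norm_ne_zero_iff.2 hc)

theorem norm_le_sqrt_maxSqNorm (x : Fin N → EuclideanSpace ℝ (Fin d)) (i : Fin N) :
    ‖x i‖ ≤ Real.sqrt (maxSqNorm x) :=
  Real.le_sqrt_of_sq_le (le_ciSup (f := fun i => ‖x i‖ ^ 2) (Set.finite_range _).bddAbove i)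

theorem norm_weightedCentroid_le (w c : EuclideanSpace ℝ (Fin d)) (hw : ‖w‖ = 1) :
    ‖weightedCentroid w c‖ ≤ ‖c‖ := by
  rw [EuclideanSpace.norm_eq, EuclideanSpace.norm_eq]
  refine Real.sqrt_le_sqrt (Finset.sum_le_sum fun l _ => ?_)
  have h1 : ‖w l‖ ≤ 1 := hw ▸ PiLp.norm_apply_le w l
  simp only [weightedCentroid, norm_mul, mul_pow]
  exact mul_le_of_le_one_left (sq_nonneg _) (pow_le_one₀ (norm_nonneg _) h1)

theorem abs_weightedInner_le (x : Fin N → EuclideanSpace ℝ (Fin d))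
    (w c : EuclideanSpace ℝ (Fin d)) (hw : ‖w‖ = 1) (hc : ‖c‖ ^ 2 ≤ maxSqNorm x) (i : Fin N) :
    |weightedInner w (x i) c| ≤ maxSqNorm x := by
  have h1 : weightedInner w (x i) c = inner ℝ (x i) (weightedCentroid w c) := by
    rw [PiLp.inner_apply]
    unfold weightedInner weightedCentroid
    refine Finset.sum_congr rfl fun l _ => ?_
    simp
    ring
  rw [h1]
  refine (abs_real_inner_le_norm _ _).trans ?_
  have h2 := norm_le_sqrt_maxSqNorm x i
  have h3 := (norm_weightedCentroid_le w c hw).trans (Real.le_sqrt_of_sq_le hc)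
  have h4 : 0 ≤ maxSqNorm x := (sq_nonneg _).trans hc
  calc _ ≤ Real.sqrt (maxSqNorm x) * Real.sqrt (maxSqNorm x) := by gcongr
    _ = _ := Real.mul_self_sqrt h4

end Data

/-! ### From one block to the whole circuit -/

section Assembly

variable {V : Type} [Fintype V] {p a : ℕ}

theorem relabel_zeroState (ε : V ≃ OutWire p a) :
    relabel ε (zeroState V) = zeroState (OutWire p a) := by
  funext y
  have h : (fun v => y (ε v)) = (fun _ => false) ↔ y = fun _ => false := by
    refine ⟨fun h => ?_, fun h => by rw [h]⟩
    funext v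
    simpa using congrFun h (ε.symm v)
  simp only [relabel, zeroState, h]

variable [DecidableEq V]

theorem sum_relabel (ε : V ≃ OutWire p a) (φ : QState V) :
    ∑ y, ‖relabel ε φ y‖ ^ 2 = ∑ y, ‖φ y‖ ^ 2 :=
  (Equiv.arrowCongr ε.symm (Equiv.refl Bool)).sum_comp (fun y => ‖φ y‖ ^ 2)

/-- A labelling of the qubits of a block that puts given qubits into the value register. -/
theorem exists_labelling (val : Fin (p + 1) ↪ V) :
    ∃ (a : ℕ) (ε : V ≃ OutWire p a), ∀ b, ε (val b) = Sum.inl b := by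
  classical
  let e₁ : {v // v ∈ Set.range val} ≃ Fin (p + 1) := (Equiv.ofInjective val val.injective).symm
  let e₂ := Fintype.equivFin {v // ¬ v ∈ Set.range val}
  refine ⟨_, (Equiv.sumCompl (· ∈ Set.range val)).symm.trans (Equiv.sumCongr e₁ e₂), fun b => ?_⟩
  have h : (Equiv.sumCompl (· ∈ Set.range val)).symm (val b) = Sum.inl ⟨val b, b, rfl⟩ :=
    Equiv.sumCompl_symm_apply_of_pos (p := (· ∈ Set.range val)) ⟨b, rfl⟩
  rw [Equiv.trans_apply, h, Equiv.sumCongr_apply, Sum.map_inl]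
  congr 1
  exact Equiv.ofInjective_symm_apply val.injective b

open Classical in
/-- A circuit on one block that gives a good estimate gives the quantum algorithm. -/
theorem estimatesWithin_of_block {N d k : ℕ} {T Tc η ε Δ bound : ℝ} (hT : Tc ≤ T)
    (val : Fin (p + 1) ↪ V) (f : ℤ) (P : List (BlockGate (Nat.clog 2 d) V))
    (hP : k * blockTime T P ≤ bound)
    (h : ∀ (x : Fin N → EuclideanSpace ℝ (Fin d)) (w : EuclideanSpace ℝ (Fin d))
      (c : Fin k → EuclideanSpace ℝ (Fin d)),
      maxSqNorm x = η → ‖w‖ = 1 → (∀ j, ‖c j‖ ^ 2 ≤ maxSqNorm x) →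
      ∀ (A : QuantumAccess x) (B : QuantumAccess fun j => weightedCentroid w (c j)) i j,
        ∑ y, ‖blockRun (blockData A B (code N i) (code k j)) P (zeroState V) y‖ ^ 2 = 1 ∧
        1 - 2 * Δ ≤ ∑ y : V → Bool,
          if |fixedPoint f (fun b => y (val b)) - weightedInner w (x i) (c j)| ≤ ε then
            ‖blockRun (blockData A B (code N i) (code k j)) P (zeroState V) y‖ ^ 2 else 0) :
    EstimatesWithin N d k T Tc η ε Δ bound := by
  obtain ⟨a, lab, hlab⟩ := exists_labelling val
  refine ⟨p, a, f, allBlocks lab P (List.finRange k),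
    (allBlocks_time_le lab P _ hT).trans (by simpa using hP), ?_⟩
  intro x w c hx hw hc A B
  refine ⟨fun i j => relabel lab (blockRun (blockData A B (code N i) (code k j)) P (zeroState V)),
    ?_, fun i j => ?_⟩
  · rw [run_allBlocks A B lab P (List.finRange k) (List.nodup_finRange k) (zeroState V)]
    · simp
    · intro i j _
      rw [relabel_zeroState]
  · obtain ⟨h1, h2⟩ := h x w c hx hw hc A B i j
    refine ⟨by rw [sum_relabel, h1], h2.trans (le_of_eq ?_)⟩
    unfold probClose
    rw [← (Equiv.arrowCongr lab.symm (Equiv.refl Bool)).sum_comp]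
    refine Finset.sum_congr rfl fun y _ => ?_
    have h3 : (fun b => (Equiv.arrowCongr lab.symm (Equiv.refl Bool)) y (val b))
        = fun b => y (Sum.inl b) := by
      funext b
      simp [Equiv.arrowCongr, hlab]
    rw [h3]
    rfl

/-- If the estimate `0` is good enough, or the required probability is not positive, no computation
is necessary. -/
theorem estimatesWithin_of_trivial {N d k : ℕ} {T Tc η ε Δ bound : ℝ} (hT : Tc ≤ T)
    (hb : 0 ≤ bound) (hΔ : 0 ≤ Δ) (h : η ≤ ε ∨ 1 / 2 ≤ Δ) :
    EstimatesWithin N d k T Tc η ε Δ bound := by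
  classical
  refine estimatesWithin_of_block (V := Fin 1) (p := 0) hT (Function.Embedding.refl _) 0 []
    (by simpa [blockTime] using hb) fun x w c hx hw hc A B i j => ?_
  have h0 : ∀ y : Fin 1 → Bool, ‖zeroState (Fin 1) y‖ ^ 2
      = if y = (fun _ => false) then (1 : ℝ) else 0 := by
    intro y
    unfold zeroState
    split_ifs <;> simp
  simp only [blockRun, List.foldl_nil, h0]
  refine ⟨by simp, ?_⟩
  rcases h with h | h
  · rw [Finset.sum_eq_single (fun _ => false)]
    · have h1 := abs_weightedInner_le x w (c j) hw (hc j) i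
      rw [if_pos, if_pos rfl]
      · linarith
      · simp only [fixedPoint]
        simpa using h1.trans (hx.le.trans h)
    · intro y _ hy
      simp [hy]
    · simp
  · refine le_trans (by linarith) (Finset.sum_nonneg fun y _ => ?_)
    split_ifs <;> norm_num

end Assembly

/-! ### The running time -/

section Time

theorem sum_two_pow_le (n : ℕ) :
    ∑ u ∈ Finset.range (2 * n), (2 : ℝ) ^ (u / 2) * 2 ^ (2 * n - 1 - u) ≤ 3 / 2 * 4 ^ n := by
  have h1 : ∀ j : ℕ, ∑ u ∈ Finset.range (2 * j), (2 : ℝ) ^ (u / 2) * (1 / 2) ^ u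
      = 3 * (1 - (1 / 2) ^ j) := by
    intro j
    induction j with
    | zero => simp
    | succ j ih =>
      have h2 : 2 * j / 2 = j := by omega
      have h3 : (2 * j + 1) / 2 = j := by omega
      have h4 : (2 : ℝ) ^ j * (1 / 2) ^ j = 1 := by rw [← mul_pow]; norm_num
      rw [Nat.mul_succ, Finset.sum_range_succ, Finset.sum_range_succ, ih, h2, h3, pow_succ,
        pow_succ, two_mul j, pow_add]
      linear_combination (3 / 2 * (1 / 2 : ℝ) ^ j) * h4
  have h2 : ∀ u ∈ Finset.range (2 * n), (2 : ℝ) ^ (u / 2) * 2 ^ (2 * n - 1 - u)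
      = 4 ^ n / 2 * (2 ^ (u / 2) * (1 / 2) ^ u) := by
    intro u hu
    have hu := Finset.mem_range.1 hu
    have h3 : (2 : ℝ) ^ (2 * n - 1 - u) * 2 ^ u * 2 = 4 ^ n := by
      rw [← pow_add, ← pow_succ, show 2 * n - 1 - u + u + 1 = 2 * n by omega, pow_mul]
      norm_num
    have h4 : (2 : ℝ) ^ u * (1 / 2) ^ u = 1 := by rw [← mul_pow]; norm_num
    rw [← h3]
    linear_combination (-(2 : ℝ) ^ (u / 2) * 2 ^ (2 * n - 1 - u)) * h4
  rw [Finset.sum_congr rfl h2, ← Finset.mul_sum, h1]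
  have h5 : (0 : ℝ) ≤ (1 / 2) ^ n := by positivity
  have h6 : (0 : ℝ) ≤ 4 ^ n := by positivity
  nlinarith

/-- The tests take time `O(T 2 ^ h 4 ^ n)`: the fewer repetitions a test has, the higher is the
power of the rotation that it uses. -/
theorem tests_time_le (h n L : ℕ) (T G : ℝ) (hT : 1 ≤ T) (hG : G ≤ 16 * T) :
    ∑ w ∈ testSet h n L, (3 + (testPower w : ℝ) * G) ≤ 114 * (T * 2 ^ h * 4 ^ n) := by
  have h1 : ∑ w ∈ testSet h n L, (3 + (testPower w : ℝ) * G)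
      = ∑ u : Fin (2 * n), ∑ _tr : Bool × Fin (reps h u),
          (3 + ((2 ^ (2 * n - 1 - (u : ℕ)) : ℕ) : ℝ) * G) := by
    rw [testSet, Finset.sum_map, Fintype.sum_sigma]
    rfl
  have h2 : ∀ u : ℕ, (reps h u : ℝ) ≤ 2 * 2 ^ h * 2 ^ (u / 2) := by
    intro u
    have : reps h u ≤ 2 ^ (h + u / 2 + 1) := Nat.sub_le _ _
    calc (reps h u : ℝ) ≤ ((2 ^ (h + u / 2 + 1) : ℕ) : ℝ) := by exact_mod_cast this
      _ = _ := by push_cast; ring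
  have h3 : ∀ u : ℕ, (2 * (reps h u : ℝ)) * (3 + ((2 ^ (2 * n - 1 - u) : ℕ) : ℝ) * G)
      ≤ 76 * T * 2 ^ h * (2 ^ (u / 2) * 2 ^ (2 * n - 1 - u)) := by
    intro u
    have h4 : (1 : ℝ) ≤ 2 ^ (2 * n - 1 - u) := one_le_pow₀ (by norm_num)
    have h5 : 3 + ((2 ^ (2 * n - 1 - u) : ℕ) : ℝ) * G ≤ 19 * T * 2 ^ (2 * n - 1 - u) := by
      push_cast
      nlinarith
    calc _ ≤ (2 * (2 * 2 ^ h * 2 ^ (u / 2))) * (19 * T * (2 : ℝ) ^ (2 * n - 1 - u)) := by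
          refine (mul_le_mul_of_nonneg_left h5 (by positivity)).trans ?_
          refine mul_le_mul_of_nonneg_right ?_ (by positivity)
          linarith [h2 u]
      _ = _ := by ring
  have h4 : ∀ u : Fin (2 * n), ∑ _tr : Bool × Fin (reps h u),
      (3 + ((2 ^ (2 * n - 1 - (u : ℕ)) : ℕ) : ℝ) * G)
      ≤ 76 * T * 2 ^ h * (2 ^ ((u : ℕ) / 2) * 2 ^ (2 * n - 1 - (u : ℕ))) := by
    intro u
    rw [Finset.sum_const, Finset.card_univ, Fintype.card_prod, Fintype.card_bool, Fintype.card_fin,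
      nsmul_eq_mul, Nat.cast_mul]
    exact h3 u
  rw [h1]
  refine (Finset.sum_le_sum fun u _ => h4 u).trans ?_
  rw [Fin.sum_univ_eq_sum_range
    (fun u => 76 * T * 2 ^ h * ((2 : ℝ) ^ (u / 2) * 2 ^ (2 * n - 1 - u))), ← Finset.mul_sum]
  calc _ ≤ 76 * T * 2 ^ h * (3 / 2 * 4 ^ n : ℝ) := by
        gcongr
        exact sum_two_pow_le n
    _ = _ := by ring

theorem program_length_le (h n : ℕ) (hn : 2 ≤ n) :
    1 + 2 * (2 * n * (2 ^ (h + n + 1) * 5)) + (2 * n * 5 + 4 * ((8 * n + 3) * (4 * 2 ^ n)) +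
      4 * ((8 * n + 3) * ((8 * n + 3) * 6)) + (8 * n + 3) * 7) + (8 * n + 3)
      ≤ 1800 * (2 ^ h * 4 ^ n) := by
  have h1 : n + 1 ≤ 2 ^ n := Nat.lt_two_pow_self
  have h2 : 1 ≤ 2 ^ h := Nat.one_le_two_pow
  have h3 : (4 : ℕ) ^ n = 2 ^ n * 2 ^ n := by rw [← mul_pow]; norm_num
  have h4 : 2 ^ (h + n + 1) = 2 * (2 ^ h * 2 ^ n) := by ring
  rw [h3, h4]
  generalize 2 ^ n = X at *
  generalize 2 ^ h = H at *
  have hQ : 8 * n + 3 ≤ 8 * X := by omega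
  generalize 8 * n + 3 = Q at *
  have h5 : Q * (4 * X) ≤ 8 * X * (4 * X) := Nat.mul_le_mul_right _ hQ
  have h6 : Q * (Q * 6) ≤ 8 * X * (8 * X * 6) :=
    Nat.mul_le_mul hQ (Nat.mul_le_mul_right _ hQ)
  have h7 : X ≤ X * X := Nat.le_mul_self X
  have h8 : X * X ≤ H * (X * X) := Nat.le_mul_of_pos_left _ h2
  have h9 : n * (H * X) ≤ H * (X * X) := by
    calc n * (H * X) ≤ X * (H * X) := Nat.mul_le_mul_right _ (by omega)
      _ = H * (X * X) := by ring
  have h10 : 1 ≤ X := by omega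
  nlinarith

end Time

/-! ### The algorithm -/

section Main

/-- The estimation with parameters `n` (the number of digits is `2 n`), `h` (the logarithm of the
number of repetitions) and `e` (the size of the norms). -/
theorem estimatesWithin_of_parameters {N d k : ℕ} {T Tc η ε Δ : ℝ} (hT : 1 ≤ T)
    (hm : (Nat.clog 2 d : ℝ) ≤ T) (hTc : Tc ≤ T) (hη : 0 ≤ η) (hΔ : 0 < Δ) (hΔ1 : Δ ≤ 1)
    (n h : ℕ) (e : ℤ) (hn : 2 ≤ n) (hh : 100 * Real.log (2 / Δ) ≤ 2 ^ h)
    (he : Real.sqrt η < 2 ^ e) (he' : (2 : ℝ) ^ e ≤ 2 * Real.sqrt η) (hε : 12 * η / 4 ^ n ≤ ε) :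
    EstimatesWithin N d k T Tc η ε Δ (k * (2000 * (T * 2 ^ h * 4 ^ n))) := by
  -- `8 n + 3` digits hold the product of four numbers below `2 ^ (2 n)`, a sum, and a sign
  obtain ⟨L, ops, out, hlen, hout⟩ :=
    (computes_resultFun h n (8 * n + 3) hn (by omega)).exists_flips
  obtain ⟨P, hP, hP'⟩ := exists_blockCircuit (m := Nat.clog 2 d) (T := T) (testSet h n L)
    (digitSet h n L) (fun w => not_mem_digitSet) testPhase testPhase_norm testPower digitSource
    (digitWeight e) ops
  let val : Fin (8 * n + 2 + 1) ↪ SysWire (Nat.clog 2 d) (MemWire h n L) :=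
    out.trans (Function.Embedding.inr.trans Function.Embedding.inl)
  refine estimatesWithin_of_block hTc val (2 * ((2 * n : ℕ) - e) + 2 * (2 * n : ℕ)) P ?_
    fun x w c hx hw hc A B i j => ?_
  · refine mul_le_mul_of_nonneg_left (hP.trans ?_) (Nat.cast_nonneg k)
    have h1 := tests_time_le h n L T (4 * T + 2 * (Nat.clog 2 d : ℕ) + 10) hT (by linarith)
    have h2 : (ops.length : ℝ) ≤ 1800 * (2 ^ h * 4 ^ n) := by
      exact_mod_cast hlen.trans (program_length_le h n hn)
    have h3 : ((digitSet h n L).card : ℝ) = 4 * n := by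
      simp [digitSet]
      ring
    have h4 : (n : ℝ) ≤ 4 ^ n := by exact_mod_cast (Nat.lt_pow_self (by norm_num : 1 < 4)).le
    have h5 : (1 : ℝ) ≤ 2 ^ h := one_le_pow₀ (by norm_num)
    have h6 : (1 : ℝ) ≤ 4 ^ n := one_le_pow₀ (by norm_num)
    have h7 : (4 : ℝ) ^ n ≤ 2 ^ h * 4 ^ n := le_mul_of_one_le_left (by linarith) h5
    have h8 : (2 : ℝ) ^ h * 4 ^ n ≤ T * (2 ^ h * 4 ^ n) :=
      le_mul_of_one_le_left (by positivity) hT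
    have h9 : (n : ℝ) * T ≤ 2 ^ h * 4 ^ n * T := by
      refine mul_le_mul_of_nonneg_right ?_ (by linarith)
      linarith
    rw [h3]
    linarith
  · set D := blockData A B (code N i) (code k j) with hD
    obtain ⟨θ₁, θ₂, p₁, p₂, hp₁, hp₂, hp, ho₁, ho₂, hE⟩ := hP' D
    refine ⟨?_, ?_⟩
    · have h1 := hE fun _ => True
      simp only [if_true] at h1
      rw [h1, productProb_true _ (sum_outcome _ _ _ _ _ _ _ _),
        productProb_true _ (sum_outcome _ _ _ _ _ _ _ _)]
      linarith
    · have h1 := hE fun κ => |fixedPoint (2 * ((2 * n : ℕ) - e) + 2 * (2 * n : ℕ))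
        (fun b : Fin (8 * n + 2 + 1) => κ (Sum.inr (out b))) - weightedInner w (x i) (c j)| ≤ ε
      refine le_trans ?_ h1.symm.le
      set r : Bool → ℝ := fun b => cond b ‖weightedCentroid w (c j)‖ ‖x i‖ with hr
      have hdig : ∀ b s, D.digit b s = binaryDigit (r b) s := by
        intro b s
        cases b
        · exact A.normDigit_spec i s
        · exact B.normDigit_spec j s
      have hr0 : ∀ b, 0 ≤ r b := by
        intro b
        cases b <;> exact norm_nonneg _
      have hr1 : ∀ b, r b ≤ Real.sqrt η := by
        intro b
        rw [← hx]
        cases b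
        · exact norm_le_sqrt_maxSqNorm x i
        · exact (norm_weightedCentroid_le w (c j) hw).trans (Real.le_sqrt_of_sq_le (hc j))
      have key : ∀ θ, Real.cos θ = overlap (fun a => (D.prep a).1) →
          1 - 2 * Δ ≤ productProb (memOutcome D h n L e θ) (fun κ =>
            |fixedPoint (2 * ((2 * n : ℕ) - e) + 2 * (2 * n : ℕ))
              (fun b : Fin (8 * n + 2 + 1) => flipForward ops κ (Sum.inr (out b)))
              - weightedInner w (x i) (c j)| ≤ ε) := by
        intro θ hθ
        refine success_probability D e θ Δ hΔ hΔ1 hh _ fun ω hω hC hS => ?_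
        have h2 := resultFun_close h n hn ω θ η e r hη hr0 hr1 he he'
          (fun b i => by rw [hω, hdig]) hC hS
        have h3 : r false * r true * Real.cos θ = weightedInner w (x i) (c j) := by
          rw [hθ]
          exact norm_mul_overlap x w c A B i j
        have h4 : (2 : ℝ) ^ (2 * n) = 4 ^ n := by
          rw [pow_mul]
          norm_num
        rw [h3, h4] at h2
        refine le_trans (le_of_eq ?_) (h2.trans hε)
        congr 2
        unfold fixedPoint
        congr 1
        simp only [hout]
        have h5 := estimate_abs_le n (fun u => signFun h (2 * n) false u ω)
          (fun u => signFun h (2 * n) true u ω) (normFun h (2 * n) false ω)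
          (normFun h (2 * n) true ω) (normFun_nonneg _ _ _ _) (normFun_lt _ _ _ _)
          (normFun_nonneg _ _ _ _) (normFun_lt _ _ _ _)
        have h6 : (2 : ℤ) ^ (8 * n + 1) < 2 ^ (8 * n + 2) :=
          pow_lt_pow_right₀ (by norm_num) (by omega)
        have h7 := abs_le.1 (show |resultFun h n ω| ≤ 2 ^ (8 * n + 1) from h5)
        exact twosComplement_eq (resultFun h n ω) (8 * n + 2) (by linarith) (by linarith)
      have k₁ := mul_le_mul_of_nonneg_left (key θ₁ ho₁) hp₁
      have k₂ := mul_le_mul_of_nonneg_left (key θ₂ ho₂) hp₂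
      have k₃ : 1 - 2 * Δ = p₁ * (1 - 2 * Δ) + p₂ * (1 - 2 * Δ) := by
        rw [← add_mul, hp, one_mul]
      rw [k₃]
      exact add_le_add k₁ k₂

/-- The choice of the parameters. -/
theorem estimatesWithin {N d k : ℕ} {T Tc η ε Δ : ℝ} (hT : 1 ≤ T)
    (hm : (Nat.clog 2 d : ℝ) ≤ T) (hTc : Tc ≤ T) (hη : 0 ≤ η) (hε : 0 < ε) (hΔ : 0 < Δ)
    (hΔ1 : Δ ≤ 1) :
    EstimatesWithin N d k T Tc η ε Δ (60000000 * (T * k * (η / ε) * Real.log (1 / Δ))) := by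
  have hlog : 0 ≤ Real.log (1 / Δ) := Real.log_nonneg ((one_le_div hΔ).2 hΔ1)
  by_cases htriv : η ≤ ε ∨ 1 / 2 ≤ Δ
  · exact estimatesWithin_of_trivial hTc (by positivity) hΔ.le htriv
  push Not at htriv
  obtain ⟨hηε, hΔ2⟩ := htriv
  have hη0 : 0 < η := hε.trans hηε
  have hratio : 1 < η / ε := (one_lt_div hε).2 hηε
  -- as `Δ < 1 / 2`, the number `log (2 / Δ)` is at most `2 log (1 / Δ)`
  have hlog2 : Real.log 2 ≤ Real.log (1 / Δ) :=
    Real.log_le_log (by norm_num) ((le_div_iff₀ hΔ).2 (by linarith))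
  have hlog3 : Real.log (2 / Δ) = Real.log 2 + Real.log (1 / Δ) := by
    rw [← Real.log_mul (by norm_num) (by positivity), mul_one_div]
  have hl2 := Real.log_two_gt_d9
  -- `4 ^ n ≥ 16 η / ε` makes the error `12 η / 4 ^ n` at most `ε`
  obtain ⟨n, hn1, hn2⟩ := exists_nat_pow_near (x := 16 * (η / ε)) (y := 4) (by linarith)
    (by norm_num)
  obtain ⟨h, hh1, hh2⟩ := exists_nat_pow_near (x := 100 * Real.log (2 / Δ)) (y := 2)
    (by rw [hlog3]; linarith) (by norm_num)
  obtain ⟨e, he1, he2⟩ := exists_mem_Ico_zpow (x := Real.sqrt η) (y := 2) (Real.sqrt_pos.2 hη0)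
    (by norm_num)
  have hn0 : n ≠ 0 := by
    rintro rfl
    norm_num at hn2
    linarith
  have hmain := estimatesWithin_of_parameters (N := N) (d := d) (k := k) (Tc := Tc) (ε := ε)
    hT hm hTc hη hΔ hΔ1 (n + 1) (h + 1) (e + 1) (by omega) hh2.le he2
    (by rw [zpow_add_one₀ (by norm_num)]; linarith) (by
      rw [div_le_iff₀ (by positivity)]
      have h1 : ε * (16 * (η / ε)) = 16 * η := by field_simp
      have h2 : ε * (16 * (η / ε)) ≤ ε * 4 ^ (n + 1) := by gcongr
      linarith)
  obtain ⟨p, a, f, P, hP, hP'⟩ := hmain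
  refine ⟨p, a, f, P, hP.trans ?_, hP'⟩
  have h1 : (2 : ℝ) ^ (h + 1) ≤ 400 * Real.log (1 / Δ) := by
    rw [pow_succ]
    linarith
  have h2 : (4 : ℝ) ^ (n + 1) ≤ 64 * (η / ε) := by
    rw [pow_succ]
    linarith
  calc (k : ℝ) * (2000 * (T * 2 ^ (h + 1) * 4 ^ (n + 1)))
      ≤ k * (2000 * (T * (400 * Real.log (1 / Δ)) * (64 * (η / ε)))) := by gcongr
    _ = 51200000 * (T * k * (η / ε) * Real.log (1 / Δ)) := by ring
    _ ≤ 60000000 * (T * k * (η / ε) * Real.log (1 / Δ)) := by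
        refine mul_le_mul_of_nonneg_right (by norm_num) (by positivity)

end Main

end QCentroid

end

theorem mainTheorem6 :
    (∃ C : ℝ, 0 < C ∧
      ∀ (N d k : ℕ) (T Tc η ε Δ : ℝ), 0 < N → 1 ≤ T → (Nat.clog 2 d : ℝ) ≤ T →
        0 ≤ Tc → Tc ≤ T → 0 ≤ η → 0 < ε → 0 < Δ → Δ ≤ 1 →
        QCentroid.EstimatesWithin N d k T Tc η ε Δ
          (C * (T * (k : ℝ) * (η / ε) * Real.log (1 / Δ)))) ∧
    (∃ C : ℝ, 0 < C ∧
      ∀ (N d k l : ℕ) (T Tc η ε Δ : ℝ), 0 < N → 1 ≤ T → (Nat.clog 2 d : ℝ) ≤ T →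
        0 ≤ Tc → Tc ≤ T → 0 ≤ η → 0 < ε → 0 < Δ → Δ ≤ 1 →
        QCentroid.EstimatesWithin N d (k ^ l) T Tc η ε Δ
          (C * (T * (k : ℝ) ^ l * (η / ε) * Real.log (1 / Δ)))) := by
  refine ⟨⟨60000000, by norm_num, fun N d k T Tc η ε Δ _ hT hm _ hTc hη hε hΔ hΔ1 =>
    QCentroid.estimatesWithin hT hm hTc hη hε hΔ hΔ1⟩,
    60000000, by norm_num, fun N d k l T Tc η ε Δ _ hT hm _ hTc hη hε hΔ hΔ1 => ?_⟩
  have h := QCentroid.estimatesWithin (N := N) (k := k ^ l) hT hm hTc hη hε hΔ hΔ1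
  rwa [Nat.cast_pow] at h
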